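/- Let $S$ be a non-empty subset of $\mathbb{N}^* = \{1,2,3,\dots\}$ with $S \neq \{1\}$. Let $a_n$ be the number of crossing-free partitions of $n$ points on a circle, labelled $1,\dots,n$ counterclockwise, all of whose blocks have cardinality in $S$. Here a partition is crossing-free if no chord joining two points of one block crosses a chord joining two points of a different block, and $a_0 = 1$. Let $P(x) = \sum_{n\ge 0} a_n x^n$ be the generating function and let $\gcd(S)$ be the greatest common divisor of all elements of $S$. There is a unique real number $\tau_S > 0$ such that the series $\sum_{s\in S} (s-1)\tau_S^s$ converges with sum $1$; moreover, the series below converge, and the constants \[ \rho_S = \frac{\tau_S}{\sum_{s\in S} s\,\tau_S^s},\qquad \alpha_S = 1+\sum_{s\in S}\tau_S^s,\qquad \beta_S = \sqrt{\frac{2\big(\sum_{s\in S} s\,\tau_S^s\big)^3}{\sum_{s\in S} s(s-1)\,\tau_S^s}} \] are well defined and $\rho_S, \beta_S$ are positive. For $0<\varphi<\pi/2$ and $R>1$, let $\Delta_0(\varphi,R) = \{z\in\mathbb{C} : z\ne 1,\ |z|<R,\ |\mathrm{Arg}(z-1)|>\varphi\}$ and let \[ \Delta = \bigcap_{\xi^{\gcd(S)}=1}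 \rho_S\,\xi\cdot\Delta_0(\varphi,R), \] which is a domain dented at $\rho_S$ (and at its rotations by the $\gcd(S)$-th roots of unity). Then: 1. For some $0<\varphi<\pi/2$ and $R>1$, the series $P(x)$ converges for $|x|<\rho_S$ and extends to an analytic function on $\Delta$, again denoted by $P$, which satisfies \[ P(x) = \alpha_S - \beta_S\sqrt{1-\frac{x}{\rho_S}} + O\Big(1-\frac{x}{\rho_S}\Big)\qquad\text{as } x\to\rho_S,\ x\in\Delta, \] with the principal branch of the square root. 2. As $n\to\infty$ along the multiples of $\gcd(S)$, \[ a_n = \frac{\gcd(S)\,\beta_S}{2\sqrt{\pi}}\; n^{-3/2}\,\rho_S^{-n}\,(1+o(1)). \] 3. $a_n = 0$ whenever $n$ is not a multiple of $\gcd(S)$. -/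

import Mathlib

open Filter Topology Asymptotics

noncomputable section

namespace CrossingFree

/-- A partition of `n` points on a circle, labelled counterclockwise starting from the root, is
crossing-free if no chord joining two points of a block crosses a chord joining two points of a
different block. -/
def IsCrossingFree {n : ℕ} (P : Finpartition (Finset.univ : Finset (Fin n))) : Prop :=
  ∀ U ∈ P.parts, ∀ V ∈ P.parts, U ≠ V →
    ∀ u₁ ∈ U, ∀ u₂ ∈ U, ∀ v₁ ∈ V, ∀ v₂ ∈ V, ¬ (u₁ < v₁ ∧ v₁ < u₂ ∧ u₂ < v₂)

/-- The number of crossing-free partitions of `n` points all of whose block sizes belong to `S`. -/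
def count (S : Set ℕ) (n : ℕ) : ℕ :=
  Nat.card {P : Finpartition (Finset.univ : Finset (Fin n)) //
    IsCrossingFree P ∧ ∀ B ∈ P.parts, B.card ∈ S}

/-- The generating function, by number of points, of the crossing-free partitions with block
sizes in `S`. -/
def genFun (S : Set ℕ) : PowerSeries ℕ := PowerSeries.mk (count S)

/-- The equation `∑_{s ∈ S} (s - 1) t ^ s = 1` (the series being convergent), with `t > 0`. -/
def IsTau (S : Set ℕ) (t : ℝ) : Prop :=
  0 < t ∧ HasSum (fun s : S => (((s : ℕ) : ℝ) - 1) * t ^ (s : ℕ)) 1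

/-- The positive solution of `∑_{s ∈ S} (s - 1) t ^ s = 1`. -/
def tau (S : Set ℕ) : ℝ := Classical.epsilon (IsTau S)

/-- `ρ_S = τ_S / ∑_{s ∈ S} s τ_S ^ s`. -/
def rho (S : Set ℕ) : ℝ := tau S / ∑' s : S, ((s : ℕ) : ℝ) * tau S ^ (s : ℕ)

/-- `α_S = 1 + ∑_{s ∈ S} τ_S ^ s`. -/
def alpha (S : Set ℕ) : ℝ := 1 + ∑' s : S, tau S ^ (s : ℕ)

/-- `β_S = √(2 (∑_{s ∈ S} s τ_S ^ s) ^ 3 / ∑_{s ∈ S} s (s - 1) τ_S ^ s)`. -/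
def beta (S : Set ℕ) : ℝ :=
  Real.sqrt (2 * (∑' s : S, ((s : ℕ) : ℝ) * tau S ^ (s : ℕ)) ^ 3 /
    ∑' s : S, ((s : ℕ) : ℝ) * (((s : ℕ) : ℝ) - 1) * tau S ^ (s : ℕ))

/-- The domain dented at `1` with angle `φ` and radius `R`. -/
def dentedDomain (φ R : ℝ) : Set ℂ :=
  {z | z ≠ 1 ∧ ‖z‖ < R ∧ φ < |Complex.arg (z - 1)|}

/-- The disc dented at all the points `ρ ξ` with `ξ ^ d = 1`, that is, the intersection of the
sets `ρ ξ · dentedDomain φ R`. For `d = 1` it is the domain dented at `ρ`. -/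
def indentedDisc (d : ℕ) (ρ φ R : ℝ) : Set ℂ :=
  {x | ∀ ξ : ℂ, ξ ^ d = 1 → x / ((ρ : ℂ) * ξ) ∈ dentedDomain φ R}

end CrossingFree

end

/-! In a crossing-free partition, cut after each element of the block of the root. Every gap carries
an arbitrary crossing-free partition, so a root block of size `s` contributes `(x P) ^ s`, and `P =
1 + ∑_{s ∈ S} (x P) ^ s` (`card_rooted`, `count_of_pos`, `IsAdmissible.hasSum_mul_pow`). The
equation for `τ` gives `∑ s τ ^ s = 1 + ∑ τ ^ s = α`, hence `ρ α = τ`. The weights `1 / α` at `0`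
and `τ ^ s / α` at `s ∈ S` then form a probability law of mean `1`, that is, a critical offspring
law.

With `d = gcd S`, write `P(ρ w) = α Q(w ^ d)`. Then `Q(z) = pgf(z Q(z) ^ d)`, and `v = z Q ^ d`
solves `v = z Φ(v)` with `Φ = pgf ^ d` and `Φ(1) = Φ'(1) = 1`. Passing to `z = w ^ d` removes the
periodicity: on the unit circle only `z = 1` is critical (`IsCritical.noncritical`). Elsewhere on
the circle `v` is a local inverse of `u / Φ(u)`, hence analytic
(`exists_analyticAt_of_noncritical`). At `1` the inversion is quadratic, and `v` is an analytic
function of `√(1 - z)` (`exists_sqrt_expansion_of_critical`). Compactness of the circle glues these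
local continuations on the plane slit along `[1, ∞)` (`CrossingFree.exists_continuation`), and
substituting `z = (x / ρ) ^ d` gives the dented domain.

The coefficients need no contour integral. After subtraction of the terms in `√(1 - z)` and `√(1 -
z) ^ 3`, the second derivative is bounded on the unit disc, so the remaining coefficients are
`O(n⁻²)`. Those of `√(1 - z)` come from the limit formula for `Γ(-1/2)`
(`tendsto_coeff_of_sqrt_singularity`). -/

namespace CrossingFree

/-! ### Crossing-free partitions of finite subsets of a linear order -/

variable {α β : Type*} [LinearOrder α] [LinearOrder β]

/-- `C` is the set of blocks of a crossing-free partition of the finite set `A`. -/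
structure IsNC (A : Finset α) (C : Finset (Finset α)) : Prop where
  nonempty : ∀ U ∈ C, U.Nonempty
  cover : ∀ x, x ∈ A ↔ ∃ U ∈ C, x ∈ U
  disj : ∀ U ∈ C, ∀ V ∈ C, ∀ x ∈ U, x ∈ V → U = V
  nc : ∀ U ∈ C, ∀ V ∈ C, ∀ a ∈ U, ∀ b ∈ V, ∀ c ∈ U, ∀ d ∈ V, a < b → b < c → c < d → U = V

theorem IsNC.subset {A : Finset α} {C : Finset (Finset α)} (h : IsNC A C) {U : Finset α}
    (hU : U ∈ C) : U ⊆ A := fun x hx => (h.cover x).2 ⟨U, hU, hx⟩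

theorem IsNC.union {A₁ A₂ : Finset α} {C₁ C₂ : Finset (Finset α)} (h₁ : IsNC A₁ C₁)
    (h₂ : IsNC A₂ C₂) (h : ∀ a ∈ A₁, ∀ b ∈ A₂, a < b) : IsNC (A₁ ∪ A₂) (C₁ ∪ C₂) where
  nonempty U hU := (Finset.mem_union.1 hU).elim (h₁.nonempty U) (h₂.nonempty U)
  cover x := by
    rw [Finset.mem_union, h₁.cover, h₂.cover]
    simp only [Finset.mem_union]
    grind
  disj U hU V hV x hxU hxV := by
    rcases Finset.mem_union.1 hU with hU | hU <;> rcases Finset.mem_union.1 hV with hV | hV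
    · exact h₁.disj U hU V hV x hxU hxV
    · exact absurd (h x (h₁.subset hU hxU) x (h₂.subset hV hxV)) (lt_irrefl _)
    · exact absurd (h x (h₁.subset hV hxV) x (h₂.subset hU hxU)) (lt_irrefl _)
    · exact h₂.disj U hU V hV x hxU hxV
  nc U hU V hV a ha b hb c hc d hd hab hbc hcd := by
    rcases Finset.mem_union.1 hU with hU | hU <;> rcases Finset.mem_union.1 hV with hV | hV
    · exact h₁.nc U hU V hV a ha b hb c hc d hd hab hbc hcd
    · exact absurd (h c (h₁.subset hU hc) b (h₂.subset hV hb)) hbc.not_gt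
    · exact absurd (h b (h₁.subset hV hb) a (h₂.subset hU ha)) hab.not_gt
    · exact h₂.nc U hU V hV a ha b hb c hc d hd hab hbc hcd

theorem IsNC.restrict {A A' : Finset α} {C : Finset (Finset α)} (h : IsNC A C) (hA : A' ⊆ A)
    (hC : ∀ U ∈ C, ∀ x ∈ U, x ∈ A' → U ⊆ A') : IsNC A' (C.filter (· ⊆ A')) where
  nonempty U hU := h.nonempty U (Finset.mem_filter.1 hU).1
  cover x := by
    constructor
    · intro hx
      obtain ⟨U, hU, hxU⟩ := (h.cover x).1 (hA hx)
      exact ⟨U, Finset.mem_filter.2 ⟨hU, hC U hU x hxU hx⟩, hxU⟩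
    · rintro ⟨U, hU, hxU⟩
      exact (Finset.mem_filter.1 hU).2 hxU
  disj U hU V hV := h.disj U (Finset.mem_filter.1 hU).1 V (Finset.mem_filter.1 hV).1
  nc U hU V hV := h.nc U (Finset.mem_filter.1 hU).1 V (Finset.mem_filter.1 hV).1

theorem IsNC.image {A : Finset α} {C : Finset (Finset α)} (h : IsNC A C) {f : α → β}
    (hf : StrictMonoOn f A) : IsNC (A.image f) (C.image (Finset.image f)) where
  nonempty := by
    simp only [Finset.mem_image, forall_exists_index, and_imp, forall_apply_eq_imp_iff₂]
    exact fun U hU => (h.nonempty U hU).image _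
  cover x := by
    simp only [Finset.mem_image, exists_exists_and_eq_and]
    constructor
    · rintro ⟨a, ha, rfl⟩
      obtain ⟨U, hU, haU⟩ := (h.cover a).1 ha
      exact ⟨U, hU, a, haU, rfl⟩
    · rintro ⟨U, hU, a, ha, rfl⟩
      exact ⟨a, h.subset hU ha, rfl⟩
  disj := by
    simp only [Finset.mem_image, forall_exists_index, and_imp, forall_apply_eq_imp_iff₂]
    intro U hU V hV x hx y hy hxy
    obtain rfl : y = x := hf.injOn (h.subset hV hy) (h.subset hU hx) hxy
    rw [h.disj U hU V hV y hx hy]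
  nc := by
    simp only [Finset.mem_image, forall_exists_index, and_imp, forall_apply_eq_imp_iff₂]
    intro U hU V hV a ha b hb c hc d hd hab hbc hcd
    rw [h.nc U hU V hV a ha b hb c hc d hd
      ((hf.lt_iff_lt (h.subset hU ha) (h.subset hV hb)).1 hab)
      ((hf.lt_iff_lt (h.subset hV hb) (h.subset hU hc)).1 hbc)
      ((hf.lt_iff_lt (h.subset hU hc) (h.subset hV hd)).1 hcd)]

theorem IsNC.preimage {A : Finset α} {f : α → β} (hf : StrictMonoOn f A)
    {D : Finset (Finset β)} (h : IsNC (A.image f) D) :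
    IsNC A (D.image fun V => A.filter (f · ∈ V)) where
  nonempty := by
    simp only [Finset.mem_image, forall_exists_index, and_imp, forall_apply_eq_imp_iff₂]
    intro V hV
    obtain ⟨y, hy⟩ := h.nonempty V hV
    obtain ⟨x, hx, rfl⟩ := Finset.mem_image.1 (h.subset hV hy)
    exact ⟨x, Finset.mem_filter.2 ⟨hx, hy⟩⟩
  cover x := by
    simp only [Finset.mem_image, exists_exists_and_eq_and, Finset.mem_filter]
    constructor
    · intro hx
      obtain ⟨V, hV, hxV⟩ := (h.cover (f x)).1 (Finset.mem_image_of_mem f hx)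
      exact ⟨V, hV, hx, hxV⟩
    · rintro ⟨V, hV, hx, -⟩
      exact hx
  disj := by
    simp only [Finset.mem_image, forall_exists_index, and_imp, forall_apply_eq_imp_iff₂,
      Finset.mem_filter]
    intro U hU V hV x _ hx _ hy
    rw [h.disj U hU V hV (f x) hx hy]
  nc := by
    simp only [Finset.mem_image, forall_exists_index, and_imp, forall_apply_eq_imp_iff₂,
      Finset.mem_filter]
    intro U hU V hV a hA ha b hB hb c hC hc d hD hd hab hbc hcd
    rw [h.nc U hU V hV _ ha _ hb _ hc _ hd (hf hA hB hab) (hf hB hC hbc) (hf hC hD hcd)]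

open scoped Classical in
/-- The crossing-free partitions of `A` with block sizes in `S`. -/
noncomputable def ncPartitions (S : Set ℕ) (A : Finset α) : Finset (Finset (Finset α)) :=
  A.powerset.powerset.filter fun C => IsNC A C ∧ ∀ U ∈ C, U.card ∈ S

theorem mem_ncPartitions {S : Set ℕ} {A : Finset α} {C : Finset (Finset α)} :
    C ∈ ncPartitions S A ↔ IsNC A C ∧ ∀ U ∈ C, U.card ∈ S := by
  simp only [ncPartitions, Finset.mem_filter, Finset.mem_powerset, and_iff_right_iff_imp]
  exact fun h U hU => Finset.mem_powerset.2 (h.1.subset hU)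

/-- Crossings depend only on the order, so images and preimages of blocks under a strictly monotone
map are mutually inverse. This lets the gaps `Finset.Ico m n` be counted by `count`. -/
theorem card_ncPartitions_image (S : Set ℕ) {A : Finset α} {f : α → β} (hf : StrictMonoOn f A) :
    (ncPartitions S (A.image f)).card = (ncPartitions S A).card := by
  have key : ∀ V ⊆ A.image f, (A.filter (f · ∈ V)).image f = V := by
    intro V hV
    ext y
    simp only [Finset.mem_image, Finset.mem_filter]
    constructor
    · rintro ⟨x, ⟨-, hx⟩, rfl⟩
      exact hx
    · intro hy
      obtain ⟨x, hx, rfl⟩ := Finset.mem_image.1 (hV hy)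
      exact ⟨x, ⟨hx, hy⟩, rfl⟩
  have key' : ∀ U ⊆ A, A.filter (f · ∈ U.image f) = U := by
    intro U hU
    ext x
    simp only [Finset.mem_image, Finset.mem_filter]
    constructor
    · rintro ⟨hx, y, hy, hxy⟩
      rwa [← hf.injOn (hU hy) hx hxy]
    · intro hx
      exact ⟨hU hx, x, hx, rfl⟩
  refine Finset.card_nbij' (fun D => D.image fun V => A.filter (f · ∈ V))
    (fun C => C.image (Finset.image f)) ?_ ?_ ?_ ?_
  · intro D hD
    obtain ⟨h₁, h₂⟩ := mem_ncPartitions.1 hD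
    refine mem_ncPartitions.2 ⟨h₁.preimage hf, ?_⟩
    simp only [Finset.mem_image, forall_exists_index, and_imp, forall_apply_eq_imp_iff₂]
    intro V hV
    have := h₂ V hV
    rw [← key V (h₁.subset hV), Finset.card_image_of_injOn] at this
    · exact this
    · exact hf.injOn.mono fun x hx => (Finset.mem_filter.1 hx).1
  · intro C hC
    obtain ⟨h₁, h₂⟩ := mem_ncPartitions.1 hC
    refine mem_ncPartitions.2 ⟨h₁.image hf, ?_⟩
    simp only [Finset.mem_image, forall_exists_index, and_imp, forall_apply_eq_imp_iff₂]
    intro U hU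
    rw [Finset.card_image_of_injOn (hf.injOn.mono (Finset.coe_subset.2 (h₁.subset hU)))]
    exact h₂ U hU
  · intro D hD
    obtain ⟨h₁, -⟩ := mem_ncPartitions.1 hD
    simp only [Finset.image_image]
    conv_rhs => rw [← Finset.image_id (s := D)]
    exact Finset.image_congr fun V hV => key V (h₁.subset hV)
  · intro C hC
    obtain ⟨h₁, -⟩ := mem_ncPartitions.1 hC
    simp only [Finset.image_image]
    conv_rhs => rw [← Finset.image_id (s := C)]
    exact Finset.image_congr fun U hU => key' U (h₁.subset hU)

theorem isNC_parts_iff {n : ℕ} (P : Finpartition (Finset.univ : Finset (Fin n))) :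
    IsNC Finset.univ P.parts ↔ IsCrossingFree P := by
  constructor
  · intro h U hU V hV hUV a ha c hc b hb d hd hlt
    exact hUV (h.nc U hU V hV a ha b hb c hc d hd hlt.1 hlt.2.1 hlt.2.2)
  · intro h
    refine ⟨fun U hU => P.nonempty_of_mem_parts hU, fun x => ?_, ?_, ?_⟩
    · exact ⟨fun hx => P.exists_mem hx, fun _ => Finset.mem_univ x⟩
    · intro U hU V hV x hx hy
      exact P.eq_of_mem_parts hU hV hx hy
    · intro U hU V hV a ha b hb c hc d hd hab hbc hcd
      by_contra hUV
      exact h U hU V hV hUV a ha c hc b hb d hd ⟨hab, hbc, hcd⟩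

theorem count_eq_card_univ (S : Set ℕ) (n : ℕ) :
    count S n = (ncPartitions S (Finset.univ : Finset (Fin n))).card := by
  rw [count, ← Nat.card_eq_finsetCard]
  refine Nat.card_congr
    { toFun := fun P => ⟨P.1.parts, mem_ncPartitions.2 ⟨(isNC_parts_iff P.1).2 P.2.1, P.2.2⟩⟩
      invFun := fun C =>
        have hC := mem_ncPartitions.1 C.2
        let P : Finpartition (Finset.univ : Finset (Fin n)) :=
          Finpartition.ofExistsUnique C.1 (fun U hU => hC.1.subset hU)
            (fun x hx => by
              obtain ⟨U, hU, hxU⟩ := (hC.1.cover x).1 hx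
              exact ⟨U, ⟨hU, hxU⟩, fun V hV => hC.1.disj V hV.1 U hU x hV.2 hxU⟩)
            (fun h => by simpa using hC.1.nonempty ∅ h)
        ⟨P, (isNC_parts_iff P).1 hC.1, hC.2⟩
      left_inv := fun P => Subtype.ext (Finpartition.ext rfl)
      right_inv := fun C => rfl }

theorem count_eq_card_range (S : Set ℕ) (n : ℕ) :
    count S n = (ncPartitions S (Finset.range n)).card := by
  rw [count_eq_card_univ, ← card_ncPartitions_image S (f := Fin.val)
    (Fin.val_strictMono.strictMonoOn _)]
  congr 2
  ext x
  simp only [Finset.mem_image, Finset.mem_univ, true_and, Finset.mem_range]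
  exact ⟨by rintro ⟨a, rfl⟩; exact a.2, fun h => ⟨⟨x, h⟩, rfl⟩⟩

theorem card_ncPartitions_Ico (S : Set ℕ) (m n : ℕ) :
    (ncPartitions S (Finset.Ico m n)).card = count S (n - m) := by
  rw [count_eq_card_range, ← card_ncPartitions_image S (A := Finset.range (n - m)) (f := (· + m))]
  · congr 2
    ext x
    simp only [Finset.mem_image, Finset.mem_range, Finset.mem_Ico]
    exact ⟨fun h => ⟨x - m, by omega, by omega⟩, by rintro ⟨a, h, rfl⟩; omega⟩
  · exact fun a _ b _ h => Nat.add_lt_add_right h m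


/-! ### Decomposition along the block of the root -/

/-- `B` is the block of `0` (empty if `n = 0`) and `C` the set of the other blocks of a
crossing-free partition of `{0, …, n - 1}`. -/
structure IsRooted (n : ℕ) (B : Finset ℕ) (C : Finset (Finset ℕ)) : Prop where
  subset : B ⊆ Finset.range n
  root : 0 < n → 0 ∈ B
  isNC : IsNC (Finset.range n \ B) C
  gap : ∀ U ∈ C, ∀ b ∈ U, ∀ d ∈ U, ∀ c ∈ B, b < c → c < d → False

open scoped Classical in
/-- The crossing-free partitions of `{0, …, n - 1}` whose block of `0` has size `k`, the other
blocks having sizes in `S`. -/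
noncomputable def rooted (S : Set ℕ) (n k : ℕ) : Finset (Finset ℕ × Finset (Finset ℕ)) :=
  ((Finset.range n).powerset ×ˢ (Finset.range n).powerset.powerset).filter fun p =>
    IsRooted n p.1 p.2 ∧ p.1.card = k ∧ ∀ U ∈ p.2, U.card ∈ S

theorem mem_rooted {S : Set ℕ} {n k : ℕ} {p : Finset ℕ × Finset (Finset ℕ)} :
    p ∈ rooted S n k ↔ IsRooted n p.1 p.2 ∧ p.1.card = k ∧ ∀ U ∈ p.2, U.card ∈ S := by
  simp only [rooted, Finset.mem_filter, Finset.mem_product, Finset.mem_powerset,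
    and_iff_right_iff_imp]
  exact fun h => ⟨h.1.subset, fun U hU => Finset.mem_powerset.2
    ((h.1.isNC.subset hU).trans Finset.sdiff_subset)⟩

/-- The root block is empty only when there are no points, which matches the coefficients of `(x P)
^ 0 = 1`. -/
theorem card_rooted_zero (S : Set ℕ) (n : ℕ) :
    (rooted S n 0).card = if n = 0 then 1 else 0 := by
  split_ifs with hn
  · subst hn
    rw [Finset.card_eq_one]
    refine ⟨(∅, ∅), ?_⟩
    ext ⟨B, C⟩
    rw [mem_rooted, Finset.mem_singleton, Prod.mk.injEq]
    constructor
    · rintro ⟨h, hB, -⟩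
      refine ⟨Finset.card_eq_zero.1 hB, Finset.eq_empty_of_forall_notMem fun U hU => ?_⟩
      obtain ⟨x, hx⟩ := h.isNC.nonempty U hU
      simpa using h.isNC.subset hU hx
    · rintro ⟨rfl, rfl⟩
      exact ⟨⟨by simp, by simp, ⟨by simp, by simp, by simp, by simp⟩, by simp⟩, rfl, by simp⟩
  · rw [Finset.card_eq_zero]
    refine Finset.eq_empty_of_forall_notMem fun p hp => ?_
    obtain ⟨h, hB, -⟩ := mem_rooted.1 hp
    have := h.root (Nat.pos_of_ne_zero hn)
    rw [Finset.card_eq_zero.1 hB] at this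
    simp at this

theorem IsRooted.insert {n j : ℕ} (hj : j < n) {B : Finset ℕ} {C D : Finset (Finset ℕ)}
    (h : IsRooted j B C) (hD : IsNC (Finset.Ico (j + 1) n) D) :
    IsRooted n (insert j B) (C ∪ D) where
  subset := by
    intro x hx
    rcases Finset.mem_insert.1 hx with rfl | hx
    · exact Finset.mem_range.2 hj
    · exact Finset.mem_range.2 ((Finset.mem_range.1 (h.subset hx)).trans hj)
  root _ := by
    rcases Nat.eq_zero_or_pos j with rfl | hj'
    · exact Finset.mem_insert_self _ _
    · exact Finset.mem_insert_of_mem (h.root hj')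
  isNC := by
    have := h.isNC.union hD fun a ha b hb => by
      have h1 := (Finset.mem_sdiff.1 ha).1
      rw [Finset.mem_range] at h1
      rw [Finset.mem_Ico] at hb
      omega
    convert this using 1
    ext x
    have hx : x ∈ B → x < j := fun hx => Finset.mem_range.1 (h.subset hx)
    simp only [Finset.mem_sdiff, Finset.mem_range, Finset.mem_insert, Finset.mem_union,
      Finset.mem_Ico]
    grind
  gap := by
    intro U hU b hb d hd c hc hbc hcd
    rcases Finset.mem_union.1 hU with hU | hU
    · rcases Finset.mem_insert.1 hc with rfl | hc
      · have := (Finset.mem_sdiff.1 (h.isNC.subset hU hd)).1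
        rw [Finset.mem_range] at this
        omega
      · exact h.gap U hU b hb d hd c hc hbc hcd
    · have h1 := Finset.mem_Ico.1 (hD.subset hU hb)
      rcases Finset.mem_insert.1 hc with rfl | hc
      · omega
      · have := Finset.mem_range.1 (h.subset hc)
        omega

/-- An element of the root block separates every other block, by the condition `gap`; this is what
allows cutting at `j`. -/
theorem IsRooted.side {n : ℕ} {B : Finset ℕ} {C : Finset (Finset ℕ)} (h : IsRooted n B C)
    {j : ℕ} (hjB : j ∈ B) {U : Finset ℕ} (hU : U ∈ C) :
    (∀ x ∈ U, x < j) ∨ (∀ x ∈ U, j < x) := by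
  have hne : ∀ x ∈ U, x ≠ j := fun x hx hxj =>
    (Finset.mem_sdiff.1 (h.isNC.subset hU hx)).2 (hxj ▸ hjB)
  by_contra hcon
  push Not at hcon
  obtain ⟨⟨a, ha, hja⟩, b, hb, hbj⟩ := hcon
  exact h.gap U hU b hb a ha j hjB (lt_of_le_of_ne hbj (hne b hb))
    (lt_of_le_of_ne hja (hne a ha).symm)

theorem IsRooted.left {n : ℕ} {B : Finset ℕ} {C : Finset (Finset ℕ)} (h : IsRooted n B C)
    {j : ℕ} (hjB : j ∈ B) (hj : ∀ x ∈ B, x ≤ j) :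
    IsRooted j (B.erase j) (C.filter (· ⊆ Finset.range j \ B.erase j)) where
  subset x hx := by
    obtain ⟨h1, h2⟩ := Finset.mem_erase.1 hx
    exact Finset.mem_range.2 (lt_of_le_of_ne (hj x h2) h1)
  root h0 := Finset.mem_erase.2
    ⟨h0.ne, h.root (h0.trans (Finset.mem_range.1 (h.subset hjB)))⟩
  isNC := by
    have hjn := Finset.mem_range.1 (h.subset hjB)
    refine h.isNC.restrict ?_ ?_
    · intro x
      simp only [Finset.mem_sdiff, Finset.mem_range, Finset.mem_erase]
      grind
    · intro U hU x hx hxj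
      simp only [Finset.mem_sdiff, Finset.mem_range] at hxj
      intro y hy
      have hyB := (Finset.mem_sdiff.1 (h.isNC.subset hU hy)).2
      rcases h.side hjB hU with h1 | h1
      · exact Finset.mem_sdiff.2 ⟨Finset.mem_range.2 (h1 y hy),
          fun hy' => hyB (Finset.mem_of_mem_erase hy')⟩
      · have := h1 x hx
        omega
  gap U hU b hb d hd c hc := h.gap U (Finset.mem_filter.1 hU).1 b hb d hd c
    (Finset.mem_of_mem_erase hc)

theorem IsRooted.right {n : ℕ} {B : Finset ℕ} {C : Finset (Finset ℕ)} (h : IsRooted n B C)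
    {j : ℕ} (hjB : j ∈ B) (hj : ∀ x ∈ B, x ≤ j) :
    IsNC (Finset.Ico (j + 1) n) (C.filter (· ⊆ Finset.Ico (j + 1) n)) := by
  refine h.isNC.restrict ?_ ?_
  · intro x hx
    rw [Finset.mem_Ico] at hx
    refine Finset.mem_sdiff.2 ⟨Finset.mem_range.2 hx.2, fun hxB => ?_⟩
    have := hj x hxB
    omega
  · intro U hU x hx hxj y hy
    rw [Finset.mem_Ico] at hxj ⊢
    have hyn := (Finset.mem_sdiff.1 (h.isNC.subset hU hy)).1
    rw [Finset.mem_range] at hyn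
    rcases h.side hjB hU with h1 | h1
    · have := h1 x hx
      omega
    · exact ⟨h1 y hy, hyn⟩

/-- Cut at the largest element `j` of the root block: below `j` remains a configuration of the same
kind whose root block has lost `j`, and above `j` an arbitrary crossing-free partition. The maximum
is written `sup id`, so that the inverse map is defined without a nonemptiness proof. -/
theorem card_rooted_succ (S : Set ℕ) (n k : ℕ) :
    (rooted S n (k + 1)).card =
      ∑ j ∈ Finset.range n, (rooted S j k).card * count S (n - (j + 1)) := by
  have hcard : ∑ j ∈ Finset.range n, (rooted S j k).card * count S (n - (j + 1)) =
      ((Finset.range n).sigma fun j =>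
        rooted S j k ×ˢ ncPartitions S (Finset.Ico (j + 1) n)).card := by
    rw [Finset.card_sigma]
    exact Finset.sum_congr rfl fun j _ => by rw [Finset.card_product, card_ncPartitions_Ico]
  rw [hcard]
  symm
  refine Finset.card_nbij'
    (i := fun x : (_ : ℕ) × ((Finset ℕ × Finset (Finset ℕ)) × Finset (Finset ℕ)) =>
      (insert x.1 x.2.1.1, x.2.1.2 ∪ x.2.2))
    (j := fun p : Finset ℕ × Finset (Finset ℕ) => ⟨p.1.sup id, ((p.1.erase (p.1.sup id),
      p.2.filter (· ⊆ Finset.range (p.1.sup id) \ p.1.erase (p.1.sup id))),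
      p.2.filter (· ⊆ Finset.Ico (p.1.sup id + 1) n))⟩) ?_ ?_ ?_ ?_
  · rintro ⟨j, ⟨B, C⟩, D⟩ hx
    simp only [Finset.coe_sigma, Set.mem_sigma_iff, Finset.mem_coe, Finset.mem_range,
      Finset.mem_product, mem_rooted, mem_ncPartitions] at hx ⊢
    obtain ⟨hj, ⟨hR, hk, hC⟩, hD, hDS⟩ := hx
    refine ⟨hR.insert hj hD, ?_, ?_⟩
    · rw [Finset.card_insert_of_notMem, hk]
      exact fun h => lt_irrefl _ (Finset.mem_range.1 (hR.subset h))
    · exact fun U hU => (Finset.mem_union.1 hU).elim (hC U) (hDS U)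
  · rintro ⟨B, C⟩ hx
    simp only [Finset.coe_sigma, Set.mem_sigma_iff, Finset.mem_coe, Finset.mem_range,
      Finset.mem_product, mem_rooted, mem_ncPartitions] at hx ⊢
    obtain ⟨hR, hk, hC⟩ := hx
    have hBne : B.Nonempty := Finset.card_pos.1 (by omega)
    have hm : B.sup id ∈ B := by
      obtain ⟨m, hm, h⟩ := Finset.exists_mem_eq_sup B hBne id
      rw [h]
      exact hm
    have hmax : ∀ x ∈ B, x ≤ B.sup id := fun x hx => Finset.le_sup (f := id) hx
    refine ⟨Finset.mem_range.1 (hR.subset hm), ⟨hR.left hm hmax, ?_, ?_⟩, hR.right hm hmax, ?_⟩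
    · rw [Finset.card_erase_of_mem hm, hk, Nat.add_sub_cancel]
    · exact fun U hU => hC U (Finset.mem_filter.1 hU).1
    · exact fun U hU => hC U (Finset.mem_filter.1 hU).1
  · rintro ⟨j, ⟨B, C⟩, D⟩ hx
    simp only [Finset.coe_sigma, Set.mem_sigma_iff, Finset.mem_coe, Finset.mem_range,
      Finset.mem_product, mem_rooted, mem_ncPartitions] at hx
    obtain ⟨hj, ⟨hR, hk, hC⟩, hD, hDS⟩ := hx
    have hBj : ∀ x ∈ B, x < j := fun x hx => Finset.mem_range.1 (hR.subset hx)
    have hsup : (insert j B).sup id = j := by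
      refine le_antisymm (Finset.sup_le fun x hx => ?_)
        (Finset.le_sup (f := id) (Finset.mem_insert_self _ _))
      rcases Finset.mem_insert.1 hx with rfl | hx
      · exact le_rfl
      · exact (hBj x hx).le
    have her : (insert j B).erase j = B :=
      Finset.erase_insert fun h => lt_irrefl _ (hBj j h)
    have hCsub : ∀ U ∈ C, U ⊆ Finset.range j \ B := fun U hU => hR.isNC.subset hU
    have hDsub : ∀ U ∈ D, U ⊆ Finset.Ico (j + 1) n := fun U hU => hD.subset hU
    simp only [hsup, her]
    have e1 : (C ∪ D).filter (· ⊆ Finset.range j \ B) = C := by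
      ext U
      simp only [Finset.mem_filter, Finset.mem_union]
      refine ⟨?_, fun h => ⟨Or.inl h, hCsub U h⟩⟩
      rintro ⟨h | h, hU⟩
      · exact h
      · obtain ⟨x, hx⟩ := hD.nonempty U h
        have h1 := hDsub U h hx
        have h2 := (Finset.mem_sdiff.1 (hU hx)).1
        rw [Finset.mem_Ico] at h1
        rw [Finset.mem_range] at h2
        omega
    have e2 : (C ∪ D).filter (· ⊆ Finset.Ico (j + 1) n) = D := by
      ext U
      simp only [Finset.mem_filter, Finset.mem_union]
      refine ⟨?_, fun h => ⟨Or.inr h, hDsub U h⟩⟩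
      rintro ⟨h | h, hU⟩
      · obtain ⟨x, hx⟩ := hR.isNC.nonempty U h
        have h1 := (Finset.mem_sdiff.1 (hCsub U h hx)).1
        have h2 := hU hx
        rw [Finset.mem_Ico] at h2
        rw [Finset.mem_range] at h1
        omega
      · exact h
    rw [e1, e2]
  · rintro ⟨B, C⟩ hx
    simp only [Finset.mem_coe, mem_rooted] at hx
    obtain ⟨hR, hk, hC⟩ := hx
    have hBne : B.Nonempty := Finset.card_pos.1 (by omega)
    have hm : B.sup id ∈ B := by
      obtain ⟨m, hm, h⟩ := Finset.exists_mem_eq_sup B hBne id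
      rw [h]
      exact hm
    have hmax : ∀ x ∈ B, x ≤ B.sup id := fun x hx => Finset.le_sup (f := id) hx
    simp only [Prod.mk.injEq]
    refine ⟨Finset.insert_erase hm, ?_⟩
    ext U
    simp only [Finset.mem_filter, Finset.mem_union]
    refine ⟨fun h => h.elim And.left And.left, fun hU => ?_⟩
    have hsub := hR.isNC.subset hU
    rcases hR.side hm hU with h | h
    · refine Or.inl ⟨hU, fun x hx => Finset.mem_sdiff.2 ⟨Finset.mem_range.2 (h x hx), fun hxB => ?_⟩⟩
      exact (Finset.mem_sdiff.1 (hsub hx)).2 (Finset.mem_of_mem_erase hxB)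
    · refine Or.inr ⟨hU, fun x hx => Finset.mem_Ico.2 ⟨h x hx, ?_⟩⟩
      exact Finset.mem_range.1 (Finset.mem_sdiff.1 (hsub hx)).1


/-! ### The functional equation for the coefficients -/

/-- Each element of the root block contributes a factor `x` and the gap after it a factor `P`; the
recursion `card_rooted_succ` is multiplication by `x P`. -/
theorem card_rooted (S : Set ℕ) (n k : ℕ) :
    (rooted S n k).card = PowerSeries.coeff n ((PowerSeries.X * genFun S) ^ k) := by
  induction k generalizing n with
  | zero => rw [card_rooted_zero, pow_zero, PowerSeries.coeff_one]
  | succ k ih =>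
    rw [card_rooted_succ, pow_succ', mul_assoc]
    cases n with
    | zero => simp
    | succ n =>
      rw [PowerSeries.coeff_succ_X_mul, mul_comm (genFun S), PowerSeries.coeff_mul,
        Finset.Nat.sum_antidiagonal_eq_sum_range_succ_mk]
      refine Finset.sum_congr rfl fun j _ => ?_
      rw [ih, genFun, PowerSeries.coeff_mk, Nat.add_sub_add_right]

theorem IsRooted.insert_isNC {n : ℕ} {B : Finset ℕ} {C : Finset (Finset ℕ)}
    (h : IsRooted n B C) (hn : 0 < n) : IsNC (Finset.range n) (Insert.insert B C) where
  nonempty U hU := by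
    rcases Finset.mem_insert.1 hU with rfl | hU
    · exact ⟨0, h.root hn⟩
    · exact h.isNC.nonempty U hU
  cover x := by
    have h1 := h.isNC.cover x
    have h2 : x ∈ B → x ∈ Finset.range n := fun hx => h.subset hx
    simp only [Finset.mem_sdiff, Finset.mem_insert, exists_eq_or_imp] at h1 ⊢
    rw [← h1]
    tauto
  disj U hU V hV x hxU hxV := by
    rcases Finset.mem_insert.1 hU with rfl | hU' <;> rcases Finset.mem_insert.1 hV with rfl | hV'
    · rfl
    · exact absurd hxU (Finset.mem_sdiff.1 (h.isNC.subset hV' hxV)).2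
    · exact absurd hxV (Finset.mem_sdiff.1 (h.isNC.subset hU' hxU)).2
    · exact h.isNC.disj U hU' V hV' x hxU hxV
  nc U hU V hV a ha b hb c hc d hd hab hbc hcd := by
    rcases Finset.mem_insert.1 hU with rfl | hU' <;> rcases Finset.mem_insert.1 hV with rfl | hV'
    · rfl
    · exact (h.gap V hV' b hb d hd c hc hbc hcd).elim
    · exact (h.gap U hU' a ha c hc b hb hab hbc).elim
    · exact h.isNC.nc U hU' V hV' a ha b hb c hc d hd hab hbc hcd

/-- If a block had points `b < c < d` with `c` in the root block, then `0 < b < c < d` would be a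
crossing. So `gap` captures all crossings with the root block. -/
theorem IsNC.isRooted_erase {n : ℕ} {B : Finset ℕ} {C : Finset (Finset ℕ)}
    (h : IsNC (Finset.range n) C) (hB : B ∈ C) (h0 : 0 ∈ B) : IsRooted n B (C.erase B) where
  subset := h.subset hB
  root _ := h0
  isNC := {
    nonempty := fun U hU => h.nonempty U (Finset.mem_of_mem_erase hU)
    cover := fun x => by
      rw [Finset.mem_sdiff, h.cover]
      constructor
      · rintro ⟨⟨U, hU, hx⟩, hxB⟩
        exact ⟨U, Finset.mem_erase.2 ⟨fun e => hxB (e ▸ hx), hU⟩, hx⟩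
      · rintro ⟨U, hU, hx⟩
        obtain ⟨h1, h2⟩ := Finset.mem_erase.1 hU
        exact ⟨⟨U, h2, hx⟩, fun hxB => h1 (h.disj U h2 B hB x hx hxB)⟩
    disj := fun U hU V hV =>
      h.disj U (Finset.mem_of_mem_erase hU) V (Finset.mem_of_mem_erase hV)
    nc := fun U hU V hV =>
      h.nc U (Finset.mem_of_mem_erase hU) V (Finset.mem_of_mem_erase hV) }
  gap U hU b hb d hd c hc hbc hcd := by
    obtain ⟨h1, h2⟩ := Finset.mem_erase.1 hU
    have hb0 : 0 < b := by
      rcases Nat.eq_zero_or_pos b with rfl | hb0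
      · exact absurd (h.disj U h2 B hB 0 hb h0) h1
      · exact hb0
    exact h1 (h.nc B hB U h2 0 h0 b hb c hc d hd hb0 hbc hcd).symm

theorem count_zero (S : Set ℕ) : count S 0 = 1 := by
  rw [count_eq_card_range, Finset.card_eq_one]
  refine ⟨∅, ?_⟩
  ext C
  rw [mem_ncPartitions, Finset.mem_singleton]
  constructor
  · rintro ⟨h, -⟩
    refine Finset.eq_empty_of_forall_notMem fun U hU => ?_
    obtain ⟨x, hx⟩ := h.nonempty U hU
    simpa using h.subset hU hx
  · rintro rfl
    exact ⟨⟨by simp, by simp, by simp, by simp⟩, by simp⟩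

-- Split according to the size of the root block. Injectivity holds because the root block is
-- recovered as the block containing `0`, which exists since `n > 0`.
open scoped Classical in
theorem count_of_pos (S : Set ℕ) {n : ℕ} (hn : 0 < n) :
    count S n = ∑ k ∈ (Finset.range (n + 1)).filter (· ∈ S),
      PowerSeries.coeff n ((PowerSeries.X * genFun S) ^ k) := by
  have hcard : ∑ k ∈ (Finset.range (n + 1)).filter (· ∈ S),
      PowerSeries.coeff n ((PowerSeries.X * genFun S) ^ k) =
      (((Finset.range (n + 1)).filter (· ∈ S)).sigma fun k => rooted S n k).card := by
    rw [Finset.card_sigma]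
    exact Finset.sum_congr rfl fun k _ => (card_rooted S n k).symm
  rw [hcard, count_eq_card_range]
  symm
  refine Finset.card_bij
    (fun (x : (_ : ℕ) × (Finset ℕ × Finset (Finset ℕ))) _ => insert x.2.1 x.2.2) ?_ ?_ ?_
  · rintro ⟨k, B, C⟩ hx
    simp only [Finset.mem_sigma, Finset.mem_filter, mem_rooted, mem_ncPartitions] at hx ⊢
    obtain ⟨⟨-, hk⟩, hR, rfl, hC⟩ := hx
    refine ⟨hR.insert_isNC hn, fun U hU => ?_⟩
    rcases Finset.mem_insert.1 hU with rfl | hU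
    · exact hk
    · exact hC U hU
  · rintro ⟨k, B, C⟩ hx ⟨k', B', C'⟩ hx' heq
    simp only [Finset.mem_sigma, Finset.mem_filter, mem_rooted] at hx hx' heq
    obtain ⟨-, hR, rfl, -⟩ := hx
    obtain ⟨-, hR', rfl, -⟩ := hx'
    have hB : B = B' := (hR'.insert_isNC hn).disj B (heq ▸ Finset.mem_insert_self _ _) B'
      (Finset.mem_insert_self _ _) 0 (hR.root hn) (hR'.root hn)
    subst hB
    have h1 : ∀ {C}, IsRooted n B C → B ∉ C := fun h hBC =>
      (Finset.mem_sdiff.1 (h.isNC.subset hBC (h.root hn))).2 (h.root hn)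
    have hC : C = C' := by
      rw [← Finset.erase_insert (h1 hR), heq, Finset.erase_insert (h1 hR')]
    rw [hC]
  · intro C hC
    obtain ⟨h, hS⟩ := mem_ncPartitions.1 hC
    obtain ⟨B, hB, h0⟩ := (h.cover 0).1 (Finset.mem_range.2 hn)
    refine ⟨⟨B.card, B, C.erase B⟩, ?_, Finset.insert_erase hB⟩
    simp only [Finset.mem_sigma, Finset.mem_filter, mem_rooted, Finset.mem_range]
    refine ⟨⟨?_, hS B hB⟩, h.isRooted_erase hB h0, trivial, fun U hU =>
      hS U (Finset.mem_of_mem_erase hU)⟩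
    have := Finset.card_le_card (h.subset hB)
    rw [Finset.card_range] at this
    omega

-- As `x ^ k` divides `(x P) ^ k`, the terms with `k > n` vanish, so a single truncation `N` serves
-- all `n ≤ N`. This uniformity is needed to sum the identity over `n`.
open scoped Classical in
theorem count_eq_sum {S : Set ℕ} (h0 : 0 ∉ S) {n N : ℕ} (hn : n ≤ N) :
    count S n = (if n = 0 then 1 else 0) + ∑ k ∈ (Finset.range (N + 1)).filter (· ∈ S),
      PowerSeries.coeff n ((PowerSeries.X * genFun S) ^ k) := by
  have hz : ∀ k, n < k → PowerSeries.coeff n ((PowerSeries.X * genFun S) ^ k) = 0 := by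
    intro k hk
    rw [mul_pow, PowerSeries.coeff_X_pow_mul', if_neg (by omega)]
  rcases Nat.eq_zero_or_pos n with rfl | hpos
  · rw [if_pos rfl, count_zero, Finset.sum_eq_zero, add_zero]
    intro k hk
    refine hz k (Nat.pos_of_ne_zero ?_)
    rintro rfl
    exact h0 (Finset.mem_filter.1 hk).2
  · rw [if_neg hpos.ne', zero_add, count_of_pos S hpos]
    refine Finset.sum_subset ?_ ?_
    · exact Finset.filter_subset_filter _ (Finset.range_mono (by omega))
    · intro k hk hk'
      refine hz k ?_
      simp only [Finset.mem_filter, Finset.mem_range] at hk hk'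
      by_contra hcon
      exact hk' ⟨by omega, hk.2⟩

theorem count_eq_zero {S : Set ℕ} {n : ℕ} (hn : ¬ Nat.setGcd S ∣ n) : count S n = 0 := by
  have : IsEmpty {P : Finpartition (Finset.univ : Finset (Fin n)) //
      IsCrossingFree P ∧ ∀ B ∈ P.parts, B.card ∈ S} := by
    refine ⟨fun P => hn ?_⟩
    have h := P.1.sum_card_parts
    rw [Finset.card_univ, Fintype.card_fin] at h
    rw [← h]
    exact Finset.dvd_sum fun B hB => Nat.setGcd_dvd_of_mem (P.2.2 B hB)
  exact Nat.card_of_isEmpty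


/-! ### The constants `τ`, `ρ`, `α`, `β` -/

theorem exists_two_le_mem {S : Set ℕ} (hne : S.Nonempty) (hpos : 0 ∉ S) (hS : S ≠ {1}) :
    ∃ s ∈ S, 2 ≤ s := by
  by_contra! h
  have h1 : ∀ s ∈ S, s = 1 := fun s hs => by
    have h2 := h s hs
    have h3 : s ≠ 0 := fun h0 => hpos (h0 ▸ hs)
    omega
  exact hS (hne.subset_singleton_iff.1 h1)

theorem sub_one_nonneg {S : Set ℕ} (hpos : 0 ∉ S) (s : S) : (0 : ℝ) ≤ ((s : ℕ) : ℝ) - 1 := by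
  have : 1 ≤ (s : ℕ) := Nat.one_le_iff_ne_zero.2 fun h => hpos (h ▸ s.2)
  have : (1 : ℝ) ≤ (s : ℕ) := by exact_mod_cast this
  linarith

/-- A single term suffices to exceed `1`. For finite `S` take `r = 2`. For infinite `S` the series
converges for all `r < 1`, and `r = (1/2) ^ (1/s)` makes the term of index `s > 3` equal to `(s - 1)
/ 2 > 1`. -/
theorem exists_radius {S : Set ℕ} (hne : S.Nonempty) (hpos : 0 ∉ S) (hS : S ≠ {1}) :
    ∃ r : ℝ, 0 < r ∧ Summable (fun s : S => (((s : ℕ) : ℝ) - 1) * r ^ (s : ℕ)) ∧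
      1 < ∑' s : S, (((s : ℕ) : ℝ) - 1) * r ^ (s : ℕ) := by
  have hnn : ∀ {r : ℝ}, 0 < r → ∀ s : S, 0 ≤ (((s : ℕ) : ℝ) - 1) * r ^ (s : ℕ) := fun hr s =>
    mul_nonneg (sub_one_nonneg hpos s) (pow_nonneg hr.le _)
  rcases S.finite_or_infinite with hfin | hinf
  · obtain ⟨s, hs, h2⟩ := exists_two_le_mem hne hpos hS
    have := hfin.to_subtype
    have hsum : Summable (fun s : S => (((s : ℕ) : ℝ) - 1) * 2 ^ (s : ℕ)) := Summable.of_finite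
    refine ⟨2, two_pos, hsum, ?_⟩
    refine lt_of_lt_of_le ?_ (hsum.le_tsum ⟨s, hs⟩ fun t _ => hnn two_pos t)
    have h3 : (2 : ℝ) ≤ s := by exact_mod_cast h2
    have h4 : (2 : ℝ) ^ 2 ≤ 2 ^ s := pow_le_pow_right₀ one_le_two h2
    show (1 : ℝ) < ((s : ℝ) - 1) * 2 ^ s
    nlinarith
  · obtain ⟨s, hs, h3⟩ := hinf.exists_gt 3
    have hs0 : s ≠ 0 := by omega
    set r : ℝ := (1 / 2 : ℝ) ^ (1 / (s : ℝ)) with hr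
    have hr0 : 0 < r := Real.rpow_pos_of_pos (by norm_num) _
    have hr1 : r < 1 := Real.rpow_lt_one (by norm_num) (by norm_num) (by positivity)
    have hrs : r ^ s = 1 / 2 := by
      rw [hr, one_div (s : ℝ), Real.rpow_inv_natCast_pow (by norm_num) hs0]
    have hsum : Summable (fun s : S => (((s : ℕ) : ℝ) - 1) * r ^ (s : ℕ)) := by
      have h1 : Summable (fun n : ℕ => (n : ℝ) ^ 1 * r ^ n) :=
        summable_pow_mul_geometric_of_norm_lt_one 1 (by rwa [Real.norm_of_nonneg hr0.le])
      have h2 : Summable (fun n : ℕ => r ^ n) := summable_geometric_of_lt_one hr0.le hr1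
      refine ((h1.sub h2).comp_injective Subtype.val_injective : Summable (_ ∘ ((↑) : S → ℕ))).congr
        fun s => ?_
      simp only [Function.comp_apply]
      ring
    refine ⟨r, hr0, hsum, ?_⟩
    refine lt_of_lt_of_le ?_ (hsum.le_tsum ⟨s, hs⟩ fun t _ => hnn hr0 t)
    have h4 : (3 : ℝ) < s := by exact_mod_cast h3
    show (1 : ℝ) < ((s : ℝ) - 1) * r ^ s
    rw [hrs]
    linarith

/-- Intermediate value theorem on `[0, r]`. The inequality `t < r` is strict because the sum at `r`
exceeds `1`; convergence beyond `τ` later gives finite moments and a generating function analytic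
past the closed unit disc. -/
theorem exists_isTau {S : Set ℕ} (hne : S.Nonempty) (hpos : 0 ∉ S) (hS : S ≠ {1}) :
    ∃ t r : ℝ, IsTau S t ∧ t < r ∧ Summable (fun s : S => r ^ (s : ℕ)) := by
  obtain ⟨r, hr0, hsum, hgt⟩ := exists_radius hne hpos hS
  have hle : ∀ t ∈ Set.Icc 0 r, ∀ s : S, ‖(((s : ℕ) : ℝ) - 1) * t ^ (s : ℕ)‖ ≤
      (((s : ℕ) : ℝ) - 1) * r ^ (s : ℕ) := by
    intro t ht s
    rw [Real.norm_of_nonneg (mul_nonneg (sub_one_nonneg hpos s) (pow_nonneg ht.1 _))]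
    exact mul_le_mul_of_nonneg_left (pow_le_pow_left₀ ht.1 ht.2 _) (sub_one_nonneg hpos s)
  have hcont : ContinuousOn (fun t : ℝ => ∑' s : S, (((s : ℕ) : ℝ) - 1) * t ^ (s : ℕ))
      (Set.Icc 0 r) := by
    refine continuousOn_tsum (fun s => ?_) hsum fun s t ht => hle t ht s
    fun_prop
  have h0 : ∑' s : S, (((s : ℕ) : ℝ) - 1) * (0 : ℝ) ^ (s : ℕ) = 0 := by
    rw [tsum_congr (g := fun _ => (0 : ℝ)), tsum_zero]
    intro s
    rw [zero_pow (fun h => hpos (h ▸ s.2)), mul_zero]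
  obtain ⟨t, ht, h1⟩ := intermediate_value_Icc hr0.le hcont
    (show (1 : ℝ) ∈ Set.Icc _ _ from ⟨by simp only [h0]; exact zero_le_one, hgt.le⟩)
  have hst : Summable (fun s : S => (((s : ℕ) : ℝ) - 1) * t ^ (s : ℕ)) :=
    Summable.of_norm_bounded hsum fun s => hle t ht s
  have ht0 : t ≠ 0 := by
    rintro rfl
    simp only [h0] at h1
    exact zero_ne_one h1
  have htr : t ≠ r := by
    rintro rfl
    exact hgt.ne h1.symm
  refine ⟨t, r, ⟨lt_of_le_of_ne ht.1 ht0.symm, hst.hasSum_iff.2 h1⟩, lt_of_le_of_ne ht.2 htr, ?_⟩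
  -- For `s ≥ 2` one has `r ^ s ≤ (s - 1) r ^ s`; only `s = 1`, whose weight `s - 1` vanishes, must
  -- be added separately.
  have h2 : Summable (fun s : S => if (s : ℕ) = 1 then r else 0) := by
    refine summable_of_hasFiniteSupport (Set.Subsingleton.finite ?_)
    intro x hx y hy
    simp only [Function.mem_support, ne_eq, ite_eq_right_iff, Classical.not_imp] at hx hy
    exact Subtype.ext (hx.1.trans hy.1.symm)
  refine Summable.of_nonneg_of_le (fun s => by positivity) (fun s => ?_) (hsum.add h2)
  split_ifs with h
  · rw [h]
    simp
  · have h3 : 1 ≤ (s : ℕ) := Nat.one_le_iff_ne_zero.2 fun h => hpos (h ▸ s.2)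
    have h4 : (2 : ℝ) ≤ (s : ℕ) := by exact_mod_cast (show 2 ≤ (s : ℕ) by omega)
    rw [add_zero]
    exact le_mul_of_one_le_left (by positivity) (by linarith)

theorem IsTau.unique {S : Set ℕ} (hne : S.Nonempty) (hpos : 0 ∉ S) (hS : S ≠ {1}) {t u : ℝ}
    (ht : IsTau S t) (hu : IsTau S u) : t = u := by
  obtain ⟨s, hs, h2⟩ := exists_two_le_mem hne hpos hS
  have key : ∀ {t u : ℝ}, IsTau S t → IsTau S u → ¬ t < u := by
    intro t u ht hu htu
    refine lt_irrefl (1 : ℝ) (hasSum_lt (i := ⟨s, hs⟩) (fun x => ?_) ?_ ht.2 hu.2)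
    · exact mul_le_mul_of_nonneg_left (pow_le_pow_left₀ ht.1.le htu.le _) (sub_one_nonneg hpos x)
    · have h3 : (2 : ℝ) ≤ s := by exact_mod_cast h2
      exact mul_lt_mul_of_pos_left (pow_lt_pow_left₀ htu ht.1.le (by simp; omega))
        (by simp; linarith)
  exact le_antisymm (not_lt.1 (key hu ht)) (not_lt.1 (key ht hu))

theorem existsUnique_isTau {S : Set ℕ} (hne : S.Nonempty) (hpos : 0 ∉ S) (hS : S ≠ {1}) :
    ∃! t : ℝ, IsTau S t := by
  obtain ⟨t, -, ht, -⟩ := exists_isTau hne hpos hS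
  exact ⟨t, ht, fun u hu => hu.unique hne hpos hS ht⟩

theorem isTau_tau {S : Set ℕ} (hne : S.Nonempty) (hpos : 0 ∉ S) (hS : S ≠ {1}) :
    IsTau S (tau S) :=
  Classical.epsilon_spec (existsUnique_isTau hne hpos hS).exists

theorem exists_tau_lt_summable {S : Set ℕ} (hne : S.Nonempty) (hpos : 0 ∉ S) (hS : S ≠ {1}) :
    ∃ r, tau S < r ∧ Summable (fun s : S => r ^ (s : ℕ)) := by
  obtain ⟨t, r, ht, h⟩ := exists_isTau hne hpos hS
  rw [← (isTau_tau hne hpos hS).unique hne hpos hS ht] at h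
  exact ⟨r, h⟩

/-- Since `τ < r`, the factor `s ^ k (τ / r) ^ s` is bounded, which leaves the convergent series `∑
r ^ s`. -/
theorem summable_pow_mul_tau {S : Set ℕ} (hne : S.Nonempty) (hpos : 0 ∉ S) (hS : S ≠ {1})
    (k : ℕ) : Summable (fun s : S => ((s : ℕ) : ℝ) ^ k * tau S ^ (s : ℕ)) := by
  obtain ⟨r, hr, hsum⟩ := exists_tau_lt_summable hne hpos hS
  have ht := (isTau_tau hne hpos hS).1
  have hr0 := ht.trans hr
  have h1 : Summable (fun n : ℕ => (n : ℝ) ^ k * (tau S / r) ^ n) :=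
    summable_pow_mul_geometric_of_norm_lt_one k
      (by rw [Real.norm_of_nonneg (by positivity)]; exact (div_lt_one hr0).2 hr)
  have hb := h1.tendsto_atTop_zero.bddAbove_range
  obtain ⟨C, hC⟩ := hb
  refine Summable.of_nonneg_of_le (fun s => by positivity) (fun s => ?_) (hsum.mul_left C)
  have := hC ⟨(s : ℕ), rfl⟩
  calc ((s : ℕ) : ℝ) ^ k * tau S ^ (s : ℕ)
      = ((s : ℕ) : ℝ) ^ k * (tau S / r) ^ (s : ℕ) * r ^ (s : ℕ) := by
        rw [div_pow, mul_assoc, div_mul_cancel₀ _ (pow_ne_zero _ hr0.ne')]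
    _ ≤ C * r ^ (s : ℕ) := mul_le_mul_of_nonneg_right this (by positivity)


/-- The standing assumptions on the set `S` of block sizes. -/
structure IsAdmissible (S : Set ℕ) : Prop where
  nonempty : S.Nonempty
  zero_notMem : 0 ∉ S
  ne_singleton_one : S ≠ {1}

namespace IsAdmissible

variable {S : Set ℕ}

theorem tau_pos (h : IsAdmissible S) : 0 < tau S :=
  (isTau_tau h.nonempty h.zero_notMem h.ne_singleton_one).1

theorem hasSum_tau (h : IsAdmissible S) :
    HasSum (fun s : S => (((s : ℕ) : ℝ) - 1) * tau S ^ (s : ℕ)) 1 :=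
  (isTau_tau h.nonempty h.zero_notMem h.ne_singleton_one).2

theorem summable_pow (h : IsAdmissible S) (k : ℕ) :
    Summable (fun s : S => ((s : ℕ) : ℝ) ^ k * tau S ^ (s : ℕ)) :=
  summable_pow_mul_tau h.nonempty h.zero_notMem h.ne_singleton_one k

theorem summable_tau_pow (h : IsAdmissible S) : Summable (fun s : S => tau S ^ (s : ℕ)) :=
  (h.summable_pow 0).congr fun s => by rw [pow_zero, one_mul]

theorem summable_mul_tau_pow (h : IsAdmissible S) :
    Summable (fun s : S => ((s : ℕ) : ℝ) * tau S ^ (s : ℕ)) :=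
  (h.summable_pow 1).congr fun s => by rw [pow_one]

theorem summable_mul_sub_one_mul_tau_pow (h : IsAdmissible S) :
    Summable (fun s : S => ((s : ℕ) : ℝ) * (((s : ℕ) : ℝ) - 1) * tau S ^ (s : ℕ)) :=
  ((h.summable_pow 2).sub (h.summable_pow 1)).congr fun s => by ring

theorem hasSum_tau_pow (h : IsAdmissible S) :
    HasSum (fun s : S => tau S ^ (s : ℕ)) (alpha S - 1) := by
  rw [alpha, add_sub_cancel_left]
  exact h.summable_tau_pow.hasSum

/-- Adding `∑ (s - 1) τ ^ s = 1` to `∑ τ ^ s = α - 1` gives `α`: the denominator of `ρ` is `α`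
itself, whence `ρ α = τ`. -/
theorem hasSum_mul_tau_pow (h : IsAdmissible S) :
    HasSum (fun s : S => ((s : ℕ) : ℝ) * tau S ^ (s : ℕ)) (alpha S) := by
  have := h.hasSum_tau.add h.hasSum_tau_pow
  rw [add_sub_cancel] at this
  refine this.congr_fun ?_
  intro s
  ring

theorem one_lt_alpha (h : IsAdmissible S) : 1 < alpha S := by
  obtain ⟨s, hs⟩ := h.nonempty
  have h1 := le_hasSum h.hasSum_tau_pow ⟨s, hs⟩ fun t _ => pow_nonneg h.tau_pos.le _
  have h2 := pow_pos h.tau_pos s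
  have h3 : tau S ^ s ≤ alpha S - 1 := h1
  linarith

theorem alpha_pos (h : IsAdmissible S) : 0 < alpha S := one_pos.trans h.one_lt_alpha

theorem rho_eq (h : IsAdmissible S) : rho S = tau S / alpha S := by
  rw [rho, h.hasSum_mul_tau_pow.tsum_eq]

theorem rho_pos (h : IsAdmissible S) : 0 < rho S := by
  rw [h.rho_eq]
  exact div_pos h.tau_pos h.alpha_pos

theorem rho_mul_alpha (h : IsAdmissible S) : rho S * alpha S = tau S := by
  rw [h.rho_eq, div_mul_cancel₀ _ h.alpha_pos.ne']

theorem variance_pos (h : IsAdmissible S) :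
    0 < ∑' s : S, ((s : ℕ) : ℝ) * (((s : ℕ) : ℝ) - 1) * tau S ^ (s : ℕ) := by
  obtain ⟨s, hs, h2⟩ := exists_two_le_mem h.nonempty h.zero_notMem h.ne_singleton_one
  refine h.summable_mul_sub_one_mul_tau_pow.tsum_pos (fun t => ?_) ⟨s, hs⟩ ?_
  · exact mul_nonneg (mul_nonneg (Nat.cast_nonneg _) (sub_one_nonneg h.zero_notMem t))
      (pow_nonneg h.tau_pos.le _)
  · have h3 : (2 : ℝ) ≤ s := by exact_mod_cast h2
    have h4 : (0 : ℝ) < (s : ℝ) - 1 := by linarith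
    have := h.tau_pos
    show (0 : ℝ) < (s : ℝ) * ((s : ℝ) - 1) * tau S ^ s
    positivity

theorem beta_eq (h : IsAdmissible S) : beta S = Real.sqrt (2 * alpha S ^ 3 /
    ∑' s : S, ((s : ℕ) : ℝ) * (((s : ℕ) : ℝ) - 1) * tau S ^ (s : ℕ)) := by
  rw [beta, h.hasSum_mul_tau_pow.tsum_eq]

theorem beta_pos (h : IsAdmissible S) : 0 < beta S := by
  rw [h.beta_eq]
  have := h.variance_pos
  have := h.alpha_pos
  positivity

end IsAdmissible

/-! ### Convergence at `ρ` and the functional equation on the closed disc -/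

/-- Partial sums of the evaluation at `x` of a power series. -/
noncomputable def partialEval (A : PowerSeries ℕ) (N : ℕ) (x : ℝ) : ℝ :=
  ∑ n ∈ Finset.range N, ((PowerSeries.coeff n A : ℕ) : ℝ) * x ^ n

theorem partialEval_nonneg (A : PowerSeries ℕ) (N : ℕ) {x : ℝ} (hx : 0 ≤ x) :
    0 ≤ partialEval A N x :=
  Finset.sum_nonneg fun n _ => by positivity

theorem partialEval_mul_le (A B : PowerSeries ℕ) (N : ℕ) {x : ℝ} (hx : 0 ≤ x) :
    partialEval (A * B) N x ≤ partialEval A N x * partialEval B N x := by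
  have h1 : partialEval (A * B) N x = ∑ m ∈ Finset.range N, ∑ k ∈ Finset.range (m + 1),
      (((PowerSeries.coeff k A : ℕ) : ℝ) * x ^ k) *
        (((PowerSeries.coeff (m - k) B : ℕ) : ℝ) * x ^ (m - k)) := by
    refine Finset.sum_congr rfl fun m _ => ?_
    rw [PowerSeries.coeff_mul, Finset.Nat.sum_antidiagonal_eq_sum_range_succ_mk, Nat.cast_sum,
      Finset.sum_mul]
    refine Finset.sum_congr rfl fun k hk => ?_
    have hk : k + (m - k) = m := by
      have := Finset.mem_range.1 hk
      omega
    rw [Nat.cast_mul, mul_mul_mul_comm, ← pow_add, hk]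
  rw [h1, Finset.sum_range_diag_flip N fun k l => (((PowerSeries.coeff k A : ℕ) : ℝ) * x ^ k) *
        (((PowerSeries.coeff l B : ℕ) : ℝ) * x ^ l), partialEval, Finset.sum_mul]
  refine Finset.sum_le_sum fun k _ => ?_
  rw [← Finset.mul_sum]
  refine mul_le_mul_of_nonneg_left ?_ (by positivity)
  exact Finset.sum_le_sum_of_subset_of_nonneg (Finset.range_mono (Nat.sub_le _ _))
    fun n _ _ => by positivity

theorem partialEval_pow_le (A : PowerSeries ℕ) (N : ℕ) {x : ℝ} (hx : 0 ≤ x) (k : ℕ) :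
    partialEval (A ^ k) N x ≤ partialEval A N x ^ k := by
  induction k with
  | zero =>
    rw [pow_zero, pow_zero, partialEval]
    simp only [PowerSeries.coeff_one]
    rcases N with _ | N
    · simp
    · rw [Finset.sum_eq_single 0] <;> simp +contextual
  | succ k ih =>
    rw [pow_succ, pow_succ]
    exact (partialEval_mul_le _ _ N hx).trans
      (mul_le_mul_of_nonneg_right ih (partialEval_nonneg A N hx))

theorem partialEval_X_mul (A : PowerSeries ℕ) (N : ℕ) (x : ℝ) :
    partialEval (PowerSeries.X * A) (N + 1) x = x * partialEval A N x := by
  rw [partialEval, Finset.sum_range_succ', partialEval, Finset.mul_sum]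
  simp only [PowerSeries.coeff_succ_X_mul, PowerSeries.coeff_zero_X_mul, Nat.cast_zero, zero_mul,
    add_zero]
  exact Finset.sum_congr rfl fun n _ => by ring

-- Induction on the truncation `N`. The functional equation bounds the next partial sum by `1 + ∑ (ρ
-- P_N(ρ)) ^ k`, and `ρ P_N(ρ) ≤ ρ α = τ` turns this into `1 + ∑ τ ^ k ≤ α`.
open scoped Classical in
theorem IsAdmissible.partialEval_genFun_le {S : Set ℕ} (h : IsAdmissible S) (N : ℕ) :
    partialEval (genFun S) N (rho S) ≤ alpha S := by
  have hρ := h.rho_pos.le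
  induction N with
  | zero => simpa [partialEval] using h.alpha_pos.le
  | succ N ih =>
    have h1 : partialEval (genFun S) (N + 1) (rho S) = 1 +
        ∑ k ∈ (Finset.range (N + 1)).filter (· ∈ S),
          partialEval ((PowerSeries.X * genFun S) ^ k) (N + 1) (rho S) := by
      simp only [partialEval]
      rw [Finset.sum_comm]
      have h2 : ∀ n ∈ Finset.range (N + 1), ((PowerSeries.coeff n (genFun S) : ℕ) : ℝ) * rho S ^ n =
          (if n = 0 then 1 else 0) + ∑ k ∈ (Finset.range (N + 1)).filter (· ∈ S),
            ((PowerSeries.coeff n ((PowerSeries.X * genFun S) ^ k) : ℕ) : ℝ) * rho S ^ n := by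
        intro n hn
        rw [genFun, PowerSeries.coeff_mk,
          count_eq_sum h.zero_notMem (Nat.lt_succ_iff.1 (Finset.mem_range.1 hn)), Nat.cast_add,
          Nat.cast_sum, add_mul, Finset.sum_mul]
        congr 1
        split_ifs with hn0
        · simp [hn0]
        · simp
      rw [Finset.sum_congr rfl h2, Finset.sum_add_distrib]
      simp
    rw [h1]
    have h3 : ∀ k ∈ (Finset.range (N + 1)).filter (· ∈ S),
        partialEval ((PowerSeries.X * genFun S) ^ k) (N + 1) (rho S) ≤ tau S ^ k := by
      intro k _
      refine (partialEval_pow_le _ _ hρ k).trans ?_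
      rw [partialEval_X_mul]
      refine pow_le_pow_left₀ (mul_nonneg hρ (partialEval_nonneg _ _ hρ)) ?_ k
      rw [← h.rho_mul_alpha]
      exact mul_le_mul_of_nonneg_left ih hρ
    have h4 : ∑ k ∈ (Finset.range (N + 1)).filter (· ∈ S), tau S ^ k ≤ alpha S - 1 := by
      have h5 := hasSum_subtype_iff_indicator.1 h.hasSum_tau_pow
      refine le_trans (le_of_eq ?_) (sum_le_hasSum (Finset.range (N + 1))
        (fun k _ => Set.indicator_nonneg (fun k _ => pow_nonneg h.tau_pos.le k) k) h5)
      rw [Finset.sum_filter]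
      exact Finset.sum_congr rfl fun k _ => by rw [Set.indicator_apply]
    linarith [Finset.sum_le_sum h3]

theorem partialEval_X_mul_pow_le {S : Set ℕ} (h : IsAdmissible S) (N k : ℕ) :
    partialEval ((PowerSeries.X * genFun S) ^ k) N (rho S) ≤ tau S ^ k := by
  have hρ := h.rho_pos.le
  have h1 : partialEval (PowerSeries.X * genFun S) N (rho S) ≤ tau S := by
    rcases N with _ | N
    · simpa [partialEval] using h.tau_pos.le
    · rw [partialEval_X_mul, ← h.rho_mul_alpha]
      exact mul_le_mul_of_nonneg_left (h.partialEval_genFun_le N) hρ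
  exact (partialEval_pow_le _ _ hρ k).trans
    (pow_le_pow_left₀ (partialEval_nonneg _ _ hρ) h1 k)

theorem IsAdmissible.summable_count {S : Set ℕ} (h : IsAdmissible S) :
    Summable (fun n => (count S n : ℝ) * rho S ^ n) := by
  refine summable_of_sum_range_le (c := alpha S)
    (fun n => mul_nonneg (Nat.cast_nonneg _) (pow_nonneg h.rho_pos.le n)) fun N => ?_
  simpa [partialEval, genFun] using h.partialEval_genFun_le N

theorem IsAdmissible.tsum_count_le {S : Set ℕ} (h : IsAdmissible S) :
    ∑' n, (count S n : ℝ) * rho S ^ n ≤ alpha S := by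
  refine Real.tsum_le_of_sum_range_le
    (fun n => mul_nonneg (Nat.cast_nonneg _) (pow_nonneg h.rho_pos.le n)) fun N => ?_
  simpa [partialEval, genFun] using h.partialEval_genFun_le N

theorem hasSum_eval_mul {A B : PowerSeries ℕ} {x : ℂ}
    (hA : Summable fun n => ‖((PowerSeries.coeff n A : ℕ) : ℂ) * x ^ n‖)
    (hB : Summable fun n => ‖((PowerSeries.coeff n B : ℕ) : ℂ) * x ^ n‖) :
    (Summable fun n => ‖((PowerSeries.coeff n (A * B) : ℕ) : ℂ) * x ^ n‖) ∧
      ∑' n, ((PowerSeries.coeff n (A * B) : ℕ) : ℂ) * x ^ n =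
        (∑' n, ((PowerSeries.coeff n A : ℕ) : ℂ) * x ^ n) *
          ∑' n, ((PowerSeries.coeff n B : ℕ) : ℂ) * x ^ n := by
  have h1 : ∀ n, ((PowerSeries.coeff n (A * B) : ℕ) : ℂ) * x ^ n =
      ∑ kl ∈ Finset.HasAntidiagonal.antidiagonal n, (((PowerSeries.coeff kl.1 A : ℕ) : ℂ) * x ^ kl.1) *
        (((PowerSeries.coeff kl.2 B : ℕ) : ℂ) * x ^ kl.2) := by
    intro n
    rw [PowerSeries.coeff_mul, Nat.cast_sum, Finset.sum_mul]
    refine Finset.sum_congr rfl fun kl hkl => ?_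
    rw [Nat.cast_mul, mul_mul_mul_comm, ← pow_add, Finset.HasAntidiagonal.mem_antidiagonal.1 hkl]
  refine ⟨(summable_norm_sum_mul_antidiagonal_of_summable_norm hA hB).congr fun n => ?_, ?_⟩
  · rw [h1]
  · rw [tsum_mul_tsum_eq_tsum_sum_antidiagonal_of_summable_norm hA hB]
    exact tsum_congr h1

theorem hasSum_eval_pow {A : PowerSeries ℕ} {x : ℂ}
    (hA : Summable fun n => ‖((PowerSeries.coeff n A : ℕ) : ℂ) * x ^ n‖) (k : ℕ) :
    (Summable fun n => ‖((PowerSeries.coeff n (A ^ k) : ℕ) : ℂ) * x ^ n‖) ∧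
      ∑' n, ((PowerSeries.coeff n (A ^ k) : ℕ) : ℂ) * x ^ n =
        (∑' n, ((PowerSeries.coeff n A : ℕ) : ℂ) * x ^ n) ^ k := by
  induction k with
  | zero =>
    have h1 : ∀ n, n ≠ 0 → ((PowerSeries.coeff n (A ^ 0) : ℕ) : ℂ) * x ^ n = 0 := by
      intro n hn
      rw [pow_zero, PowerSeries.coeff_one, if_neg hn, Nat.cast_zero, zero_mul]
    refine ⟨?_, ?_⟩
    · refine summable_of_ne_finset_zero (s := {0}) fun n hn => ?_
      rw [h1 n (by simpa using hn), norm_zero]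
    · rw [tsum_eq_single 0 h1]
      simp
  | succ k ih =>
    rw [pow_succ, pow_succ, ← ih.2]
    exact hasSum_eval_mul ih.1 hA

theorem hasSum_eval_X_mul {A : PowerSeries ℕ} {x : ℂ}
    (hA : Summable fun n => ‖((PowerSeries.coeff n A : ℕ) : ℂ) * x ^ n‖) :
    (Summable fun n => ‖((PowerSeries.coeff n (PowerSeries.X * A) : ℕ) : ℂ) * x ^ n‖) ∧
      ∑' n, ((PowerSeries.coeff n (PowerSeries.X * A) : ℕ) : ℂ) * x ^ n =
        x * ∑' n, ((PowerSeries.coeff n A : ℕ) : ℂ) * x ^ n := by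
  have hX : ∀ n, n ≠ 1 → ((PowerSeries.coeff n (PowerSeries.X : PowerSeries ℕ) : ℕ) : ℂ) * x ^ n = 0 := by
    intro n hn
    rw [PowerSeries.coeff_X, if_neg hn, Nat.cast_zero, zero_mul]
  have h1 : Summable fun n => ‖((PowerSeries.coeff n (PowerSeries.X : PowerSeries ℕ) : ℕ) : ℂ) * x ^ n‖ := by
    refine summable_of_ne_finset_zero (s := {1}) fun n hn => ?_
    rw [hX n (by simpa using hn), norm_zero]
  have h2 := hasSum_eval_mul h1 hA
  rw [tsum_eq_single 1 hX] at h2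
  simpa using h2

open scoped Classical in
/-- The functional equation `f = 1 + ∑_{s ∈ S} (x f) ^ s` on the closed disc of radius `ρ_S`. -/
theorem IsAdmissible.hasSum_mul_pow {S : Set ℕ} (h : IsAdmissible S) {x : ℂ} (hx : ‖x‖ ≤ rho S) :
    HasSum (fun s : S => (x * ∑' n, (count S n : ℂ) * x ^ n) ^ (s : ℕ))
      (∑' n, (count S n : ℂ) * x ^ n - 1) := by
  have hnorm : ∀ (A : PowerSeries ℕ) (n : ℕ), ‖((PowerSeries.coeff n A : ℕ) : ℂ) * x ^ n‖ ≤
      ((PowerSeries.coeff n A : ℕ) : ℝ) * rho S ^ n := by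
    intro A n
    rw [norm_mul, norm_pow, Complex.norm_natCast]
    exact mul_le_mul_of_nonneg_left (pow_le_pow_left₀ (norm_nonneg x) hx n) (Nat.cast_nonneg _)
  have hP : Summable fun n => ‖((PowerSeries.coeff n (genFun S) : ℕ) : ℂ) * x ^ n‖ := by
    refine Summable.of_nonneg_of_le (fun n => norm_nonneg _) (hnorm _) ?_
    simpa [genFun] using h.summable_count
  have hPsum : ∑' n, ((PowerSeries.coeff n (genFun S) : ℕ) : ℂ) * x ^ n =
      ∑' n, (count S n : ℂ) * x ^ n := by simp [genFun]
  have hXP := hasSum_eval_X_mul hP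
  set A := PowerSeries.X * genFun S with hA
  -- Absolute convergence of the double series: the row of `s` has sum at most `τ ^ s`. Summing by
  -- rows gives the powers `(x P) ^ s`, and by columns the coefficients of `P - 1`.
  have hG : Summable fun p : S × ℕ =>
      ((PowerSeries.coeff p.2 (A ^ (p.1 : ℕ)) : ℕ) : ℝ) * rho S ^ p.2 := by
    have hnn : ∀ (k n : ℕ), 0 ≤ ((PowerSeries.coeff n (A ^ k) : ℕ) : ℝ) * rho S ^ n := fun k n =>
      mul_nonneg (Nat.cast_nonneg _) (pow_nonneg h.rho_pos.le n)
    refine (summable_prod_of_nonneg fun p => hnn _ _).2 ⟨fun s => ?_, ?_⟩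
    · exact summable_of_sum_range_le (hnn s) fun N => partialEval_X_mul_pow_le h N s
    · refine Summable.of_nonneg_of_le (fun s => tsum_nonneg (hnn s)) (fun s => ?_)
        h.summable_tau_pow
      exact Real.tsum_le_of_sum_range_le (hnn s) fun N => partialEval_X_mul_pow_le h N s
  have hg : Summable fun p : S × ℕ =>
      ((PowerSeries.coeff p.2 (A ^ (p.1 : ℕ)) : ℕ) : ℂ) * x ^ p.2 :=
    Summable.of_norm_bounded hG fun p => hnorm _ _
  have h1 := hg.hasSum.prod_fiberwise
    (g := fun s : S => (x * ∑' n, (count S n : ℂ) * x ^ n) ^ (s : ℕ)) fun s => by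
    have := hasSum_eval_pow hXP.1 s
    rw [hXP.2, hPsum] at this
    rw [← this.2]
    exact this.1.of_norm.hasSum
  have hswap := (Equiv.prodComm ℕ S).hasSum_iff.2 hg.hasSum
  have h2 := hswap.prod_fiberwise (g := fun n => (count S n : ℂ) * x ^ n - if n = 0 then 1 else 0)
    fun n => by
      have h3 : (count S n : ℂ) * x ^ n - (if n = 0 then 1 else 0) =
          ∑ k ∈ Finset.range (n + 1),
            S.indicator (fun k => ((PowerSeries.coeff n (A ^ k) : ℕ) : ℂ) * x ^ n) k := by
        rw [count_eq_sum h.zero_notMem le_rfl, Nat.cast_add, Nat.cast_sum, Finset.sum_filter,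
          add_mul, Finset.sum_mul]
        simp only [Set.indicator_apply, Nat.cast_ite, ite_mul, Nat.cast_zero, zero_mul]
        split_ifs with hn
        · simp [hn]
        · simp only [zero_add, sub_zero, hA]
      rw [h3]
      refine hasSum_subtype_iff_indicator.2 (hasSum_sum_of_ne_finset_zero fun k hk => ?_)
      rw [Set.indicator_apply_eq_zero]
      intro _
      rw [hA, mul_pow, PowerSeries.coeff_X_pow_mul', if_neg (by simpa using hk), Nat.cast_zero,
        zero_mul]
  have h4 : HasSum (fun n => (count S n : ℂ) * x ^ n - if n = 0 then 1 else 0)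
      (∑' n, (count S n : ℂ) * x ^ n - 1) := by
    refine HasSum.sub ?_ (hasSum_ite_eq 0 1)
    rw [← hPsum]
    refine (hP.of_norm.hasSum).congr_fun fun n => ?_
    simp [genFun]
  rwa [h2.unique h4] at h1


/-! ### Singularity analysis for a square root singularity -/

/-- The Taylor coefficients of `√(1 - z)` at `0`. -/
noncomputable def sqrtCoeff (n : ℕ) : ℝ := (-1) ^ n * Ring.choose (1 / 2 : ℝ) n

theorem hasSum_sqrtCoeff {z : ℂ} (hz : ‖z‖ < 1) :
    HasSum (fun n => (sqrtCoeff n : ℂ) * z ^ n) (Complex.sqrt (1 - z)) := by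
  have h := (Complex.one_add_cpow_hasFPowerSeriesOnBall_zero (a := 2⁻¹)).hasSum (y := -z)
    (by rw [Metric.mem_eball, edist_zero_right, enorm_neg, ← ofReal_norm, ENNReal.ofReal_lt_one]; exact hz)
  rw [zero_add, ← sub_eq_add_neg] at h
  refine h.congr_fun fun n => ?_
  rw [sqrtCoeff, binomialSeries_apply, List.ofFn_const, List.prod_replicate, neg_pow z, Complex.ofReal_mul,
    Complex.ofReal_choose, smul_eq_mul]
  push_cast
  rw [one_div]
  ring

theorem sqrtCoeff_succ (n : ℕ) : (n + 1) * sqrtCoeff (n + 1) = (n - 1 / 2) * sqrtCoeff n := by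
  have h := Ring.choose_smul_choose (1 / 2 : ℝ) (Nat.le_succ n)
  rw [Nat.succ_sub (le_refl n), Nat.sub_self, Ring.choose_one_right, Nat.succ_eq_add_one,
    Nat.choose_succ_self_right, nsmul_eq_mul, Nat.cast_succ] at h
  simp only [sqrtCoeff]
  rw [pow_succ]
  linear_combination (-(-1 : ℝ) ^ n) * h

theorem sqrtCoeff_zero : sqrtCoeff 0 = 1 := by simp [sqrtCoeff]

theorem prod_eq_sqrtCoeff (n : ℕ) :
    ∏ j ∈ Finset.range n, (-(1 / 2) + (j : ℝ)) = n.factorial * sqrtCoeff n := by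
  induction n with
  | zero => simp [sqrtCoeff_zero]
  | succ n ih =>
    rw [Finset.prod_range_succ, ih, Nat.factorial_succ, Nat.cast_mul, Nat.cast_succ]
    linear_combination (-(n.factorial : ℝ)) * sqrtCoeff_succ n

/-- Euler's sequence for `Γ(-1/2)` has denominator `∏_{j ≤ n} (j - 1/2) = n! (n - 1/2) sqrtCoeff n`.
Inverting it and replacing `n - 1/2` by `n` gives the limit `1 / Γ(-1/2) = -1 / (2 √π)`. -/
theorem tendsto_sqrtCoeff : Tendsto (fun n : ℕ => sqrtCoeff n * (n : ℝ) ^ (3 / 2 : ℝ)) atTop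
    (𝓝 (-1 / (2 * Real.sqrt Real.pi))) := by
  have hG : Real.Gamma (-(1 / 2)) = -(2 * Real.sqrt Real.pi) := by
    have := Real.Gamma_add_one (s := -(1 / 2)) (by norm_num)
    rw [show (-(1 / 2) + 1 : ℝ) = 1 / 2 by norm_num, Real.Gamma_one_half_eq] at this
    linarith
  have h := Real.GammaSeq_tendsto_Gamma (-(1 / 2))
  rw [hG] at h
  have hpi : (0 : ℝ) < Real.sqrt Real.pi := Real.sqrt_pos.2 Real.pi_pos
  have h1 := h.inv₀ (by linarith)
  have h2 : Tendsto (fun n : ℕ => (n : ℝ) / (n + (-(1 / 2)))) atTop (𝓝 1) :=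
    tendsto_natCast_div_add_atTop _
  have h3 := h1.mul h2
  rw [mul_one, show (-(2 * Real.sqrt Real.pi))⁻¹ = -1 / (2 * Real.sqrt Real.pi) by
    rw [inv_neg, neg_div, one_div]] at h3
  refine h3.congr' ?_
  filter_upwards [eventually_ge_atTop 1] with n hn
  have hn0 : (0 : ℝ) < n := by exact_mod_cast hn
  have hn1 : (1 : ℝ) ≤ n := by exact_mod_cast hn
  have hf : (n.factorial : ℝ) ≠ 0 := by positivity
  rw [Real.GammaSeq, Finset.prod_range_succ, prod_eq_sqrtCoeff,
    show (3 / 2 : ℝ) = 1 - (-(1 / 2)) by norm_num, Real.rpow_sub hn0, Real.rpow_one]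
  have hr := (Real.rpow_pos_of_pos hn0 (-(1 / 2))).ne'
  have hd : (n : ℝ) + -(1 / 2) ≠ 0 := by linarith
  rw [add_comm (-(1 / 2) : ℝ)]
  generalize (n : ℝ) ^ (-(1 / 2) : ℝ) = r at *
  generalize (n : ℝ) + -(1 / 2) = u at *
  field_simp


theorem sqrt_sq (z : ℂ) : Complex.sqrt z ^ 2 = z := by
  simp [Complex.sqrt]

theorem sqrt_ne_zero {z : ℂ} (hz : z ≠ 0) : Complex.sqrt z ≠ 0 := by
  intro h
  have := sqrt_sq z
  rw [h] at this
  exact hz (by simpa using this.symm)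

theorem norm_sqrt_sq (z : ℂ) : ‖Complex.sqrt z‖ ^ 2 = ‖z‖ := by
  rw [← norm_pow, sqrt_sq]

theorem hasDerivAt_sqrt_one_sub {z : ℂ} (hz : 1 - z ∈ Complex.slitPlane) :
    HasDerivAt (fun z => Complex.sqrt (1 - z)) (-(1 / (2 * Complex.sqrt (1 - z)))) z := by
  have h0 : 1 - z ≠ 0 := Complex.slitPlane_ne_zero hz
  have h1 := (Complex.hasDerivAt_sqrt hz).comp z ((hasDerivAt_id z).const_sub 1)
  refine h1.congr_deriv ?_
  have h2 : (1 - z) ^ (-1 / 2 : ℂ) = (Complex.sqrt (1 - z))⁻¹ := by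
    rw [Complex.sqrt, ← Complex.cpow_neg]
    norm_num
  rw [h2, mul_neg, mul_one, one_div, mul_inv, div_eq_inv_mul]

theorem analyticAt_sqrt_one_sub {z : ℂ} (hz : 1 - z ∈ Complex.slitPlane) :
    AnalyticAt ℂ (fun z => Complex.sqrt (1 - z)) z := by
  have : ∀ᶠ w in 𝓝 z, 1 - w ∈ Complex.slitPlane :=
    (continuous_const.sub continuous_id).continuousAt.eventually
      (Complex.isOpen_slitPlane.mem_nhds hz)
  exact Complex.analyticAt_iff_eventually_differentiableAt.2
    (this.mono fun w hw => (hasDerivAt_sqrt_one_sub hw).differentiableAt)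

theorem tendsto_sqrt_one_sub : Tendsto (fun z : ℂ => Complex.sqrt (1 - z)) (𝓝 1) (𝓝 0) := by
  have h : ContinuousAt (fun z : ℂ => Complex.sqrt (1 - z)) 1 := by
    refine ContinuousAt.comp (g := Complex.sqrt) ?_ (by fun_prop)
    exact Complex.continuousAt_sqrt (by simp)
  simpa [ContinuousAt] using h

theorem one_sub_mem_slitPlane {z : ℂ} (hz : ‖z‖ ≤ 1) (h1 : z ≠ 1) :
    1 - z ∈ Complex.slitPlane := by
  rw [Complex.mem_slitPlane_iff]
  by_contra! h
  obtain ⟨hre, him⟩ := h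
  simp only [Complex.sub_re, Complex.one_re, Complex.sub_im, Complex.one_im, zero_sub,
    neg_eq_zero] at hre him
  refine h1 (Complex.ext ?_ him)
  have := (Complex.re_le_norm z).trans hz
  simp only [Complex.one_re]
  linarith

/-- First order division of an analytic function. -/
theorem exists_eq_add_mul {f : ℂ → ℂ} (hf : AnalyticAt ℂ f 0) :
    ∃ g : ℂ → ℂ, AnalyticAt ℂ g 0 ∧ g 0 = deriv f 0 ∧ ∀ s, f s = f 0 + s * g s := by
  refine ⟨dslope f 0, ?_, dslope_same f 0, fun s => ?_⟩
  · obtain ⟨p, hp⟩ := hf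
    exact ⟨_, hp.has_fpower_series_dslope_fslope⟩
  · have := sub_smul_dslope f 0 s
    rw [sub_zero, smul_eq_mul] at this
    rw [this]
    ring

/-- With `s = √(1 - z)` one has `ds/dz = -1 / (2 s)`, and the factor `s ^ 2` absorbs this pole: the
derivative is again an analytic function of `s`. -/
theorem eventually_hasDerivAt_sq_mul {m : ℂ → ℂ} (hm : AnalyticAt ℂ m 0) (C : ℂ) :
    ∀ᶠ z in 𝓝 (1 : ℂ), 1 - z ∈ Complex.slitPlane →
      HasDerivAt (fun z => C + Complex.sqrt (1 - z) ^ 2 * m (Complex.sqrt (1 - z)))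
        (-(m (Complex.sqrt (1 - z)) +
          Complex.sqrt (1 - z) / 2 * deriv m (Complex.sqrt (1 - z)))) z := by
  filter_upwards [tendsto_sqrt_one_sub.eventually hm.eventually_analyticAt] with z hz hsl
  have hs := hasDerivAt_sqrt_one_sub hsl
  have hs0 := sqrt_ne_zero (Complex.slitPlane_ne_zero hsl)
  have h1 := ((hs.pow 2).mul (hz.differentiableAt.hasDerivAt.comp z hs)).const_add C
  refine h1.congr_deriv ?_
  simp only [Function.comp_apply, Pi.pow_apply]
  field_simp
  ring

/-- If the second derivative of `∑ e_n z ^ n` is bounded on the unit disc, then `e_n = O(n⁻²)`. -/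
theorem norm_coeff_le_of_deriv_deriv_le {e : ℕ → ℂ} {G : ℂ → ℂ} {C : ℝ}
    (hG : ∀ z, ‖z‖ < 1 → AnalyticAt ℂ G z)
    (hsum : ∀ z, ‖z‖ < 1 → HasSum (fun n => e n * z ^ n) (G z))
    (hC : ∀ z, ‖z‖ < 1 → ‖deriv (deriv G) z‖ ≤ C) (n : ℕ) :
    ‖e (n + 2)‖ * ((n + 1) * (n + 2)) ≤ C := by
  have hcoeff : ∀ n, e n = iteratedDeriv n G 0 / n.factorial := by
    have h1 : HasFPowerSeriesAt G (FormalMultilinearSeries.ofScalars ℂ e) 0 := by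
      rw [hasFPowerSeriesAt_iff]
      filter_upwards [Metric.ball_mem_nhds (0 : ℂ) one_pos] with z hz
      rw [zero_add]
      refine (hsum z (by simpa using hz)).congr_fun fun n => ?_
      rw [FormalMultilinearSeries.coeff_ofScalars, smul_eq_mul, mul_comm]
    have h2 := (hG 0 (by simp)).hasFPowerSeriesAt
    have h3 := h1.eq_formalMultilinearSeries h2
    intro n
    have h4 := congrArg (fun p => FormalMultilinearSeries.coeff p n) h3
    simpa only [FormalMultilinearSeries.coeff_ofScalars] using h4
  have hb : ‖iteratedDeriv n (deriv (deriv G)) 0‖ ≤ n.factorial * C := by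
    -- Cauchy's estimate for the second derivative on circles of radius `r < 1`, followed by `r →
    -- 1`.
    have h1 : ∀ᶠ r in 𝓝[<] (1 : ℝ), ‖iteratedDeriv n (deriv (deriv G)) 0‖ ≤
        n.factorial * C / r ^ n := by
      filter_upwards [Ioo_mem_nhdsLT (zero_lt_one (α := ℝ))] with r hr
      refine Complex.norm_iteratedDeriv_le_of_forall_mem_sphere_norm_le n hr.1 ?_ ?_
      · refine DifferentiableOn.diffContOnCl fun z hz => ?_
        have hz' := Metric.closure_ball_subset_closedBall hz
        rw [mem_closedBall_zero_iff] at hz'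
        exact (hG z (hz'.trans_lt hr.2)).deriv.deriv.differentiableAt.differentiableWithinAt
      · intro z hz
        rw [mem_sphere_zero_iff_norm] at hz
        exact hC z (hz ▸ hr.2)
    have h2 : Tendsto (fun r : ℝ => n.factorial * C / r ^ n) (𝓝[<] 1) (𝓝 (n.factorial * C)) := by
      have : ContinuousAt (fun r : ℝ => n.factorial * C / r ^ n) 1 := by
        refine ContinuousAt.div (by fun_prop) (by fun_prop) (by simp)
      simpa [ContinuousAt] using this.mono_left nhdsWithin_le_nhds
    exact ge_of_tendsto h2 h1
  rw [hcoeff, norm_div, Complex.norm_natCast, iteratedDeriv_succ', iteratedDeriv_succ']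
  have hf : ((n + 2).factorial : ℝ) = (n + 2) * ((n + 1) * n.factorial) := by
    rw [Nat.factorial_succ, Nat.factorial_succ]
    push_cast
    ring
  have hn : (0 : ℝ) < n.factorial := by positivity
  rw [hf]
  have : ‖iteratedDeriv n (deriv (deriv G)) 0‖ / (((n : ℝ) + 2) * ((n + 1) * n.factorial)) *
      ((n + 1) * (n + 2)) = ‖iteratedDeriv n (deriv (deriv G)) 0‖ / n.factorial := by
    field_simp
  rw [this, div_le_iff₀ hn, mul_comm]
  exact hb

theorem tendsto_mul_rpow_of_norm_le {e : ℕ → ℂ} {C : ℝ}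
    (he : ∀ n : ℕ, ‖e (n + 2)‖ * ((n + 1) * (n + 2)) ≤ C) :
    Tendsto (fun n : ℕ => e n * (((n : ℝ) ^ (3 / 2 : ℝ) : ℝ) : ℂ)) atTop (𝓝 0) := by
  rw [tendsto_zero_iff_norm_tendsto_zero]
  have h1 : Tendsto (fun n : ℕ => 2 * C * (n : ℝ) ^ (-(1 / 2) : ℝ)) atTop (𝓝 0) := by
    have := ((tendsto_rpow_neg_atTop (show (0 : ℝ) < 1 / 2 by norm_num)).comp
      tendsto_natCast_atTop_atTop).const_mul (2 * C)
    simpa using this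
  refine squeeze_zero' (Eventually.of_forall fun n => norm_nonneg _) ?_ h1
  filter_upwards [eventually_ge_atTop 2] with n hn
  obtain ⟨m, rfl⟩ := Nat.exists_eq_add_of_le' hn
  have hm : (0 : ℝ) < ((m + 2 : ℕ) : ℝ) := by positivity
  rw [norm_mul, Complex.norm_real, Real.norm_of_nonneg (by positivity),
    show (3 / 2 : ℝ) = -(1 / 2) + 2 by norm_num, Real.rpow_add hm, mul_comm ((_ : ℝ) ^ _) (_ ^ _),
    ← mul_assoc]
  refine mul_le_mul_of_nonneg_right ?_ (by positivity)
  have h2 := he m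
  rw [show (2 : ℝ) = ((2 : ℕ) : ℝ) by norm_num, Real.rpow_natCast]
  push_cast
  have h3 := norm_nonneg (e (m + 2))
  have h4 : (0 : ℝ) ≤ m := Nat.cast_nonneg m
  calc ‖e (m + 2)‖ * ((m : ℝ) + 2) ^ 2 ≤ ‖e (m + 2)‖ * (2 * ((m + 1) * (m + 2))) :=
        mul_le_mul_of_nonneg_left (by nlinarith) h3
    _ = 2 * (‖e (m + 2)‖ * ((m + 1) * (m + 2))) := by ring
    _ ≤ 2 * C := by linarith


/-- `√(1 - z)`-expansions without the terms of orders `1` and `3` have bounded second derivative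
near `1`. -/
theorem exists_norm_deriv_deriv_le {G g : ℂ → ℂ} (hg : AnalyticAt ℂ g 0) (t₀ t₂ : ℂ)
    (hG : ∀ᶠ z in 𝓝 (1 : ℂ), ‖z‖ < 1 → G z = t₀ + Complex.sqrt (1 - z) ^ 2 *
      (t₂ + Complex.sqrt (1 - z) ^ 2 * g (Complex.sqrt (1 - z)))) :
    ∃ C : ℝ, ∀ᶠ z in 𝓝 (1 : ℂ), ‖z‖ < 1 → ‖deriv (deriv G) z‖ ≤ C := by
  have hsl : ∀ {z : ℂ}, ‖z‖ < 1 → 1 - z ∈ Complex.slitPlane := fun hz =>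
    one_sub_mem_slitPlane hz.le (by rintro rfl; simp at hz)
  have hball : ∀ {z : ℂ}, ‖z‖ < 1 → ∀ᶠ w in 𝓝 z, ‖w‖ < 1 := fun hz =>
    continuous_norm.continuousAt.eventually (gt_mem_nhds hz)
  set m : ℂ → ℂ := fun s => t₂ + s ^ 2 * g s with hm
  have hm_an : AnalyticAt ℂ m 0 := analyticAt_const.add ((analyticAt_id.pow 2).mul hg)
  -- Without a cubic term in `s`, the first derivative is again a constant plus `s ^ 2 p(s)`, so one
  -- can differentiate once more. Terms in `s` or `s ^ 3` would leave `s ^ (-3)` or `s ^ (-1)` in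
  -- the second derivative.
  set p : ℂ → ℂ := fun s => -(2 * g s + s / 2 * deriv g s) with hp
  have hp_an : AnalyticAt ℂ p 0 :=
    ((analyticAt_const.mul hg).add ((analyticAt_id.div_const).mul hg.deriv)).neg
  have h1 : ∀ᶠ z in 𝓝 (1 : ℂ), ‖z‖ < 1 →
      deriv G z = -t₂ + Complex.sqrt (1 - z) ^ 2 * p (Complex.sqrt (1 - z)) := by
    filter_upwards [hG.eventually_nhds, eventually_hasDerivAt_sq_mul hm_an t₀,
      tendsto_sqrt_one_sub.eventually hg.eventually_analyticAt] with z hz hder hgz hz1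
    have heq : G =ᶠ[𝓝 z] fun z => t₀ + Complex.sqrt (1 - z) ^ 2 * m (Complex.sqrt (1 - z)) := by
      filter_upwards [hz, hball hz1] with w hw hw1 using hw hw1
    rw [heq.deriv_eq, (hder (hsl hz1)).deriv]
    have hmd : deriv m (Complex.sqrt (1 - z)) = 2 * Complex.sqrt (1 - z) *
        g (Complex.sqrt (1 - z)) + Complex.sqrt (1 - z) ^ 2 * deriv g (Complex.sqrt (1 - z)) := by
      have h2 := (((hasDerivAt_id (Complex.sqrt (1 - z))).pow 2).mul
        hgz.differentiableAt.hasDerivAt).const_add t₂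
      refine (h2.congr_deriv ?_).deriv
      simp
    rw [hmd, hm, hp]
    ring
  have h2 : ∀ᶠ z in 𝓝 (1 : ℂ), ‖z‖ < 1 → deriv (deriv G) z =
      -(p (Complex.sqrt (1 - z)) + Complex.sqrt (1 - z) / 2 * deriv p (Complex.sqrt (1 - z))) := by
    filter_upwards [h1.eventually_nhds, eventually_hasDerivAt_sq_mul hp_an (-t₂)] with z hz hder hz1
    have heq : deriv G =ᶠ[𝓝 z] fun z =>
        -t₂ + Complex.sqrt (1 - z) ^ 2 * p (Complex.sqrt (1 - z)) := by
      filter_upwards [hz, hball hz1] with w hw hw1 using hw hw1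
    rw [heq.deriv_eq, (hder (hsl hz1)).deriv]
  have h3 : ContinuousAt (fun s => ‖-(p s + s / 2 * deriv p s)‖) 0 :=
    (hp_an.add ((analyticAt_id.div_const).mul hp_an.deriv)).neg.continuousAt.norm
  refine ⟨‖-(p 0 + 0 / 2 * deriv p 0)‖ + 1, ?_⟩
  filter_upwards [h2, tendsto_sqrt_one_sub.eventually (h3.eventually (gt_mem_nhds (lt_add_one _)))]
    with z hz hz' hz1
  rw [hz hz1]
  exact hz'.le

/-- Boundedness on the open unit disc is a local property at the points of the closed disc. -/
theorem exists_forall_norm_le_of_local {h : ℂ → ℂ}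
    (hloc : ∀ z : ℂ, ‖z‖ ≤ 1 → ∃ C : ℝ, ∀ᶠ w in 𝓝 z, ‖w‖ < 1 → ‖h w‖ ≤ C) :
    ∃ C : ℝ, ∀ z, ‖z‖ < 1 → ‖h z‖ ≤ C := by
  have := (isCompact_closedBall (0 : ℂ) 1).induction_on
    (p := fun s => ∃ C : ℝ, ∀ z ∈ s, ‖z‖ < 1 → ‖h z‖ ≤ C) ⟨0, by simp⟩
    (fun s t hst ⟨C, hC⟩ => ⟨C, fun z hz => hC z (hst hz)⟩)
    (fun s t ⟨C, hC⟩ ⟨D, hD⟩ => ⟨max C D, fun z hz hz1 => hz.elim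
      (fun hz => (hC z hz hz1).trans (le_max_left _ _))
      (fun hz => (hD z hz hz1).trans (le_max_right _ _))⟩)
    (fun z hz => by
      obtain ⟨C, hC⟩ := hloc z (by simpa using hz)
      exact ⟨_, mem_nhdsWithin_of_mem_nhds hC, C, fun w hw => hw⟩)
  obtain ⟨C, hC⟩ := this
  exact ⟨C, fun z hz => hC z (by simpa using hz.le) hz⟩

theorem tendsto_sqrtCoeff_mul_succ_rpow :
    Tendsto (fun n : ℕ => sqrtCoeff n * ((n + 1 : ℕ) : ℝ) ^ (3 / 2 : ℝ)) atTop
      (𝓝 (-1 / (2 * Real.sqrt Real.pi))) := by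
  have h1 : Tendsto (fun n : ℕ => (((n : ℝ) + 1) / n) ^ (3 / 2 : ℝ)) atTop (𝓝 1) := by
    have h2 : Tendsto (fun n : ℕ => ((n : ℝ) + 1) / n) atTop (𝓝 1) := by
      have := (tendsto_natCast_div_add_atTop (1 : ℝ)).inv₀ one_ne_zero
      simpa using this
    simpa using h2.rpow_const (p := 3 / 2) (Or.inl one_ne_zero)
  have h3 := tendsto_sqrtCoeff.mul h1
  rw [mul_one] at h3
  refine h3.congr' ?_
  filter_upwards [eventually_ge_atTop 1] with n hn
  have hn0 : (0 : ℝ) < n := by exact_mod_cast hn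
  rw [mul_assoc, ← Real.mul_rpow hn0.le (by positivity), mul_div_cancel₀ _ hn0.ne', Nat.cast_succ]

/-- Singularity analysis for a square root singularity: a function that is analytic on the closed
unit disc except at `1`, where it is an analytic function of `√(1 - z)`, has Taylor coefficients
asymptotic to those of the leading singular term. -/
theorem tendsto_coeff_of_sqrt_singularity {c : ℕ → ℂ} {F T : ℂ → ℂ}
    (hF : ∀ z, ‖z‖ ≤ 1 → z ≠ 1 → AnalyticAt ℂ F z)
    (hsum : ∀ z, ‖z‖ < 1 → HasSum (fun n => c n * z ^ n) (F z))
    (hT : AnalyticAt ℂ T 0)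
    (hFT : ∀ᶠ z in 𝓝 (1 : ℂ), ‖z‖ < 1 → F z = T (Complex.sqrt (1 - z))) :
    Tendsto (fun n : ℕ => c n * (((n : ℝ) ^ (3 / 2 : ℝ) : ℝ) : ℂ)) atTop
      (𝓝 (deriv T 0 * ((-1 / (2 * Real.sqrt Real.pi) : ℝ) : ℂ))) := by
  obtain ⟨g₁, hg₁, ht₁, hT₁⟩ := exists_eq_add_mul hT
  obtain ⟨g₂, hg₂, -, hT₂⟩ := exists_eq_add_mul hg₁
  obtain ⟨g₃, hg₃, -, hT₃⟩ := exists_eq_add_mul hg₂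
  obtain ⟨g₄, hg₄, -, hT₄⟩ := exists_eq_add_mul hg₃
  -- Since `√(1 - z) - z √(1 - z) = √(1 - z) ^ 3`, this removes the terms of orders `1` and `3`.
  -- Multiplication by `z` shifts the coefficients, hence `b'`, with value `0` at `n = 0`.
  set G : ℂ → ℂ := fun z => F z - g₁ 0 * Complex.sqrt (1 - z) -
    g₃ 0 * (Complex.sqrt (1 - z) - z * Complex.sqrt (1 - z)) with hGdef
  set b : ℕ → ℂ := fun n => (sqrtCoeff n : ℂ) with hb
  set b' : ℕ → ℂ := fun n => if n = 0 then 0 else (sqrtCoeff (n - 1) : ℂ) with hb'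
  set e : ℕ → ℂ := fun n => c n - g₁ 0 * b n - g₃ 0 * (b n - b' n) with he
  have hGan : ∀ z, ‖z‖ ≤ 1 → z ≠ 1 → AnalyticAt ℂ G z := by
    intro z hz h1
    have hs := analyticAt_sqrt_one_sub (one_sub_mem_slitPlane hz h1)
    exact ((hF z hz h1).sub (analyticAt_const.mul hs)).sub
      (analyticAt_const.mul (hs.sub (analyticAt_id.mul hs)))
  have hGsum : ∀ z, ‖z‖ < 1 → HasSum (fun n => e n * z ^ n) (G z) := by
    intro z hz
    have h1 := hasSum_sqrtCoeff hz
    have h2 : HasSum (fun n => b' n * z ^ n) (z * Complex.sqrt (1 - z)) := by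
      rw [← hasSum_nat_add_iff' 1]
      simp only [hb', Finset.sum_range_one, if_true, zero_mul, sub_zero]
      refine (h1.mul_left z).congr_fun fun n => ?_
      simp only [Nat.add_eq_zero_iff, one_ne_zero, and_false, if_false, Nat.add_sub_cancel]
      ring
    refine (((hsum z hz).sub (h1.mul_left (g₁ 0))).sub
      ((h1.sub h2).mul_left (g₃ 0))).congr_fun fun n => ?_
    simp only [he, hb]
    ring
  have hnear : ∃ C : ℝ, ∀ᶠ z in 𝓝 (1 : ℂ), ‖z‖ < 1 → ‖deriv (deriv G) z‖ ≤ C := by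
    refine exists_norm_deriv_deriv_le hg₄ (T 0) (g₂ 0) ?_
    filter_upwards [hFT] with z hz hz1
    simp only [hGdef]
    rw [hz hz1, hT₁, hT₂, hT₃, hT₄]
    have hs := sqrt_sq (1 - z)
    generalize Complex.sqrt (1 - z) = s at *
    obtain rfl : z = 1 - s ^ 2 := by rw [hs]; ring
    ring
  obtain ⟨C, hC⟩ : ∃ C : ℝ, ∀ z, ‖z‖ < 1 → ‖deriv (deriv G) z‖ ≤ C := by
    refine exists_forall_norm_le_of_local fun z hz => ?_
    rcases eq_or_ne z 1 with rfl | h1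
    · exact hnear
    · have hcont := (hGan z hz h1).deriv.deriv.continuousAt.norm
      exact ⟨_, (hcont.eventually (gt_mem_nhds (lt_add_one _))).mono fun w hw _ => hw.le⟩
  have hlim_e := tendsto_mul_rpow_of_norm_le (norm_coeff_le_of_deriv_deriv_le
    (fun z hz => hGan z hz.le (by rintro rfl; simp at hz)) hGsum hC)
  have hlim_b : Tendsto (fun n : ℕ => b n * (((n : ℝ) ^ (3 / 2 : ℝ) : ℝ) : ℂ)) atTop
      (𝓝 ((-1 / (2 * Real.sqrt Real.pi) : ℝ) : ℂ)) := by
    have := (Complex.continuous_ofReal.tendsto _).comp tendsto_sqrtCoeff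
    refine this.congr fun n => ?_
    simp [hb]
  have hlim_b' : Tendsto (fun n : ℕ => b' n * (((n : ℝ) ^ (3 / 2 : ℝ) : ℝ) : ℂ)) atTop
      (𝓝 ((-1 / (2 * Real.sqrt Real.pi) : ℝ) : ℂ)) := by
    rw [← tendsto_add_atTop_iff_nat 1]
    have := (Complex.continuous_ofReal.tendsto _).comp tendsto_sqrtCoeff_mul_succ_rpow
    refine this.congr fun n => ?_
    simp [hb']
  -- `b` and `b'` have the same limit after scaling, so the cubic term does not contribute to order
  -- `n ^ (-3/2)`.
  have hfin := (hlim_e.add (hlim_b.const_mul (g₁ 0))).add ((hlim_b.sub hlim_b').const_mul (g₃ 0))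
  rw [zero_add, sub_self, mul_zero, add_zero, ht₁] at hfin
  refine hfin.congr fun n => ?_
  simp only [he, ht₁]
  ring


/-! ### Local inversion of `v = z Φ(v)` on the unit circle -/

/-- At a non-critical point, a continuous solution of `v = z Φ(v)` on the closed unit disc is the
restriction of an analytic function. -/
theorem exists_analyticAt_of_noncritical {Φ v : ℂ → ℂ} {c : ℂ} (hΦ : AnalyticAt ℂ Φ (v c))
    (h0 : Φ (v c) ≠ 0) (hcrit : Φ (v c) ≠ v c * deriv Φ (v c)) (hc : ‖c‖ ≤ 1)
    (hcont : ContinuousWithinAt v (Metric.closedBall 0 1) c)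
    (hv : ∀ z, ‖z‖ ≤ 1 → v z = z * Φ (v z)) :
    ∃ E : ℂ → ℂ, AnalyticAt ℂ E c ∧ E c = v c ∧
      ∀ᶠ z in 𝓝 c, ‖z‖ ≤ 1 → E z = v z := by
  -- The equation reads `ψ (v z) = z`, and `hcrit` says that `ψ` has nonzero derivative at `v c`.
  set ψ : ℂ → ℂ := fun u => u / Φ u with hψ
  have hψan : AnalyticAt ℂ ψ (v c) := analyticAt_id.div hΦ h0
  have hψeq : ∀ {z}, ‖z‖ ≤ 1 → Φ (v z) ≠ 0 → ψ (v z) = z := fun {z} hz hz0 => by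
    simp only [hψ]
    rw [div_eq_iff hz0]
    exact hv z hz
  have hψ' : deriv ψ (v c) ≠ 0 := by
    have h1 := (hasDerivAt_id (v c)).div hΦ.differentiableAt.hasDerivAt h0
    have h2 : deriv ψ (v c) = _ := h1.deriv
    rw [h2]
    refine div_ne_zero ?_ (pow_ne_zero 2 h0)
    simpa [sub_eq_zero] using hcrit
  refine ⟨hψan.hasStrictDerivAt.localInverse _ _ _ hψ', ?_, ?_, ?_⟩
  · have := hψan.analyticAt_localInverse hψ'
    rwa [hψeq hc h0] at this
  · have := (HasStrictDerivAt.eventually_left_inverse hψan.hasStrictDerivAt hψ').self_of_nhds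
    rwa [hψeq hc h0] at this
  · have h1 := HasStrictDerivAt.eventually_left_inverse hψan.hasStrictDerivAt hψ'
    -- Continuity of `v` up to the boundary keeps `v z` where the local inverse of `ψ` is a left
    -- inverse.
    have h2 := hcont.eventually (h1.and (hΦ.continuousAt.eventually_ne h0))
    rw [eventually_nhdsWithin_iff] at h2
    filter_upwards [h2] with z hz hz1
    obtain ⟨h3, h4⟩ := hz (by simpa using hz1)
    rwa [hψeq hz1 h4] at h3

theorem deriv_deriv_eq_of_eq_add_mul {f g : ℂ → ℂ} (hg : AnalyticAt ℂ g 0)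
    (h : ∀ s, f s = f 0 + s * g s) : deriv (deriv f) 0 = 2 * deriv g 0 := by
  have h1 : deriv f =ᶠ[𝓝 0] fun s => g s + s * deriv g s := by
    filter_upwards [hg.eventually_analyticAt] with s hs
    have h2 := (((hasDerivAt_id s).mul hs.differentiableAt.hasDerivAt).const_add (f 0))
    have h3 : f = fun s => f 0 + ((id : ℂ → ℂ) * g) s := funext h
    rw [h3]
    refine h2.deriv.trans ?_
    simp
  rw [h1.deriv_eq]
  have h4 := hg.differentiableAt.hasDerivAt.add
    ((hasDerivAt_id (0 : ℂ)).mul hg.deriv.differentiableAt.hasDerivAt)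
  refine h4.deriv.trans ?_
  simp
  ring

theorem analyticAt_sqrt_comp {H : ℂ → ℂ} {x : ℂ} (hH : AnalyticAt ℂ H x)
    (h : H x ∈ Complex.slitPlane) : AnalyticAt ℂ (fun s => Complex.sqrt (H s)) x := by
  have h1 : AnalyticAt ℂ (fun z => Complex.sqrt (1 - z)) (1 - H x) :=
    analyticAt_sqrt_one_sub (by simpa using h)
  have h2 : AnalyticAt ℂ (fun s => Complex.sqrt (1 - (1 - H s))) x :=
    h1.comp_of_eq (f := fun s => 1 - H s) (analyticAt_const.sub hH) rfl
  refine h2.congr (Eventually.of_forall fun s => ?_)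
  simp

theorem re_sqrt_nonneg (z : ℂ) : 0 ≤ (Complex.sqrt z).re := by
  rw [Complex.sqrt, Complex.cpow_inv_two_re]
  exact Real.sqrt_nonneg _

theorem re_sq_sub_im_sq_sqrt (z : ℂ) :
    (Complex.sqrt z).re ^ 2 - (Complex.sqrt z).im ^ 2 = z.re := by
  conv_rhs => rw [← sqrt_sq z, pow_two, Complex.mul_re]
  ring

theorem abs_im_sqrt_le {z : ℂ} (hz : 0 ≤ z.re) :
    |(Complex.sqrt z).im| ≤ (Complex.sqrt z).re := by
  refine abs_le_of_sq_le_sq ?_ (re_sqrt_nonneg z)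
  linarith [re_sq_sub_im_sq_sqrt z]

/-- At the critical point `1`, a continuous solution of `v = z Φ(v)` on the closed unit disc is
an analytic function of `√(1 - z)`. -/
theorem exists_sqrt_expansion_of_critical {Φ v : ℂ → ℂ} {κ : ℝ} (hΦ : AnalyticAt ℂ Φ 1)
    (h0 : Φ 1 = 1) (h1 : deriv Φ 1 = 1) (h2 : deriv (deriv Φ) 1 = κ) (hκ : 0 < κ)
    (hv1 : v 1 = 1) (hcont : ContinuousWithinAt v (Metric.closedBall 0 1) 1)
    (hle : ∀ z, ‖z‖ ≤ 1 → ‖v z‖ ≤ 1) (hv : ∀ z, ‖z‖ ≤ 1 → v z = z * Φ (v z)) :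
    ∃ χ : ℂ → ℂ, AnalyticAt ℂ χ 0 ∧ χ 0 = 1 ∧ deriv χ 0 = -((Real.sqrt (2 / κ) : ℝ) : ℂ) ∧
      ∀ᶠ z in 𝓝 (1 : ℂ), ‖z‖ ≤ 1 → v z = χ (Complex.sqrt (1 - z)) := by
  set f : ℂ → ℂ := fun h => Φ (1 + h) with hf
  have hΦ' : AnalyticAt ℂ Φ (1 + 0) := by rwa [add_zero]
  have hfan : AnalyticAt ℂ f 0 :=
    hΦ'.comp (analyticAt_const.add analyticAt_id : AnalyticAt ℂ (fun h => (1 : ℂ) + h) 0)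
  have hf0 : f 0 = 1 := by simp [hf, h0]
  have hf1 : deriv f = fun h => deriv Φ (1 + h) := funext fun h => deriv_comp_const_add _ _ _
  have hf2 : deriv (deriv f) 0 = κ := by
    rw [hf1, deriv_comp_const_add (deriv Φ), add_zero, h2]
  obtain ⟨g₁, hg₁, hg₁0, hfg₁⟩ := exists_eq_add_mul hfan
  obtain ⟨g₂, hg₂, hg₂0, hg₁g₂⟩ := exists_eq_add_mul hg₁
  have hg₁1 : g₁ 0 = 1 := by rw [hg₁0, hf1]; simp [h1]
  have hg₂κ : g₂ 0 = ((κ / 2 : ℝ) : ℂ) := by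
    have := deriv_deriv_eq_of_eq_add_mul hg₁ hfg₁
    rw [hf2] at this
    rw [hg₂0]
    push_cast
    rw [this]
    ring
  have hfeq : ∀ h, f h - (1 + h) = h ^ 2 * g₂ h := by
    intro h
    rw [hfg₁, hf0, hg₁g₂, hg₁1]
    ring
  -- Writing `v = 1 + h`, the equation `1 + h = z f(h)` becomes `1 - z = h ^ 2 H(h)`, as `f` agrees
  -- with `1 + h` to first order.
  set H : ℂ → ℂ := fun h => g₂ h / f h with hH
  have hHan : AnalyticAt ℂ H 0 := hg₂.div hfan (by rw [hf0]; exact one_ne_zero)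
  have hH0 : H 0 = ((κ / 2 : ℝ) : ℂ) := by simp only [hH]; rw [hf0, div_one, hg₂κ]
  set q : ℂ → ℂ := fun h => Complex.sqrt (H h) with hq
  have hqan : AnalyticAt ℂ q 0 := analyticAt_sqrt_comp hHan (by
    rw [hH0, Complex.ofReal_mem_slitPlane]
    positivity)
  have hq0 : q 0 = ((Real.sqrt (κ / 2) : ℝ) : ℂ) := by
    simp only [hq]
    rw [hH0, Complex.sqrt, Real.sqrt_eq_rpow, Complex.ofReal_cpow (by positivity)]
    norm_num
  have hsq : 0 < Real.sqrt (κ / 2) := Real.sqrt_pos.2 (by positivity)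
  -- A square root of `h ^ 2 H(h)`. The sign is negative because `Re h ≤ 0` for `‖v‖ ≤ 1`, while `q
  -- h` is close to `√(κ / 2) > 0`.
  set K : ℂ → ℂ := fun h => -h * q h with hK
  have hKan : AnalyticAt ℂ K 0 := analyticAt_id.neg.mul hqan
  have hK0 : K 0 = 0 := by simp [hK]
  have hK' : deriv K 0 = -q 0 := by
    have h3 := (hasDerivAt_id (0 : ℂ)).neg.mul hqan.differentiableAt.hasDerivAt
    refine (h3.deriv : deriv K 0 = _).trans ?_
    simp
  have hK'0 : deriv K 0 ≠ 0 := by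
    rw [hK', hq0, neg_ne_zero, Complex.ofReal_ne_zero]
    exact hsq.ne'
  set L := hKan.hasStrictDerivAt.localInverse _ _ _ hK'0 with hL
  have hLan : AnalyticAt ℂ L 0 := by
    have := hKan.analyticAt_localInverse hK'0
    rwa [hK0] at this
  have hL0 : L 0 = 0 := by
    have := (HasStrictDerivAt.eventually_left_inverse hKan.hasStrictDerivAt hK'0).self_of_nhds
    rwa [hK0] at this
  have hL' : deriv L 0 = (deriv K 0)⁻¹ := by
    have := (HasStrictDerivAt.to_localInverse hKan.hasStrictDerivAt hK'0).hasDerivAt.deriv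
    rwa [hK0] at this
  refine ⟨fun s => 1 + L s, analyticAt_const.add hLan, by simp only [hL0, add_zero], ?_, ?_⟩
  · rw [deriv_const_add, hL', hK', hq0, inv_neg, ← Complex.ofReal_inv, ← Real.sqrt_inv, inv_div]
  · have hinv := HasStrictDerivAt.eventually_left_inverse hKan.hasStrictDerivAt hK'0
    have hcone : ∀ᶠ h in 𝓝 (0 : ℂ), |(q h).im| < (q h).re := by
      have hc := hqan.continuousAt
      refine (Complex.continuous_im.continuousAt.comp hc).abs.eventually_lt
        (Complex.continuous_re.continuousAt.comp hc) ?_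
      simpa [hq0] using hsq
    have hfne := hfan.continuousAt.eventually_ne (by rw [hf0]; exact one_ne_zero : f 0 ≠ 0)
    have htend : Tendsto (fun z => v z - 1) (𝓝[Metric.closedBall 0 1] 1) (𝓝 0) := by
      have := hcont.tendsto.sub_const 1
      rwa [hv1, sub_self] at this
    have hall := htend.eventually (hinv.and (hcone.and hfne))
    rw [eventually_nhdsWithin_iff] at hall
    filter_upwards [hall] with z hz hz1
    obtain ⟨hLK, hqz, hfz⟩ := hz (by simpa using hz1)
    set h := v z - 1 with hh
    have hvz : v z = 1 + h := by rw [hh]; ring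
    have hre : h.re ≤ 0 := by
      have := (Complex.re_le_norm (v z)).trans (hle z hz1)
      rw [hh, Complex.sub_re, Complex.one_re]
      linarith
    have hKsq : K h ^ 2 = 1 - z := by
      have h3 := hv z hz1
      rw [hvz] at h3
      have h4 : (1 + h) = z * f h := h3
      have h5 := hfeq h
      simp only [hK, hq]
      rw [mul_pow, sqrt_sq, neg_sq]
      simp only [hH]
      rw [← mul_div_assoc, ← h5, h4, sub_div, mul_div_assoc, div_self hfz, mul_one]
    set s := Complex.sqrt (1 - z) with hs
    have hss : s ^ 2 = 1 - z := sqrt_sq _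
    have hKs : K h = s := by
      rcases sq_eq_sq_iff_eq_or_eq_neg.1 (hKsq.trans hss.symm) with h3 | h3
      · exact h3
      -- Exclusion of the wrong branch. If `s = h q`, then `Re (s * conj q) = Re h * |q| ^ 2 ≤ 0`.
      -- But `s` lies in the closed sector of half-angle `π / 4` (as `Re (1 - z) ≥ 0`) and `q` in
      -- the open one, which forces `s = 0`.
      · have him : |s.im| ≤ s.re := abs_im_sqrt_le (by
          have := (Complex.re_le_norm z).trans hz1
          rw [Complex.sub_re, Complex.one_re]
          linarith)
        have hsq' : s = h * q h := by
          have : -h * q h = -s := h3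
          linear_combination this
        have h4 : s.re * (q h).re + s.im * (q h).im = h.re * Complex.normSq (q h) := by
          rw [hsq', Complex.mul_re, Complex.mul_im, Complex.normSq_apply]
          ring
        have h5 : h.re * Complex.normSq (q h) ≤ 0 :=
          mul_nonpos_of_nonpos_of_nonneg hre (Complex.normSq_nonneg _)
        have h6 : -(s.re * |(q h).im|) ≤ s.im * (q h).im := by
          have h7 := neg_abs_le (s.im * (q h).im)
          rw [abs_mul] at h7
          have h8 := mul_le_mul_of_nonneg_right him (abs_nonneg (q h).im)
          linarith
        have hs_re : s.re = 0 := by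
          have h9 : s.re * ((q h).re - |(q h).im|) ≤ 0 := by linarith
          have h10 : 0 ≤ s.re := re_sqrt_nonneg _
          nlinarith
        have hs_im : s.im = 0 := by
          rw [hs_re] at him
          exact abs_nonpos_iff.1 him
        have : s = 0 := Complex.ext hs_re hs_im
        rw [h3, this, neg_zero]
    have hLs : L s = h := by rw [← hKs]; exact hLK
    rw [hLs, hvz]


/-! ### Gluing local continuations across the unit circle -/

/-- `E` continues `f` analytically from the open unit disc to `B(c, r) ∩ Ω`. -/
structure IsLocalContinuation (Ω : Set ℂ) (f : ℂ → ℂ) (c : ℂ) (r : ℝ) (E : ℂ → ℂ) : Prop where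
  norm_eq : ‖c‖ = 1
  pos : 0 < r
  analyticAt : ∀ z ∈ Metric.ball c r, z ∈ Ω → AnalyticAt ℂ E z
  eq : ∀ z ∈ Metric.ball c r, ‖z‖ < 1 → E z = f z

/-- Radial projection from outside onto the unit circle does not increase the distance to a point
`c` of the circle, so it stays inside balls centred there. -/
theorem norm_inv_norm_smul_sub_le {z c : ℂ} (hz : 1 ≤ ‖z‖) (hc : ‖c‖ = 1) :
    ‖(‖z‖⁻¹ : ℝ) • z - c‖ ≤ ‖z - c‖ := by
  have hz0 : 0 < ‖z‖ := one_pos.trans_le hz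
  have h1 : ‖(‖z‖⁻¹ : ℝ) • z‖ = 1 := by
    rw [norm_smul, norm_inv, norm_norm, inv_mul_cancel₀ hz0.ne']
  refine le_of_sq_le_sq ?_ (norm_nonneg _)
  rw [norm_sub_sq_real, norm_sub_sq_real, h1, hc, real_inner_smul_left]
  have h2 : inner ℝ z c ≤ ‖z‖ := by simpa [hc] using real_inner_le_norm z c
  set x := inner ℝ z c
  set ρ := ‖z‖
  have h3 : ρ⁻¹ * x ≤ 1 := by
    rw [inv_mul_le_iff₀ hz0]
    linarith
  have h4 : x = ρ * (ρ⁻¹ * x) := by rw [← mul_assoc, mul_inv_cancel₀ hz0.ne', one_mul]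
  set y := ρ⁻¹ * x
  rw [h4]
  nlinarith [mul_nonneg (sub_nonneg.2 hz) (sub_nonneg.2 h3)]

/-- From `z` outside the open disc, move radially to a point `t • z` just inside it. The segment
stays in both balls by convexity and in `Ω` by star-shapedness, and `E = E' = f` near `t • z`; the
identity theorem applies along the segment. -/
theorem IsLocalContinuation.eq_of_mem {Ω : Set ℂ} (hstar : StarConvex ℝ 0 Ω) {f : ℂ → ℂ}
    {c c' : ℂ} {r r' : ℝ} {E E' : ℂ → ℂ} (h : IsLocalContinuation Ω f c r E)
    (h' : IsLocalContinuation Ω f c' r' E') {z : ℂ} (hz : z ∈ Metric.ball c r)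
    (hz' : z ∈ Metric.ball c' r') (hzΩ : z ∈ Ω) : E z = E' z := by
  rcases lt_or_ge ‖z‖ 1 with hlt | hge
  · rw [h.eq z hz hlt, h'.eq z hz' hlt]
  have hz0 : 0 < ‖z‖ := one_pos.trans_le hge
  set U := Metric.ball c r ∩ Metric.ball c' r' with hU
  have hUo : IsOpen U := Metric.isOpen_ball.inter Metric.isOpen_ball
  have hUc : Convex ℝ U := (convex_ball c r).inter (convex_ball c' r')
  have hproj : (‖z‖⁻¹ : ℝ) • z ∈ U := by
    constructor
    · rw [mem_ball_iff_norm] at hz ⊢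
      exact (norm_inv_norm_smul_sub_le hge h.norm_eq).trans_lt hz
    · rw [mem_ball_iff_norm] at hz' ⊢
      exact (norm_inv_norm_smul_sub_le hge h'.norm_eq).trans_lt hz'
  have hev : ∀ᶠ t in 𝓝[<] (‖z‖⁻¹ : ℝ), t • z ∈ U ∧ 0 < t := by
    refine Filter.Eventually.and ?_ ?_
    · have : ContinuousAt (fun t : ℝ => t • z) ‖z‖⁻¹ := by fun_prop
      exact (this.eventually (hUo.mem_nhds hproj)).filter_mono nhdsWithin_le_nhds
    · exact (lt_mem_nhds (inv_pos.2 hz0)).filter_mono nhdsWithin_le_nhds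
  obtain ⟨t, ⟨htU, ht0⟩, htlt⟩ := (hev.and self_mem_nhdsWithin).exists
  have htlt : t < ‖z‖⁻¹ := htlt
  have ht1 : t ≤ 1 := htlt.le.trans (inv_le_one_of_one_le₀ hge)
  have htz : ‖t • z‖ < 1 := by
    rw [norm_smul, Real.norm_of_nonneg ht0.le]
    calc t * ‖z‖ < ‖z‖⁻¹ * ‖z‖ := mul_lt_mul_of_pos_right htlt hz0
      _ = 1 := inv_mul_cancel₀ hz0.ne'
  have hsegU : segment ℝ (t • z) z ⊆ U := hUc.segment_subset htU ⟨hz, hz'⟩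
  have hsegΩ : segment ℝ (t • z) z ⊆ Ω := by
    rintro w ⟨a, b, ha, hb, hab, rfl⟩
    have : a • t • z + b • z = (a * t + b) • z := by rw [add_smul, mul_smul]
    rw [this]
    refine hstar.smul_mem hzΩ (by positivity) ?_
    nlinarith
  have heq : E =ᶠ[𝓝 (t • z)] E' := by
    filter_upwards [hUo.mem_nhds htU, continuous_norm.continuousAt.eventually (gt_mem_nhds htz)]
      with w hw hw1
    rw [h.eq w hw.1 hw1, h'.eq w hw.2 hw1]
  have han : AnalyticOnNhd ℂ E (segment ℝ (t • z) z) := fun w hw =>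
    h.analyticAt w (hsegU hw).1 (hsegΩ hw)
  have han' : AnalyticOnNhd ℂ E' (segment ℝ (t • z) z) := fun w hw =>
    h'.analyticAt w (hsegU hw).2 (hsegΩ hw)
  exact han.eqOn_of_preconnected_of_eventuallyEq han' (convex_segment _ _).isPreconnected
    (left_mem_segment ℝ _ _) heq (right_mem_segment ℝ _ _)

/-- Local analytic continuations across the points of the unit circle, on a star-shaped domain,
glue to a continuation to a larger disc. -/
theorem exists_continuation {Ω : Set ℂ} (hΩ : IsOpen Ω) (hstar : StarConvex ℝ 0 Ω)
    {f : ℂ → ℂ} (hf : ∀ z, ‖z‖ < 1 → AnalyticAt ℂ f z)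
    (hloc : ∀ c : ℂ, ‖c‖ = 1 → ∃ r E, IsLocalContinuation Ω f c r E) :
    ∃ R : ℝ, 1 < R ∧ ∃ F : ℂ → ℂ, (∀ z ∈ Ω, ‖z‖ < R → AnalyticAt ℂ F z) ∧
      (∀ z, ‖z‖ < 1 → F z = f z) ∧
      ∀ c r E, IsLocalContinuation Ω f c r E → ∀ z ∈ Metric.ball c r, z ∈ Ω → ‖z‖ < R →
        F z = E z := by
  have hloc' : ∀ c : Metric.sphere (0 : ℂ) 1, ∃ r E, IsLocalContinuation Ω f c r E := fun c =>
    hloc c (by simp)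
  choose r E hE using hloc'
  -- A Lebesgue number for the cover of the circle: `z` with `1 ≤ ‖z‖ < 1 + δ` lies within `δ` of
  -- its radial projection, hence in one of the balls.
  obtain ⟨δ, hδ, hcov⟩ := lebesgue_number_lemma_of_metric (isCompact_sphere (0 : ℂ) 1)
    (c := fun c : Metric.sphere (0 : ℂ) 1 => Metric.ball (c : ℂ) (r c))
    (fun c => Metric.isOpen_ball)
    (fun c hc => Set.mem_iUnion.2 ⟨⟨c, hc⟩, Metric.mem_ball_self (hE ⟨c, hc⟩).pos⟩)
  have hcov' : ∀ z : ℂ, ∃ k : Metric.sphere (0 : ℂ) 1, 1 ≤ ‖z‖ → ‖z‖ < 1 + δ →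
      z ∈ Metric.ball (k : ℂ) (r k) := by
    intro z
    by_cases hz : 1 ≤ ‖z‖
    · have hz0 : 0 < ‖z‖ := one_pos.trans_le hz
      have h1 : (‖z‖⁻¹ : ℝ) • z ∈ Metric.sphere (0 : ℂ) 1 := by
        rw [mem_sphere_zero_iff_norm, norm_smul, norm_inv, norm_norm, inv_mul_cancel₀ hz0.ne']
      obtain ⟨k, hk⟩ := hcov _ h1
      refine ⟨k, fun _ hzδ => hk ?_⟩
      have h2 : z - (‖z‖⁻¹ : ℝ) • z = (1 - ‖z‖⁻¹ : ℝ) • z := by rw [sub_smul, one_smul]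
      have h3 : ‖z‖⁻¹ ≤ 1 := inv_le_one_of_one_le₀ hz
      rw [mem_ball_iff_norm, h2, norm_smul, Real.norm_of_nonneg (by linarith), sub_mul, one_mul,
        inv_mul_cancel₀ hz0.ne']
      linarith
    · exact ⟨⟨1, by simp⟩, fun h => absurd h hz⟩
  choose k hk using hcov'
  classical
  -- The choice of ball `k z` may jump with `z`; by `eq_of_mem` the value does not depend on it, so
  -- `F` is locally a single `E`.
  set F : ℂ → ℂ := fun z => if ‖z‖ < 1 then f z else E (k z) z with hF
  have hFf : ∀ z, ‖z‖ < 1 → F z = f z := fun z hz => if_pos hz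
  have hFE : ∀ c r E, IsLocalContinuation Ω f c r E → ∀ z ∈ Metric.ball c r, z ∈ Ω →
      ‖z‖ < 1 + δ → F z = E z := by
    intro c r E h z hz hzΩ hzδ
    rcases lt_or_ge ‖z‖ 1 with hlt | hge
    · rw [hFf z hlt, h.eq z hz hlt]
    · simp only [hF]
      rw [if_neg hge.not_gt]
      exact (hE (k z)).eq_of_mem hstar h (hk z hge hzδ) hz hzΩ
  refine ⟨1 + δ, by linarith, F, fun z hzΩ hzδ => ?_, hFf, hFE⟩
  rcases lt_or_ge ‖z‖ 1 with hlt | hge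
  · refine (hf z hlt).congr ?_
    filter_upwards [continuous_norm.continuousAt.eventually (gt_mem_nhds hlt)] with w hw
    exact (hFf w hw).symm
  · have hzk := hk z hge hzδ
    refine ((hE (k z)).analyticAt z hzk hzΩ).congr ?_
    filter_upwards [Metric.isOpen_ball.mem_nhds hzk, hΩ.mem_nhds hzΩ,
      continuous_norm.continuousAt.eventually (gt_mem_nhds hzδ)] with w hw hwΩ hwδ
    exact (hFE _ _ _ (hE (k z)) w hw hwΩ hwδ).symm


/-! ### Critical offspring laws and their generating functions -/

/-- Critical offspring weights: `q k` is the probability of `d * k` children. -/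
structure IsCritical (d : ℕ) (q : ℕ → ℝ) (V r : ℝ) : Prop where
  d_pos : 0 < d
  nonneg : ∀ k, 0 ≤ q k
  zero_pos : 0 < q 0
  hasSum : HasSum q 1
  hasSum_mean : HasSum (fun k : ℕ => (d * k : ℝ) * q k) 1
  hasSum_variance : HasSum (fun k : ℕ => (d * k : ℝ) * (d * k - 1) * q k) V
  variance_pos : 0 < V
  one_lt : 1 < r
  summable : Summable fun k => q k * r ^ k
  aperiodic : ∀ v : ℂ, (∀ k, q k ≠ 0 → v ^ k = 1) → v = 1

/-- The probability generating function `∑ q_k v ^ k`. -/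
noncomputable def pgf (q : ℕ → ℝ) (v : ℂ) : ℂ := ∑' k, (q k : ℂ) * v ^ k

namespace IsCritical

variable {d : ℕ} {q : ℕ → ℝ} {V r : ℝ}

theorem norm_le (h : IsCritical d q V r) (k : ℕ) {v : ℂ} (hv : v ∈ Metric.ball (0 : ℂ) r) :
    ‖(q k : ℂ) * v ^ k‖ ≤ q k * r ^ k := by
  rw [norm_mul, norm_pow, Complex.norm_real, Real.norm_of_nonneg (h.nonneg k)]
  exact mul_le_mul_of_nonneg_left
    (pow_le_pow_left₀ (norm_nonneg _) (mem_ball_zero_iff.1 hv).le k) (h.nonneg k)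

theorem mem_ball (h : IsCritical d q V r) {v : ℂ} (hv : ‖v‖ ≤ 1) : v ∈ Metric.ball (0 : ℂ) r :=
  mem_ball_zero_iff.2 (hv.trans_lt h.one_lt)

theorem hasSum_pgf (h : IsCritical d q V r) {v : ℂ} (hv : v ∈ Metric.ball (0 : ℂ) r) :
    HasSum (fun k => (q k : ℂ) * v ^ k) (pgf q v) :=
  (Summable.of_norm_bounded h.summable fun k => h.norm_le k hv).hasSum

theorem analyticAt_pgf (h : IsCritical d q V r) {v : ℂ} (hv : v ∈ Metric.ball (0 : ℂ) r) :
    AnalyticAt ℂ (pgf q) v := by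
  have : DifferentiableOn ℂ (pgf q) (Metric.ball 0 r) :=
    Complex.differentiableOn_tsum_of_summable_norm h.summable (fun k => by fun_prop)
      Metric.isOpen_ball fun k w hw => h.norm_le k hw
  exact this.analyticAt (Metric.isOpen_ball.mem_nhds hv)

theorem hasSum_deriv_pgf (h : IsCritical d q V r) {v : ℂ} (hv : v ∈ Metric.ball (0 : ℂ) r) :
    HasSum (fun k => (q k : ℂ) * (k * v ^ (k - 1))) (deriv (pgf q) v) := by
  have := Complex.hasSum_deriv_of_summable_norm (F := fun k v => (q k : ℂ) * v ^ k) h.summable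
    (fun k => by fun_prop) Metric.isOpen_ball (fun k w hw => h.norm_le k hw) hv
  refine this.congr_fun fun k => ?_
  simp

theorem hasSum_deriv_deriv_pgf_one (h : IsCritical d q V r) :
    HasSum (fun k => (q k : ℂ) * (k * (k - 1 : ℕ))) (deriv (deriv (pgf q)) 1) := by
  obtain ⟨r', h1, h2⟩ := exists_between h.one_lt
  have hr0 : 0 < r' := one_pos.trans h1
  have hu : Summable fun k : ℕ => q k * (k * r' ^ (k - 1)) := by
    have h3 := (h.hasSum_deriv_pgf (v := (r' : ℂ))
      (by rw [mem_ball_zero_iff, Complex.norm_real, Real.norm_of_nonneg hr0.le]; exact h2)).summable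
    exact_mod_cast h3
  have h4 := Complex.hasSum_deriv_of_summable_norm (z := 1) (U := Metric.ball 0 r')
    (F := fun k v => (q k : ℂ) * (k * v ^ (k - 1))) hu
    (fun k => by fun_prop) Metric.isOpen_ball (fun k w hw => by
      rw [norm_mul, norm_mul, norm_pow, Complex.norm_real, Real.norm_of_nonneg (h.nonneg k),
        Complex.norm_natCast]
      have := pow_le_pow_left₀ (norm_nonneg _) (mem_ball_zero_iff.1 hw).le (k - 1)
      exact mul_le_mul_of_nonneg_left (mul_le_mul_of_nonneg_left this (Nat.cast_nonneg k))
        (h.nonneg k)) (by simpa using h1)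
  have h5 : (fun w => ∑' k : ℕ, (q k : ℂ) * (k * w ^ (k - 1))) =ᶠ[𝓝 1] deriv (pgf q) := by
    filter_upwards [Metric.isOpen_ball.mem_nhds (h.mem_ball (v := 1) (by simp))] with w hw
    exact (h.hasSum_deriv_pgf hw).tsum_eq
  rw [h5.deriv_eq] at h4
  refine h4.congr_fun fun k => ?_
  simp

theorem pgf_one (h : IsCritical d q V r) : pgf q 1 = 1 := by
  have h1 := h.hasSum_pgf (h.mem_ball (v := 1) (by simp))
  simp only [one_pow, mul_one] at h1
  have h2 := Complex.hasSum_ofReal.2 h.hasSum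
  rw [Complex.ofReal_one] at h2
  exact h1.unique h2

theorem deriv_pgf_one (h : IsCritical d q V r) : d * deriv (pgf q) 1 = 1 := by
  have h1 := (h.hasSum_deriv_pgf (h.mem_ball (v := 1) (by simp))).mul_left (d : ℂ)
  refine h1.unique ?_
  have h2 := Complex.hasSum_ofReal.2 h.hasSum_mean
  rw [Complex.ofReal_one] at h2
  refine h2.congr_fun fun k => ?_
  push_cast
  rw [one_pow]
  ring

/-- From `dk (dk - 1) = d ^ 2 k (k - 1) + (d - 1) dk` and mean `1`. -/
theorem deriv_deriv_pgf_one (h : IsCritical d q V r) :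
    (d : ℂ) ^ 2 * deriv (deriv (pgf q)) 1 + (d - 1) = V := by
  have h1 := (h.hasSum_deriv_deriv_pgf_one.mul_left ((d : ℂ) ^ 2))
  have h2 := (Complex.hasSum_ofReal.2 h.hasSum_mean).mul_left ((d : ℂ) - 1)
  have h3 := Complex.hasSum_ofReal.2 h.hasSum_variance
  rw [Complex.ofReal_one, mul_one] at h2
  refine (h1.add h2).unique (h3.congr_fun fun k => ?_)
  rcases k with _ | k
  · simp
  · push_cast
    ring

/-- Otherwise `dk` only takes the values `0` and `1` on the support, and `V` would vanish. Such a
`k` provides the strictness in the convexity arguments below. -/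
theorem exists_two_le (h : IsCritical d q V r) : ∃ k, q k ≠ 0 ∧ 2 ≤ d * k := by
  by_contra! hcon
  have : ∀ k : ℕ, (d * k : ℝ) * (d * k - 1) * q k = 0 := by
    intro k
    by_cases hq : q k = 0
    · rw [hq, mul_zero]
    · have h1 := hcon k hq
      have h2 : d * k = 0 ∨ d * k = 1 := by omega
      rcases h2 with h2 | h2
      · have h3 : (d * k : ℝ) = 0 := by exact_mod_cast h2
        rw [h3]
        ring
      · have h3 : (d * k : ℝ) = 1 := by exact_mod_cast h2
        rw [h3]
        ring
  have h1 := h.hasSum_variance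
  simp only [this] at h1
  exact h.variance_pos.ne' (h1.unique hasSum_zero)

/-- `1` is the only fixed point in `[0, 1]`. -/
theorem eq_one_of_hasSum (h : IsCritical d q V r) {y : ℝ} (hy : 0 ≤ y)
    (hsum : HasSum (fun k => q k * (y ^ d) ^ k) y) : y = 1 := by
  -- Subtract from each `y ^ (dk)` its tangent line at `1`; by total mass `1` and mean `1` the
  -- tangent lines sum to `y`. Bernoulli makes every term nonnegative, so each one is zero.
  have h1 : HasSum (fun k => q k * ((y ^ d) ^ k - (1 + (d * k : ℝ) * (y - 1)))) 0 := by
    have := hsum.sub (h.hasSum.add (h.hasSum_mean.mul_right (y - 1)))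
    rw [one_mul, add_sub_cancel, sub_self] at this
    refine this.congr_fun fun k => ?_
    ring
  have hbern : ∀ n : ℕ, 1 + (n : ℝ) * (y - 1) ≤ y ^ n := fun n => by
    have := one_add_mul_le_pow (a := y - 1) (by linarith) n
    rwa [add_sub_cancel] at this
  have hnn : ∀ k, 0 ≤ q k * ((y ^ d) ^ k - (1 + (d * k : ℝ) * (y - 1))) := fun k => by
    have := hbern (d * k)
    rw [pow_mul] at this
    push_cast at this
    exact mul_nonneg (h.nonneg k) (by linarith)
  have h2 := (hasSum_zero_iff_of_nonneg hnn).1 h1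
  obtain ⟨k, hqk, hk⟩ := h.exists_two_le
  have h3 := congrFun h2 k
  simp only [Pi.zero_apply, mul_eq_zero, hqk, false_or] at h3
  obtain ⟨m, hm⟩ := Nat.exists_eq_add_of_le' hk
  have h4 : (d * k : ℝ) = m + 2 := by exact_mod_cast hm
  rw [← pow_mul, hm, h4, pow_succ] at h3
  have h5 := mul_le_mul_of_nonneg_right (hbern (m + 1)) hy
  push_cast at h5
  have h6 : ((m : ℝ) + 1) * (y - 1) ^ 2 ≤ 0 := by nlinarith
  have h7 : (y - 1) ^ 2 ≤ 0 := by
    by_contra! h8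
    have : (0 : ℝ) < ((m : ℝ) + 1) * (y - 1) ^ 2 := by positivity
    linarith
  have h8 : y - 1 = 0 := by
    have := le_antisymm h7 (sq_nonneg _)
    exact pow_eq_zero_iff two_ne_zero |>.1 this
  linarith

theorem eq_one_of_norm_le_of_re_eq {u : ℂ} (hu : ‖u‖ ≤ 1) (hre : u.re = 1) : u = 1 := by
  have h1 : u.re ^ 2 + u.im ^ 2 ≤ 1 := by
    have := Complex.sq_norm u
    rw [Complex.normSq_apply] at this
    nlinarith [norm_nonneg u]
  refine Complex.ext hre ?_
  rw [hre] at h1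
  rw [Complex.one_im]
  exact pow_eq_zero_iff two_ne_zero |>.1 (le_antisymm (by linarith) (sq_nonneg u.im))

/-- The only critical point of `v / pgf ^ d` on the relevant part of the closed unit disc. -/
theorem noncritical (h : IsCritical d q V r) {c w : ℂ} (hc : ‖c‖ ≤ 1) (hw : ‖w‖ ≤ 1)
    (hpw : pgf q (c * w ^ d) = w)
    (hcrit : w = d * (c * w ^ d) * deriv (pgf q) (c * w ^ d)) : c = 1 := by
  set u := c * w ^ d with hu
  have hu1 : ‖u‖ ≤ 1 := by
    rw [hu, norm_mul, norm_pow]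
    exact mul_le_one₀ hc (by positivity) (pow_le_one₀ (norm_nonneg _) hw)
  have hpow : ∀ k, ‖u ^ k‖ ≤ 1 := fun k => by
    rw [norm_pow]
    exact pow_le_one₀ (norm_nonneg _) hu1
  have hs1 := h.hasSum_pgf (h.mem_ball hu1)
  have hs2 := (h.hasSum_deriv_pgf (h.mem_ball hu1)).mul_left (d * u)
  rw [hpw] at hs1
  rw [← hcrit] at hs2
  -- The two hypotheses give `∑ (dk - 1) q_k u ^ k = 0`, and mass and mean give the same at `u = 1`.
  -- In the difference the term `k = 0`, the only one with a negative factor, disappears, so all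
  -- real parts are nonnegative.
  have hs3 : HasSum (fun k : ℕ => (((d * k : ℝ) - 1) * q k : ℝ) * (1 - u ^ k)) (0 : ℂ) := by
    have h4 := Complex.hasSum_ofReal.2 (h.hasSum_mean.sub h.hasSum)
    have h5 := h4.sub (hs2.sub hs1)
    simp only [sub_self, Complex.ofReal_zero] at h5
    refine h5.congr_fun fun k => ?_
    rcases k with _ | k
    · simp
    · push_cast
      simp only [pow_succ]
      ring
  have hs4 := Complex.hasSum_re hs3
  simp only [Complex.re_ofReal_mul, Complex.sub_re, Complex.one_re, Complex.zero_re] at hs4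
  have hnn : ∀ k : ℕ, 0 ≤ ((d * k : ℝ) - 1) * q k * (1 - (u ^ k).re) := fun k => by
    rcases Nat.eq_zero_or_pos k with rfl | hk
    · simp
    · have h1 : (1 : ℝ) ≤ d * k := by exact_mod_cast Nat.mul_pos h.d_pos hk
      have h2 := (Complex.re_le_norm (u ^ k)).trans (hpow k)
      exact mul_nonneg (mul_nonneg (by linarith) (h.nonneg k)) (by linarith)
  have hz := (hasSum_zero_iff_of_nonneg hnn).1 hs4
  obtain ⟨k, hqk, hk⟩ := h.exists_two_le
  have huk : u ^ k = 1 := by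
    refine eq_one_of_norm_le_of_re_eq (hpow k) ?_
    have h3 := congrFun hz k
    have h4 : (2 : ℝ) ≤ d * k := by exact_mod_cast hk
    simp only [Pi.zero_apply, mul_eq_zero, hqk, or_false] at h3
    rcases h3 with h3 | h3 <;> linarith
  have hk0 : k ≠ 0 := by
    rintro rfl
    omega
  have hun : ‖u‖ = 1 := by
    have := congrArg norm huk
    rw [norm_pow, norm_one] at this
    exact (pow_eq_one_iff_of_nonneg (norm_nonneg _) hk0).1 this
  have hwn : ‖w‖ = 1 := by
    have h3 : ‖c‖ * ‖w‖ ^ d = 1 := by rw [← norm_pow, ← norm_mul]; exact hun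
    have h4 : ‖w‖ ^ d ≤ 1 := pow_le_one₀ (norm_nonneg _) hw
    have h5 : ‖w‖ ^ d = 1 := by
      refine le_antisymm h4 ?_
      calc 1 = ‖c‖ * ‖w‖ ^ d := h3.symm
        _ ≤ 1 * ‖w‖ ^ d := mul_le_mul_of_nonneg_right hc (by positivity)
        _ = ‖w‖ ^ d := one_mul _
    exact (pow_eq_one_iff_of_nonneg (norm_nonneg _) h.d_pos.ne').1 h5
  set wc := (starRingEnd ℂ) w with hwc
  have hww : w * wc = 1 := by
    rw [hwc, Complex.mul_conj, Complex.normSq_eq_norm_sq, hwn]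
    simp
  have hnw : ∀ k, ‖u ^ k * wc‖ ≤ 1 := fun k => by
    rw [norm_mul, hwc, Complex.norm_conj, hwn, mul_one]
    exact hpow k
  -- Equality case of the triangle inequality: an average of the points `u ^ k` of the disc equals
  -- `w` of modulus `1`, so `u ^ k = w` on the support. The index `k = 0` then gives `w = 1`, and
  -- aperiodicity gives `u = 1`.
  have hs5 : HasSum (fun k => q k * (1 - (u ^ k * wc).re)) 0 := by
    have h4 := Complex.hasSum_re (hs1.mul_right wc)
    rw [hww, Complex.one_re] at h4
    have h5 := h.hasSum.sub h4
    rw [sub_self] at h5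
    refine h5.congr_fun fun k => ?_
    rw [mul_assoc, Complex.re_ofReal_mul]
    ring
  have hz' := (hasSum_zero_iff_of_nonneg fun k => mul_nonneg (h.nonneg k)
    (sub_nonneg.2 ((Complex.re_le_norm _).trans (hnw k)))).1 hs5
  have hall : ∀ k, q k ≠ 0 → u ^ k * wc = 1 := fun k hqk => by
    refine eq_one_of_norm_le_of_re_eq (hnw k) ?_
    have h3 := congrFun hz' k
    simp only [Pi.zero_apply, mul_eq_zero, hqk, false_or] at h3
    linarith
  have hwc1 : wc = 1 := by simpa using hall 0 h.zero_pos.ne'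
  have hw1 : w = 1 := by rwa [hwc1, mul_one] at hww
  have hu1 : u = 1 := h.aperiodic u fun k hqk => by simpa [hwc1] using hall k hqk
  rw [hu, hw1, one_pow, mul_one] at hu1
  exact hu1

end IsCritical


/-! ### Continuation of the solution of `Q = pgf (z Q ^ d)` -/

theorem isOpen_one_sub_slitPlane : IsOpen {z : ℂ | 1 - z ∈ Complex.slitPlane} :=
  Complex.isOpen_slitPlane.preimage (continuous_const.sub continuous_id)

theorem starConvex_one_sub_slitPlane : StarConvex ℝ 0 {z : ℂ | 1 - z ∈ Complex.slitPlane} := by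
  rw [starConvex_zero_iff]
  intro z hz a ha0 ha1
  have := Complex.starConvex_one_slitPlane.add_smul_sub_mem hz ha0 ha1
  have h2 : (1 : ℂ) + a • (1 - z - 1) = 1 - a • z := by
    rw [sub_sub_cancel_left, smul_neg, sub_eq_add_neg]
  rwa [h2] at this

/-- A function on the closed unit disc, given there by an absolutely convergent power series with
nonnegative coefficients, that solves `Q = pgf q (z Q ^ d)`. -/
structure IsSolution (d : ℕ) (q : ℕ → ℝ) (c : ℕ → ℝ) (Q : ℂ → ℂ) : Prop where
  nonneg : ∀ n, 0 ≤ c n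
  summable : Summable c
  tsum_le : ∑' n, c n ≤ 1
  hasSum : ∀ z : ℂ, ‖z‖ ≤ 1 → HasSum (fun n => (c n : ℂ) * z ^ n) (Q z)
  eq : ∀ z : ℂ, ‖z‖ ≤ 1 → HasSum (fun k => (q k : ℂ) * (z * Q z ^ d) ^ k) (Q z)

namespace IsSolution

variable {d : ℕ} {q c : ℕ → ℝ} {Q : ℂ → ℂ} {V r : ℝ}

theorem norm_term_le (h : IsSolution d q c Q) (n : ℕ) {z : ℂ} (hz : ‖z‖ ≤ 1) :
    ‖(c n : ℂ) * z ^ n‖ ≤ c n := by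
  rw [norm_mul, norm_pow, Complex.norm_real, Real.norm_of_nonneg (h.nonneg n)]
  exact mul_le_of_le_one_right (h.nonneg n) (pow_le_one₀ (norm_nonneg _) hz)

theorem norm_le_one (h : IsSolution d q c Q) {z : ℂ} (hz : ‖z‖ ≤ 1) : ‖Q z‖ ≤ 1 := by
  rw [← (h.hasSum z hz).tsum_eq]
  exact (tsum_of_norm_bounded h.summable.hasSum fun n => h.norm_term_le n hz).trans h.tsum_le

theorem continuousOn (h : IsSolution d q c Q) : ContinuousOn Q (Metric.closedBall 0 1) := by
  have h1 : ContinuousOn (fun z : ℂ => ∑' n, (c n : ℂ) * z ^ n) (Metric.closedBall 0 1) :=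
    continuousOn_tsum (fun n => by fun_prop) h.summable fun n z hz =>
      h.norm_term_le n (mem_closedBall_zero_iff.1 hz)
  exact h1.congr fun z hz => (h.hasSum z (mem_closedBall_zero_iff.1 hz)).tsum_eq.symm

theorem analyticAt (h : IsSolution d q c Q) {z : ℂ} (hz : ‖z‖ < 1) : AnalyticAt ℂ Q z := by
  have h1 : DifferentiableOn ℂ (fun z : ℂ => ∑' n, (c n : ℂ) * z ^ n) (Metric.ball 0 1) :=
    Complex.differentiableOn_tsum_of_summable_norm h.summable (fun n => by fun_prop)
      Metric.isOpen_ball fun n w hw => h.norm_term_le n (mem_ball_zero_iff.1 hw).le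
  have h2 := h1.congr fun z hz => (h.hasSum z (mem_ball_zero_iff.1 hz).le).tsum_eq.symm
  exact h2.analyticAt (Metric.isOpen_ball.mem_nhds (mem_ball_zero_iff.2 hz))

theorem eq_pgf (h : IsSolution d q c Q) {z : ℂ} (hz : ‖z‖ ≤ 1) : pgf q (z * Q z ^ d) = Q z :=
  (h.eq z hz).tsum_eq

theorem norm_mul_pow_le (h : IsSolution d q c Q) {z : ℂ} (hz : ‖z‖ ≤ 1) :
    ‖z * Q z ^ d‖ ≤ 1 := by
  rw [norm_mul, norm_pow]
  exact mul_le_one₀ hz (by positivity) (pow_le_one₀ (norm_nonneg _) (h.norm_le_one hz))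

/-- `Q 1` is the sum of the nonnegative `c n`, hence a nonnegative real fixed point of `y ↦ pgf (y ^
d)`, and `1` is the only candidate by `eq_one_of_hasSum`. -/
theorem apply_one (h : IsSolution d q c Q) (hq : IsCritical d q V r) : Q 1 = 1 := by
  have h1 := h.hasSum 1 (by simp)
  simp only [one_pow, mul_one] at h1
  have h2 : Q 1 = ((∑' n, c n : ℝ) : ℂ) := h1.unique (Complex.hasSum_ofReal.2 h.summable.hasSum)
  have h3 := h.eq 1 (by simp)
  rw [h2, one_mul] at h3
  have h4 : HasSum (fun k => q k * ((∑' n, c n) ^ d) ^ k) (∑' n, c n) := by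
    rw [← Complex.hasSum_ofReal]
    push_cast
    exact_mod_cast h3
  rw [h2, hq.eq_one_of_hasSum (tsum_nonneg h.nonneg) h4, Complex.ofReal_one]

theorem ne_zero (h : IsSolution d q c Q) (hq : IsCritical d q V r) {z : ℂ} (hz : ‖z‖ ≤ 1) :
    Q z ≠ 0 := by
  intro h0
  have h1 := h.eq z hz
  rw [h0, zero_pow hq.d_pos.ne', mul_zero] at h1
  have h2 := hasSum_single (f := fun k => (q k : ℂ) * 0 ^ k) 0 fun k hk => by simp [hk]
  have h3 := h1.unique h2
  simp only [pow_zero, mul_one] at h3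
  exact hq.zero_pos.ne (by exact_mod_cast h3)

theorem hasDerivAt_pgf_pow (hq : IsCritical d q V r) {v : ℂ} (hv : v ∈ Metric.ball (0 : ℂ) r) :
    HasDerivAt (fun v => pgf q v ^ d) (d * pgf q v ^ (d - 1) * deriv (pgf q) v) v :=
  (hq.analyticAt_pgf hv).differentiableAt.hasDerivAt.pow d

/-- The second derivative is `d (d - 1) pgf' ^ 2 + d pgf''` at `1`; inserting `d pgf' = 1` and `d ^
2 pgf'' = V - (d - 1)` leaves `V / d`. -/
theorem deriv_deriv_pgf_pow_one (hq : IsCritical d q V r) :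
    deriv (deriv fun v => pgf q v ^ d) 1 = ((V / d : ℝ) : ℂ) := by
  have h1mem := hq.mem_ball (v := 1) (by simp)
  have h1 : deriv (fun v => pgf q v ^ d) =ᶠ[𝓝 1]
      fun v => d * pgf q v ^ (d - 1) * deriv (pgf q) v := by
    filter_upwards [Metric.isOpen_ball.mem_nhds h1mem] with v hv
    exact (hasDerivAt_pgf_pow hq hv).deriv
  have han := hq.analyticAt_pgf h1mem
  have h2 := ((han.differentiableAt.hasDerivAt.pow (d - 1)).const_mul (d : ℂ)).mul
    han.deriv.differentiableAt.hasDerivAt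
  rw [h1.deriv_eq]
  refine h2.deriv.trans ?_
  have hd : (d : ℂ) ≠ 0 := Nat.cast_ne_zero.2 hq.d_pos.ne'
  have h3 := hq.deriv_pgf_one
  have h4 := hq.deriv_deriv_pgf_one
  have h5 : ((d - 1 : ℕ) : ℂ) = d - 1 := by
    rw [Nat.cast_sub hq.d_pos, Nat.cast_one]
  simp only [Pi.pow_apply, hq.pgf_one, one_pow, mul_one, h5]
  push_cast
  rw [eq_div_iff hd, ← h4]
  linear_combination ((d : ℂ) - 1) * (d * deriv (pgf q) 1 + 1) * h3

theorem continuousOn_mul_pow (h : IsSolution d q c Q) :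
    ContinuousOn (fun z => z * Q z ^ d) (Metric.closedBall 0 1) :=
  continuousOn_id.mul (h.continuousOn.pow d)

/-- The continuation of a solution beyond the unit circle, and its expansion in `√(1 - z)`. -/
theorem exists_continuation (h : IsSolution d q c Q) (hq : IsCritical d q V r) :
    ∃ R : ℝ, 1 < R ∧ ∃ F T : ℂ → ℂ,
      (∀ z, 1 - z ∈ Complex.slitPlane → ‖z‖ < R → AnalyticAt ℂ F z) ∧
      (∀ z, ‖z‖ < 1 → F z = Q z) ∧ AnalyticAt ℂ T 0 ∧ T 0 = 1 ∧
      deriv T 0 = -((Real.sqrt (2 / (d * V)) : ℝ) : ℂ) ∧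
      ∀ᶠ z in 𝓝 (1 : ℂ), 1 - z ∈ Complex.slitPlane → F z = T (Complex.sqrt (1 - z)) := by
  set v : ℂ → ℂ := fun z => z * Q z ^ d with hvdef
  set Φ : ℂ → ℂ := fun u => pgf q u ^ d with hΦdef
  set Ω : Set ℂ := {z : ℂ | 1 - z ∈ Complex.slitPlane} with hΩdef
  have hd : (d : ℂ) ≠ 0 := Nat.cast_ne_zero.2 hq.d_pos.ne'
  have hvball : ∀ {z}, ‖z‖ ≤ 1 → v z ∈ Metric.ball (0 : ℂ) r := fun hz =>
    hq.mem_ball (h.norm_mul_pow_le hz)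
  have hpgf : ∀ {z}, ‖z‖ ≤ 1 → pgf q (v z) = Q z := fun hz => h.eq_pgf hz
  have hΦan : ∀ {z}, ‖z‖ ≤ 1 → AnalyticAt ℂ Φ (v z) := fun hz =>
    (hq.analyticAt_pgf (hvball hz)).pow d
  have hvΦ : ∀ z, ‖z‖ ≤ 1 → v z = z * Φ (v z) := fun z hz => by
    simp only [hΦdef]
    rw [hpgf hz]
  have hcont : ∀ {z}, ‖z‖ ≤ 1 → ContinuousWithinAt v (Metric.closedBall 0 1) z := fun hz =>
    h.continuousOn_mul_pow _ (mem_closedBall_zero_iff.2 hz)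
  have hv1 : v 1 = 1 := by simp only [hvdef]; rw [h.apply_one hq, one_pow, one_mul]
  have h1mem := hq.mem_ball (v := 1) (by simp)
  have hVd : 0 < V / d := div_pos hq.variance_pos (Nat.cast_pos.2 hq.d_pos)
  obtain ⟨χ, hχ, hχ0, hχ', hχv⟩ := exists_sqrt_expansion_of_critical (Φ := Φ) (v := v)
    (κ := V / d) ((hq.analyticAt_pgf h1mem).pow d) (by simp only [hΦdef]; rw [hq.pgf_one, one_pow])
    (by rw [(hasDerivAt_pgf_pow hq h1mem).deriv, hq.pgf_one, one_pow, mul_one, hq.deriv_pgf_one])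
    (deriv_deriv_pgf_pow_one hq) hVd hv1 (hcont (by simp)) (fun z hz => h.norm_mul_pow_le hz) hvΦ
  -- `Q = pgf (v)`, so the expansion of `v` carries over to `Q`, its slope being multiplied by
  -- `pgf'(1) = 1 / d`.
  set T : ℂ → ℂ := fun s => pgf q (χ s) with hT
  have hpgf1 : AnalyticAt ℂ (pgf q) (χ 0) := by rw [hχ0]; exact hq.analyticAt_pgf h1mem
  have hTan : AnalyticAt ℂ T 0 := hpgf1.comp hχ
  have hT' : deriv T 0 = -((Real.sqrt (2 / (d * V)) : ℝ) : ℂ) := by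
    have h1 : deriv T 0 = deriv (pgf q) (χ 0) * deriv χ 0 :=
      deriv_comp 0 hpgf1.differentiableAt hχ.differentiableAt
    have h2 : deriv (pgf q) 1 = ((d⁻¹ : ℝ) : ℂ) := by
      push_cast
      exact eq_inv_of_mul_eq_one_right hq.deriv_pgf_one
    have hd0 : (0 : ℝ) < d := Nat.cast_pos.2 hq.d_pos
    have h3 : Real.sqrt (2 / (d * V)) = (d : ℝ)⁻¹ * Real.sqrt (2 / (V / d)) := by
      rw [← Real.sqrt_sq (inv_nonneg.2 hd0.le), ← Real.sqrt_mul (sq_nonneg _)]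
      congr 1
      have := hq.variance_pos.ne'
      field_simp
    rw [h1, hχ0, h2, hχ', h3, mul_neg, Complex.ofReal_mul]
  have hlocal1 : ∃ ρ, IsLocalContinuation Ω Q 1 ρ fun z => T (Complex.sqrt (1 - z)) := by
    have h1 := tendsto_sqrt_one_sub.eventually hTan.eventually_analyticAt
    obtain ⟨ρ, hρ, hball⟩ := Metric.eventually_nhds_iff_ball.1 (h1.and hχv)
    refine ⟨ρ, by simp, hρ, fun z hz hzΩ => ?_, fun z hz hz1 => ?_⟩
    · exact (hball z hz).1.comp_of_eq (analyticAt_sqrt_one_sub hzΩ) rfl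
    · simp only [hT]
      rw [← (hball z hz).2 hz1.le, hpgf hz1.le]
  have hloc : ∀ a : ℂ, ‖a‖ = 1 → ∃ ρ E, IsLocalContinuation Ω Q a ρ E := by
    intro a ha
    rcases eq_or_ne a 1 with rfl | ha1
    · obtain ⟨ρ, hρ⟩ := hlocal1
      exact ⟨ρ, _, hρ⟩
    · have hQ0 := h.ne_zero hq ha.le
      obtain ⟨E, hE, hEa, hEv⟩ := exists_analyticAt_of_noncritical (Φ := Φ) (v := v) (c := a)
        (hΦan ha.le) (by simp only [hΦdef]; rw [hpgf ha.le]; exact pow_ne_zero d hQ0)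
        (by
          intro hcrit
          refine ha1 (hq.noncritical ha.le (h.norm_le_one ha.le) (hpgf ha.le) ?_)
          rw [(hasDerivAt_pgf_pow hq (hvball ha.le)).deriv] at hcrit
          simp only [hΦdef] at hcrit
          rw [hpgf ha.le] at hcrit
          -- After cancelling `Q a ^ (d - 1)`, criticality of `Φ = pgf ^ d` becomes the hypothesis
          -- of `noncritical`.
          have h2 : Q a ^ d = Q a ^ (d - 1) * Q a := by
            rw [← pow_succ, Nat.sub_add_cancel hq.d_pos]
          have h3 : Q a ^ (d - 1) ≠ 0 := pow_ne_zero _ hQ0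
          refine mul_left_cancel₀ h3 ?_
          refine (h2.symm.trans hcrit).trans ?_
          simp only [hvdef]
          ring) ha.le (hcont ha.le) hvΦ
      have h1 : AnalyticAt ℂ (fun z => pgf q (E z)) a :=
        (hq.analyticAt_pgf (hvball ha.le)).comp_of_eq hE hEa
      obtain ⟨ρ, hρ, hball⟩ := Metric.eventually_nhds_iff_ball.1 (h1.eventually_analyticAt.and hEv)
      refine ⟨ρ, fun z => pgf q (E z), ha, hρ, fun z hz _ => (hball z hz).1, fun z hz hz1 => ?_⟩
      show pgf q (E z) = Q z
      rw [(hball z hz).2 hz1.le, hpgf hz1.le]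
  obtain ⟨R, hR, F, hFan, hFQ, hFE⟩ := CrossingFree.exists_continuation isOpen_one_sub_slitPlane
    starConvex_one_sub_slitPlane (fun z hz => h.analyticAt hz) hloc
  refine ⟨R, hR, F, T, fun z hz hzR => hFan z hz hzR, hFQ, hTan, ?_, hT', ?_⟩
  · simp only [hT]
    rw [hχ0, hq.pgf_one]
  · obtain ⟨ρ, hρ⟩ := hlocal1
    have hn : ∀ᶠ z in 𝓝 (1 : ℂ), ‖z‖ < R :=
      continuous_norm.continuousAt.eventually (gt_mem_nhds (by simpa using hR))
    filter_upwards [Metric.ball_mem_nhds (1 : ℂ) hρ.pos, hn] with z hz hzR hzΩ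
    exact hFE _ _ _ hρ z hz hzΩ hzR

end IsSolution


/-! ### The critical law and the normalized solution attached to `S` -/

/-- The offspring weights attached to `S`. -/
noncomputable def weight (S : Set ℕ) (k : ℕ) : ℝ :=
  (alpha S)⁻¹ * ((if k = 0 then 1 else 0) + S.indicator (fun s => tau S ^ s) (Nat.setGcd S * k))

/-- The normalized coefficients of the generating function along the multiples of `gcd S`. -/
noncomputable def normCount (S : Set ℕ) (n : ℕ) : ℝ :=
  (alpha S)⁻¹ * ((count S (Nat.setGcd S * n) : ℝ) * rho S ^ (Nat.setGcd S * n))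

namespace IsAdmissible

variable {S : Set ℕ}

theorem setGcd_pos (h : IsAdmissible S) : 0 < Nat.setGcd S := by
  obtain ⟨s, hs, h2⟩ := exists_two_le_mem h.nonempty h.zero_notMem h.ne_singleton_one
  refine Nat.pos_of_ne_zero fun h0 => ?_
  have := Nat.setGcd_dvd_of_mem hs
  rw [h0, zero_dvd_iff] at this
  omega

/-- Every element of `S` is a multiple of `gcd S`, so sums over `S` reindex over `k`. Different
choices of `g` yield the mass, mean, variance, radius and functional equation. -/
theorem hasSum_weight_smul (h : IsAdmissible S) {E : Type*} [NormedAddCommGroup E]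
    [NormedSpace ℝ E] {g : ℕ → E} {a : E} (hg : HasSum (fun s : S => tau S ^ (s : ℕ) • g s) a) :
    HasSum (fun k => weight S k • g (Nat.setGcd S * k)) ((alpha S)⁻¹ • (g 0 + a)) := by
  have hinj : Function.Injective (Nat.setGcd S * ·) := mul_right_injective₀ h.setGcd_pos.ne'
  have h1 := (hasSum_subtype_iff_indicator (f := fun n : ℕ => tau S ^ n • g n)).1 hg
  have h2 := (hinj.hasSum_iff (fun n hn => by
    refine Set.indicator_of_notMem (fun hnS => hn ?_) _
    obtain ⟨k, hk⟩ := Nat.setGcd_dvd_of_mem hnS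
    exact ⟨k, hk.symm⟩)).2 h1
  refine (((hasSum_ite_eq 0 (g 0)).add h2).const_smul (alpha S)⁻¹).congr_fun fun k => ?_
  rw [weight, mul_smul, add_smul]
  congr 2
  · split_ifs with hk
    · rw [hk, mul_zero, one_smul]
    · rw [zero_smul]
  · rw [Function.comp_apply]
    by_cases hk : Nat.setGcd S * k ∈ S
    · rw [Set.indicator_of_mem hk, Set.indicator_of_mem hk]
    · rw [Set.indicator_of_notMem hk, Set.indicator_of_notMem hk, zero_smul]

theorem isCritical (h : IsAdmissible S) : ∃ r, IsCritical (Nat.setGcd S) (weight S)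
    ((alpha S)⁻¹ * ∑' s : S, ((s : ℕ) : ℝ) * (((s : ℕ) : ℝ) - 1) * tau S ^ (s : ℕ)) r := by
  obtain ⟨r, hr, hsum⟩ := exists_tau_lt_summable h.nonempty h.zero_notMem h.ne_singleton_one
  have hα := h.alpha_pos
  have hτ := h.tau_pos
  -- The power `d` appears because `k` stands for `dk` children: `τ ^ (dk)` times the `k`-th power
  -- of this radius is `r ^ (dk)`.
  refine ⟨(r / tau S) ^ Nat.setGcd S, ?_⟩
  constructor
  · exact h.setGcd_pos
  · intro k
    refine mul_nonneg (inv_nonneg.2 hα.le) (add_nonneg (by split_ifs <;> norm_num) ?_)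
    exact Set.indicator_nonneg (fun s _ => pow_nonneg hτ.le s) _
  · rw [weight, mul_zero, if_pos rfl, Set.indicator_of_notMem h.zero_notMem, add_zero, mul_one]
    exact inv_pos.2 hα
  · have := h.hasSum_weight_smul (g := fun _ => (1 : ℝ)) (a := alpha S - 1)
      (h.hasSum_tau_pow.congr_fun fun s => by simp)
    simpa [hα.ne'] using this
  · have := h.hasSum_weight_smul (g := fun n : ℕ => (n : ℝ)) (a := alpha S)
      (h.hasSum_mul_tau_pow.congr_fun fun s => by simp [mul_comm])
    simpa [hα.ne', mul_comm] using this
  · have := h.hasSum_weight_smul (g := fun n : ℕ => (n : ℝ) * ((n : ℝ) - 1)) (a := _)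
      (h.summable_mul_sub_one_mul_tau_pow.hasSum.congr_fun fun s => by
        rw [smul_eq_mul, mul_comm])
    simp only [Nat.cast_zero, zero_mul, zero_add, smul_eq_mul] at this
    refine this.congr_fun fun k => ?_
    push_cast
    ring
  · exact mul_pos (inv_pos.2 hα) h.variance_pos
  · exact one_lt_pow₀ ((one_lt_div hτ).2 hr) h.setGcd_pos.ne'
  · have := h.hasSum_weight_smul (g := fun n : ℕ => (r / tau S) ^ n) (a := _)
      (hsum.hasSum.congr_fun fun s => by
        rw [smul_eq_mul, ← mul_pow, mul_div_cancel₀ _ hτ.ne'])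
    refine this.summable.congr fun k => ?_
    rw [smul_eq_mul, pow_mul]
  · intro v hv
    rw [← orderOf_eq_one_iff]
    -- If `v ^ k = 1` on the support, then `d * orderOf v` divides all of `S`, hence divides `d`, so
    -- `v` has order `1`.
    have h1 : Nat.setGcd S * orderOf v ∣ Nat.setGcd S * 1 := by
      rw [mul_one, Nat.dvd_setGcd_iff]
      intro s hs
      obtain ⟨k, hk⟩ := Nat.setGcd_dvd_of_mem hs
      rw [hk]
      refine Nat.mul_dvd_mul_left _ (orderOf_dvd_of_pow_eq_one (hv k ?_))
      rw [weight, ← hk, Set.indicator_of_mem hs]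
      have h2 : (0 : ℝ) ≤ if k = 0 then 1 else 0 := by split_ifs <;> norm_num
      have h3 := pow_pos hτ s
      exact (mul_pos (inv_pos.2 hα) (by linarith)).ne'
    exact Nat.dvd_one.1 (Nat.dvd_of_mul_dvd_mul_left h.setGcd_pos h1)

theorem hasSum_count (h : IsAdmissible S) {x : ℂ} (hx : ‖x‖ ≤ rho S) :
    HasSum (fun n => (count S n : ℂ) * x ^ n) (∑' n, (count S n : ℂ) * x ^ n) := by
  refine (Summable.of_norm_bounded h.summable_count fun n => ?_).hasSum
  rw [norm_mul, norm_pow, Complex.norm_natCast]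
  exact mul_le_mul_of_nonneg_left (pow_le_pow_left₀ (norm_nonneg x) hx n) (Nat.cast_nonneg _)

theorem hasSum_comp_setGcd_mul (h : IsAdmissible S) {E : Type*} [NormedAddCommGroup E]
    {g : ℕ → E} {a : E} (hg : ∀ n, count S n = 0 → g n = 0) :
    HasSum (fun n => g (Nat.setGcd S * n)) a ↔ HasSum g a := by
  have hinj : Function.Injective (Nat.setGcd S * ·) := mul_right_injective₀ h.setGcd_pos.ne'
  refine hinj.hasSum_iff fun n hn => hg n (count_eq_zero fun hdvd => hn ?_)
  obtain ⟨k, hk⟩ := hdvd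
  exact ⟨k, hk.symm⟩

theorem norm_rho_mul_le (h : IsAdmissible S) {w : ℂ} (hw : ‖w‖ ≤ 1) :
    ‖(rho S : ℂ) * w‖ ≤ rho S := by
  rw [norm_mul, Complex.norm_real, Real.norm_of_nonneg h.rho_pos.le]
  exact mul_le_of_le_one_right h.rho_pos.le hw

theorem hasSum_normCount (h : IsAdmissible S) {w : ℂ} (hw : ‖w‖ ≤ 1) :
    HasSum (fun n => (normCount S n : ℂ) * (w ^ Nat.setGcd S) ^ n)
      ((alpha S : ℂ)⁻¹ * ∑' n, (count S n : ℂ) * ((rho S : ℂ) * w) ^ n) := by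
  have h1 := (h.hasSum_comp_setGcd_mul (g := fun n => (count S n : ℂ) * ((rho S : ℂ) * w) ^ n)
    (fun n hn => by simp [hn])).2 (h.hasSum_count (h.norm_rho_mul_le hw))
  refine (h1.mul_left (alpha S : ℂ)⁻¹).congr_fun fun n => ?_
  rw [normCount, mul_pow, ← pow_mul]
  push_cast
  ring

theorem tsum_count_eq (h : IsAdmissible S) {w : ℂ} (hw : ‖w‖ ≤ 1) :
    ∑' n, (count S n : ℂ) * ((rho S : ℂ) * w) ^ n =
      alpha S * ∑' n, (normCount S n : ℂ) * (w ^ Nat.setGcd S) ^ n := by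
  have hα : (alpha S : ℂ) ≠ 0 := Complex.ofReal_ne_zero.2 h.alpha_pos.ne'
  rw [(h.hasSum_normCount hw).tsum_eq, mul_inv_cancel_left₀ hα]

/-- Every `z` in the closed disc is `w ^ d` with `‖w‖ ≤ 1`, and `P(ρ w) = α Q(w ^ d)`. As `ρ α = τ`,
the functional equation at `ρ w` becomes `α Q = 1 + ∑ τ ^ s (w Q) ^ s`, where `(w Q) ^ (dk) = (z Q ^
d) ^ k`. -/
theorem isSolution (h : IsAdmissible S) : IsSolution (Nat.setGcd S) (weight S) (normCount S)
    (fun z => ∑' n, (normCount S n : ℂ) * z ^ n) := by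
  have hα := h.alpha_pos
  have hsum : HasSum (normCount S) ((alpha S)⁻¹ * ∑' n, (count S n : ℝ) * rho S ^ n) :=
    ((h.hasSum_comp_setGcd_mul (g := fun n => (count S n : ℝ) * rho S ^ n)
      (fun n hn => by simp [hn])).2 h.summable_count.hasSum).mul_left (alpha S)⁻¹
  have hroot : ∀ z : ℂ, ‖z‖ ≤ 1 → ∃ w : ℂ, w ^ Nat.setGcd S = z ∧ ‖w‖ ≤ 1 := fun z hz => by
    obtain ⟨w, hw⟩ := IsAlgClosed.exists_pow_nat_eq z h.setGcd_pos
    refine ⟨w, hw, ?_⟩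
    rw [← hw, norm_pow] at hz
    exact (pow_le_one_iff_of_nonneg (norm_nonneg w) h.setGcd_pos.ne').1 hz
  constructor
  · intro n
    exact mul_nonneg (inv_nonneg.2 hα.le)
      (mul_nonneg (Nat.cast_nonneg _) (pow_nonneg h.rho_pos.le _))
  · exact hsum.summable
  · rw [hsum.tsum_eq, inv_mul_le_iff₀ hα, mul_one]
    exact h.tsum_count_le
  · intro z hz
    obtain ⟨w, rfl, hw⟩ := hroot z hz
    exact (h.hasSum_normCount hw).summable.hasSum
  · intro z hz
    obtain ⟨w, rfl, hw⟩ := hroot z hz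
    have h1 := h.hasSum_mul_pow (h.norm_rho_mul_le hw)
    rw [h.tsum_count_eq hw] at h1
    set Q := ∑' n, (normCount S n : ℂ) * (w ^ Nat.setGcd S) ^ n with hQ
    have h2 := h.hasSum_weight_smul (g := fun n => (w * Q) ^ n) (a := alpha S * Q - 1)
      (h1.congr_fun fun s => by
        rw [Complex.real_smul, Complex.ofReal_pow, ← mul_pow, ← h.rho_mul_alpha]
        push_cast
        ring)
    have hα' : (alpha S : ℂ) ≠ 0 := Complex.ofReal_ne_zero.2 hα.ne'
    rw [pow_zero, add_sub_cancel, Complex.real_smul, Complex.ofReal_inv,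
      inv_mul_cancel_left₀ hα'] at h2
    refine h2.congr_fun fun k => ?_
    rw [Complex.real_smul, pow_mul, mul_pow w Q]

end IsAdmissible


/-! ### Return to the variable `x` and conclusion -/

/-- As `cos (π / 3) = 1 / 2`, one has `Re (1 - w) ≥ -‖1 - w‖ / 2`; combine with `2 (Re s) ^ 2 = ‖s‖
^ 2 + Re (s ^ 2)` for `s = √(1 - w)`. This keeps `√d s + √(1 - w ^ d)` away from zero below. -/
theorem half_norm_sqrt_le_re {w : ℂ} (hw : Real.pi / 3 < |Complex.arg (w - 1)|) :
    ‖Complex.sqrt (1 - w)‖ / 2 ≤ (Complex.sqrt (1 - w)).re := by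
  have h1 : (w - 1).re ≤ ‖w - 1‖ / 2 := by
    rw [← Complex.norm_mul_cos_arg, ← Real.cos_abs]
    have := Real.cos_le_cos_of_nonneg_of_le_pi (by positivity) (Complex.abs_arg_le_pi (w - 1)) hw.le
    rw [Real.cos_pi_div_three] at this
    have h2 := mul_le_mul_of_nonneg_left this (norm_nonneg (w - 1))
    linarith
  have h2 := re_sq_sub_im_sq_sqrt (1 - w)
  have h3 := norm_sqrt_sq (1 - w)
  have h4 := Complex.sq_norm (Complex.sqrt (1 - w))
  rw [Complex.normSq_apply] at h4
  rw [← neg_sub w 1, norm_neg, Complex.neg_re, neg_sub w 1] at *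
  refine le_of_sq_le_sq ?_ (re_sqrt_nonneg _)
  nlinarith

/-- `√(1 - w ^ d)` and `√d √(1 - w)` agree up to `O(1 - w)` in a dented neighbourhood of `1`. -/
theorem isBigO_sqrt_one_sub_pow {d : ℕ} (hd : 0 < d) :
    (fun w : ℂ => (Real.sqrt d : ℂ) * Complex.sqrt (1 - w) - Complex.sqrt (1 - w ^ d))
      =O[𝓝[{w : ℂ | Real.pi / 3 < |Complex.arg (w - 1)|}] 1] fun w => 1 - w := by
  have hd1 : (1 : ℝ) ≤ Real.sqrt d := by
    rw [Real.one_le_sqrt]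
    exact_mod_cast hd
  have hgeom : (fun w : ℂ => ∑ i ∈ Finset.range d, w ^ i - d) =O[𝓝 1] fun w => w - 1 := by
    have : DifferentiableAt ℂ (fun w : ℂ => ∑ i ∈ Finset.range d, w ^ i) 1 := by fun_prop
    simpa using this.isBigO_sub
  obtain ⟨K, hK⟩ := hgeom.bound
  refine IsBigO.of_bound (2 * |K|) ?_
  have hsmall : ∀ᶠ w in 𝓝 (1 : ℂ), ‖Complex.sqrt (1 - w)‖ < 1 := by
    have := tendsto_sqrt_one_sub.norm
    rw [norm_zero] at this
    exact this.eventually (gt_mem_nhds one_pos)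
  filter_upwards [mem_nhdsWithin_of_mem_nhds hK, mem_nhdsWithin_of_mem_nhds hsmall,
    self_mem_nhdsWithin] with w hw hs1 hwarg
  have hre := half_norm_sqrt_le_re hwarg
  have hs := sqrt_sq (1 - w)
  have hσ := sqrt_sq (1 - w ^ d)
  have hn := norm_sqrt_sq (1 - w)
  have hσre := re_sqrt_nonneg (1 - w ^ d)
  set s := Complex.sqrt (1 - w)
  set σ := Complex.sqrt (1 - w ^ d)
  -- The product of sum and difference is `d (1 - w) - (1 - w ^ d)`, of order `(1 - w) ^ 2`;
  -- dividing by the sum, of modulus at least `‖s‖ / 2`, gives more than the required bound.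
  have hprod : ((Real.sqrt d : ℂ) * s - σ) * ((Real.sqrt d : ℂ) * s + σ) =
      -((1 - w) * (∑ i ∈ Finset.range d, w ^ i - d)) := by
    have h1 : (Real.sqrt d : ℂ) ^ 2 = d := by
      rw [← Complex.ofReal_pow, Real.sq_sqrt (Nat.cast_nonneg d), Complex.ofReal_natCast]
    have h2 := mul_neg_geom_sum w d
    linear_combination (s ^ 2) * h1 + (d : ℂ) * hs - hσ + h2
  have hlow : ‖s‖ / 2 ≤ ‖(Real.sqrt d : ℂ) * s + σ‖ := by
    refine le_trans ?_ (Complex.re_le_norm _)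
    rw [Complex.add_re, Complex.re_ofReal_mul]
    have : 0 ≤ s.re := le_trans (by positivity) hre
    nlinarith
  have hup : ‖(Real.sqrt d : ℂ) * s - σ‖ * ‖(Real.sqrt d : ℂ) * s + σ‖ ≤ |K| * ‖s‖ ^ 4 := by
    rw [← norm_mul, hprod, norm_neg, norm_mul]
    have h1 : ‖∑ i ∈ Finset.range d, w ^ i - (d : ℂ)‖ ≤ |K| * ‖1 - w‖ := by
      rw [norm_sub_rev 1 w]
      exact hw.trans (mul_le_mul_of_nonneg_right (le_abs_self K) (norm_nonneg _))
    calc ‖1 - w‖ * ‖∑ i ∈ Finset.range d, w ^ i - (d : ℂ)‖ ≤ ‖1 - w‖ * (|K| * ‖1 - w‖) :=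
          mul_le_mul_of_nonneg_left h1 (norm_nonneg _)
      _ = |K| * ‖s‖ ^ 4 := by rw [← hn]; ring
  rcases eq_or_ne s 0 with h0 | h0
  · have hw1 : w = 1 := by
      rw [h0, zero_pow two_ne_zero] at hs
      exact (sub_eq_zero.1 hs.symm).symm
    simp only [hw1, sub_self, Complex.arg_zero, abs_zero] at hwarg
    exact absurd hwarg (by have := Real.pi_pos; linarith)
  · have hspos : 0 < ‖s‖ := norm_pos_iff.2 h0
    rw [← hn]
    have h1 : ‖(Real.sqrt d : ℂ) * s - σ‖ * (‖s‖ / 2) ≤ |K| * ‖s‖ ^ 4 :=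
      (mul_le_mul_of_nonneg_left hlow (norm_nonneg _)).trans hup
    have h2 : |K| * ‖s‖ ^ 4 ≤ |K| * ‖s‖ ^ 3 := by
      refine mul_le_mul_of_nonneg_left ?_ (abs_nonneg K)
      exact pow_le_pow_of_le_one hspos.le hs1.le (by norm_num)
    refine le_of_mul_le_mul_right ?_ (half_pos hspos)
    calc ‖(Real.sqrt d : ℂ) * s - σ‖ * (‖s‖ / 2) ≤ |K| * ‖s‖ ^ 3 := h1.trans h2
      _ = 2 * |K| * ‖s‖ ^ 2 * (‖s‖ / 2) := by ring

/-- Otherwise `(x / ρ) ^ d` is a real number at least `1`, so `x / ρ = ‖x / ρ‖ ξ` with `ξ ^ d = 1`.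
Rotating by `ξ` gives a real point at least `1`, where `arg (z - 1) = 0`, which the dent at `ρ ξ`
excludes. -/
theorem one_sub_pow_mem_slitPlane {d : ℕ} (hd : 0 < d) {ρ φ R : ℝ} (hφ : 0 < φ)
    {x : ℂ} (hx : x ∈ indentedDisc d ρ φ R) : 1 - (x / ρ) ^ d ∈ Complex.slitPlane := by
  set w := x / (ρ : ℂ) with hw
  rw [Complex.mem_slitPlane_iff]
  by_contra! hcon
  obtain ⟨hre, him⟩ := hcon
  simp only [Complex.sub_re, Complex.one_re, Complex.sub_im, Complex.one_im, zero_sub,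
    neg_eq_zero] at hre him
  have hreal : w ^ d = ((w ^ d).re : ℂ) := Complex.ext rfl (by simp [him])
  have hnorm : ‖w‖ ^ d = (w ^ d).re := by
    rw [← norm_pow]
    conv_lhs => rw [hreal]
    rw [Complex.norm_real, Real.norm_of_nonneg (by linarith)]
  have hw1 : 1 ≤ ‖w‖ := by
    by_contra! hlt
    have := pow_lt_one₀ (norm_nonneg w) hlt hd.ne'
    linarith
  have hwpos : (‖w‖ : ℂ) ≠ 0 := Complex.ofReal_ne_zero.2 (by linarith)
  have hξ : (w / ‖w‖) ^ d = 1 := by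
    rw [div_pow, hreal, ← hnorm, Complex.ofReal_pow, div_self (pow_ne_zero d hwpos)]
  have hw0 : w ≠ 0 := by
    rintro h
    rw [h, norm_zero] at hw1
    linarith
  have h1 := (hx _ hξ).2.2
  have h2 : x / ((ρ : ℂ) * (w / ‖w‖)) = (‖w‖ : ℂ) := by
    rw [← div_div, ← hw]
    field_simp
  rw [h2, ← Complex.ofReal_one, ← Complex.ofReal_sub, Complex.arg_ofReal_of_nonneg (by linarith),
    abs_zero] at h1
  exact lt_asymm hφ h1

namespace IsAdmissible

variable {S : Set ℕ}

/-- The three factors are the normalization `α`, the slope of `Q` in `√(1 - z)`, and the `√d`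
produced by `z = w ^ d`. -/
theorem alpha_mul_sqrt (h : IsAdmissible S) :
    alpha S * Real.sqrt (2 / (Nat.setGcd S * ((alpha S)⁻¹ *
      ∑' s : S, ((s : ℕ) : ℝ) * (((s : ℕ) : ℝ) - 1) * tau S ^ (s : ℕ)))) * Real.sqrt (Nat.setGcd S)
      = beta S := by
  have hα := h.alpha_pos
  have hd : (0 : ℝ) < Nat.setGcd S := Nat.cast_pos.2 h.setGcd_pos
  have hV := h.variance_pos
  rw [h.beta_eq, mul_assoc, ← Real.sqrt_mul (by positivity)]
  nth_rewrite 1 [← Real.sqrt_sq hα.le]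
  rw [← Real.sqrt_mul (sq_nonneg _)]
  congr 1
  field_simp

end IsAdmissible


theorem mem_dentedDomain_of_mem_indentedDisc {d : ℕ} {ρ φ R : ℝ} {x : ℂ}
    (hx : x ∈ indentedDisc d ρ φ R) : x / ρ ∈ dentedDomain φ R := by
  simpa using hx 1 (one_pow d)

/-- If `G` is an analytic function of `√(1 - z)` near `z = 1`, then `z = w ^ d` gives an expansion
of `G (w ^ d)` in terms of `√(1 - w)`. -/
theorem isBigO_comp_pow_sub {d : ℕ} (hd : 0 < d) {G T : ℂ → ℂ} (hT : AnalyticAt ℂ T 0)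
    (hG : ∀ᶠ z in 𝓝 1, 1 - z ∈ Complex.slitPlane → G z = T (Complex.sqrt (1 - z)))
    {A : Set ℂ} (hA : ∀ w ∈ A, 1 - w ^ d ∈ Complex.slitPlane)
    (hA' : ∀ w ∈ A, Real.pi / 3 < |Complex.arg (w - 1)|) :
    (fun w => G (w ^ d) - (T 0 + deriv T 0 * (Real.sqrt d : ℂ) * Complex.sqrt (1 - w)))
      =O[𝓝[A] 1] fun w => 1 - w := by
  -- Expand `T` to second order at `σ = √(1 - w ^ d)`: the remainder carries `σ ^ 2 = 1 - w ^ d =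
  -- O(1 - w)`, and the linear term is handled by `isBigO_sqrt_one_sub_pow`.
  obtain ⟨f, hf, hf0, hTf⟩ := exists_eq_add_mul hT
  obtain ⟨g, hg, -, hfg⟩ := exists_eq_add_mul hf
  have hpow : Tendsto (fun w : ℂ => w ^ d) (𝓝 1) (𝓝 1) := by
    simpa using (continuous_pow d).tendsto (1 : ℂ)
  have hσ := tendsto_sqrt_one_sub.comp hpow
  have hbdd : (fun w : ℂ => g (Complex.sqrt (1 - w ^ d))) =O[𝓝 1] fun _ => (1 : ℂ) :=
    (hg.continuousAt.tendsto.comp hσ).isBigO_one ℂ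
  have hlin : (fun w : ℂ => 1 - w ^ d) =O[𝓝 1] fun w => 1 - w := by
    have : DifferentiableAt ℂ (fun w : ℂ => w ^ d) 1 := by fun_prop
    refine (this.isBigO_sub.neg_left.neg_right).congr (fun w => ?_) fun w => ?_ <;> simp
  have h1 : (fun w : ℂ => (1 - w ^ d) * g (Complex.sqrt (1 - w ^ d))) =O[𝓝[A] 1]
      fun w => 1 - w := by
    simpa using (hlin.mul hbdd).mono nhdsWithin_le_nhds
  have h2 := ((isBigO_sqrt_one_sub_pow hd).mono (nhdsWithin_mono 1 hA')).const_mul_left (deriv T 0)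
  refine (h1.sub h2).congr' ?_ EventuallyEq.rfl
  filter_upwards [self_mem_nhdsWithin, mem_nhdsWithin_of_mem_nhds (hpow.eventually hG)] with w hw hGw
  have hs := sqrt_sq (1 - w ^ d)
  rw [hGw (hA w hw), hTf, hfg, hf0]
  linear_combination (-g (Complex.sqrt (1 - w ^ d))) * hs

namespace IsAdmissible

variable {S : Set ℕ}

theorem exists_expansion (h : IsAdmissible S) : ∃ φ R : ℝ, 0 < φ ∧ φ < Real.pi / 2 ∧ 1 < R ∧
    ∃ F : ℂ → ℂ, AnalyticOnNhd ℂ F (indentedDisc (Nat.setGcd S) (rho S) φ R) ∧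
      (∀ x : ℂ, ‖x‖ < rho S → HasSum (fun n => (count S n : ℂ) * x ^ n) (F x)) ∧
      (fun x : ℂ => F x - ((alpha S : ℂ) - (beta S : ℂ) * Complex.sqrt (1 - x / (rho S : ℂ))))
        =O[𝓝[indentedDisc (Nat.setGcd S) (rho S) φ R] (rho S : ℂ)]
          (fun x : ℂ => 1 - x / (rho S : ℂ)) := by
  obtain ⟨r, hr⟩ := h.isCritical
  obtain ⟨R, hR, F, T, hF, hFQ, hT, hT0, hT1, hFT⟩ := h.isSolution.exists_continuation hr
  have hd := h.setGcd_pos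
  have hρ := h.rho_pos
  have hρ0 : (rho S : ℂ) ≠ 0 := Complex.ofReal_ne_zero.2 hρ.ne'
  have hπ := Real.pi_pos
  have hφ : 0 < Real.pi / 3 := by positivity
  have hRd : (R ^ ((Nat.setGcd S : ℝ)⁻¹)) ^ Nat.setGcd S = R :=
    Real.rpow_inv_natCast_pow (by linarith) hd.ne'
  -- The radius is `R ^ (1 / d)`, so that `(x / ρ) ^ d` stays in the disc of radius `R` where `F` is
  -- analytic.
  refine ⟨Real.pi / 3, R ^ ((Nat.setGcd S : ℝ)⁻¹), hφ, by linarith,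
    Real.one_lt_rpow hR (by positivity), fun x => alpha S * F ((x / rho S) ^ Nat.setGcd S),
    fun x hx => ?_, fun x hx => ?_, ?_⟩
  · refine analyticAt_const.mul (AnalyticAt.comp (f := fun x : ℂ => (x / rho S) ^ Nat.setGcd S)
      (hF _ (one_sub_pow_mem_slitPlane hd hφ hx) ?_) (by fun_prop))
    rw [norm_pow, ← hRd]
    exact pow_lt_pow_left₀ (mem_dentedDomain_of_mem_indentedDisc hx).2.1 (norm_nonneg _) hd.ne'
  · have hw : ‖x / rho S‖ < 1 := by
      rw [norm_div, Complex.norm_real, Real.norm_of_nonneg hρ.le]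
      exact (div_lt_one hρ).2 hx
    have hsum := h.hasSum_count hx.le
    have heq := h.tsum_count_eq hw.le
    rw [mul_div_cancel₀ x hρ0] at heq
    rw [heq] at hsum
    rwa [← hFQ _ (by rw [norm_pow]; exact pow_lt_one₀ (norm_nonneg _) hw hd.ne')] at hsum
  · set D := indentedDisc (Nat.setGcd S) (rho S) (Real.pi / 3) (R ^ ((Nat.setGcd S : ℝ)⁻¹))
    have hexp := isBigO_comp_pow_sub hd hT hFT (A := (fun x : ℂ => x / rho S) '' D)
      (by rintro _ ⟨x, hx, rfl⟩; exact one_sub_pow_mem_slitPlane hd hφ hx)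
      (by rintro _ ⟨x, hx, rfl⟩; exact (mem_dentedDomain_of_mem_indentedDisc hx).2.2)
    have hlim : Tendsto (fun x : ℂ => x / rho S) (𝓝[D] (rho S : ℂ))
        (𝓝[(fun x : ℂ => x / rho S) '' D] 1) := by
      have hc : ContinuousAt (fun x : ℂ => x / rho S) (rho S : ℂ) := by fun_prop
      have := hc.continuousWithinAt.tendsto_nhdsWithin_image (s := D)
      simpa only [div_self hρ0] using this
    refine ((hexp.comp_tendsto hlim).const_mul_left (alpha S : ℂ)).congr_left fun x => ?_
    have hβ := congrArg (Complex.ofReal) h.alpha_mul_sqrt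
    push_cast at hβ
    simp only [Function.comp_apply, hT0, hT1]
    rw [← hβ]
    ring

theorem tendsto_normCount (h : IsAdmissible S) :
    Tendsto (fun m => normCount S m * (m : ℝ) ^ (3 / 2 : ℝ)) atTop
      (𝓝 (beta S / (alpha S * Real.sqrt (Nat.setGcd S)) * (1 / (2 * Real.sqrt Real.pi)))) := by
  obtain ⟨r, hr⟩ := h.isCritical
  obtain ⟨R, hR, F, T, hF, hFQ, hT, hT0, hT1, hFT⟩ := h.isSolution.exists_continuation hr
  have hlim := tendsto_coeff_of_sqrt_singularity (c := fun m => (normCount S m : ℂ))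
    (fun z hz hz1 => hF z (one_sub_mem_slitPlane hz hz1) (by linarith))
    (fun z hz => by
      rw [hFQ z hz]
      exact h.isSolution.hasSum z hz.le)
    hT (by
      filter_upwards [hFT] with z hz hz1
      refine hz (one_sub_mem_slitPlane hz1.le ?_)
      rintro rfl
      simp at hz1)
  rw [hT1] at hlim
  have hα := h.alpha_pos.ne'
  have hd : Real.sqrt (Nat.setGcd S) ≠ 0 :=
    (Real.sqrt_pos.2 (Nat.cast_pos.2 h.setGcd_pos)).ne'
  have hre := (Complex.continuous_re.tendsto _).comp hlim
  rw [← h.alpha_mul_sqrt]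
  convert hre using 2
  · simp only [Function.comp_apply, ← Complex.ofReal_mul, Complex.ofReal_re]
  · rw [← Complex.ofReal_neg, ← Complex.ofReal_mul, Complex.ofReal_re]
    field_simp

theorem isEquivalent_count (h : IsAdmissible S) :
    (fun n : ℕ => (count S n : ℝ)) ~[atTop ⊓ 𝓟 {n : ℕ | Nat.setGcd S ∣ n}]
      (fun n : ℕ => (Nat.setGcd S : ℝ) * beta S / (2 * Real.sqrt Real.pi) *
        (n : ℝ) ^ (-(3 / 2) : ℝ) * rho S ^ (-(n : ℤ))) := by
  have hd := h.setGcd_pos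
  have hd' : (0 : ℝ) < Nat.setGcd S := Nat.cast_pos.2 hd
  have hρ := h.rho_pos
  have hα := h.alpha_pos
  have hβ := h.beta_pos
  set L := beta S / (alpha S * Real.sqrt (Nat.setGcd S)) * (1 / (2 * Real.sqrt Real.pi)) with hL
  have hLpos : 0 < L := by positivity
  have hlim := (h.tendsto_normCount.comp (Nat.tendsto_div_const_atTop hd.ne')).mono_left
    (inf_le_left (b := 𝓟 {n : ℕ | Nat.setGcd S ∣ n}))
  have hpos : ∀ᶠ n : ℕ in atTop ⊓ 𝓟 {n : ℕ | Nat.setGcd S ∣ n}, 0 < n ∧ Nat.setGcd S ∣ n :=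
    eventually_inf_principal.2 ((eventually_gt_atTop 0).mono fun n hn hdn => ⟨hn, hdn⟩)
  rw [isEquivalent_iff_tendsto_one]
  · have := hlim.div_const L
    rw [← hL, div_self hLpos.ne'] at this
    refine this.congr' ?_
    filter_upwards [hpos] with n hn
    obtain ⟨hn0, m, rfl⟩ := hn
    have hm : (0 : ℝ) < m := Nat.cast_pos.2 (Nat.pos_of_mul_pos_left hn0)
    -- For `n = d m`, `m ^ (-3/2) = d √d n ^ (-3/2)`. The `√d` cancels against the one in `L`, which
    -- leaves the factor `gcd S`.
    have hpow : ((Nat.setGcd S : ℝ) * m) ^ (-(3 / 2) : ℝ) =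
        (Nat.setGcd S * Real.sqrt (Nat.setGcd S))⁻¹ * ((m : ℝ) ^ (3 / 2 : ℝ))⁻¹ := by
      rw [Real.mul_rpow hd'.le hm.le, Real.rpow_neg hd'.le, Real.rpow_neg hm.le,
        show (3 / 2 : ℝ) = 1 + 1 / 2 by norm_num, Real.rpow_add hd', Real.rpow_one,
        ← Real.sqrt_eq_rpow]
    have hm' : (0 : ℝ) < (m : ℝ) ^ (3 / 2 : ℝ) := Real.rpow_pos_of_pos hm _
    simp only [Function.comp_apply, Pi.div_apply, Nat.mul_div_cancel_left m hd, normCount]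
    rw [zpow_neg, zpow_natCast, Nat.cast_mul, hpow, hL]
    field_simp
  · filter_upwards [hpos] with n hn
    have : (0 : ℝ) < (n : ℝ) ^ (-(3 / 2) : ℝ) := Real.rpow_pos_of_pos (Nat.cast_pos.2 hn.1) _
    positivity

end IsAdmissible

end CrossingFree
theorem mainTheorem7 (S : Set ℕ) (hne : S.Nonempty) (hpos : 0 ∉ S) (hS : S ≠ {1}) :
    -- the constants are well defined
    ((∃! t : ℝ, CrossingFree.IsTau S t) ∧
      Summable (fun s : S => CrossingFree.tau S ^ (s : ℕ)) ∧
      Summable (fun s : S => ((s : ℕ) : ℝ) * CrossingFree.tau S ^ (s : ℕ)) ∧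
      Summable (fun s : S =>
        ((s : ℕ) : ℝ) * (((s : ℕ) : ℝ) - 1) * CrossingFree.tau S ^ (s : ℕ)) ∧
      0 < CrossingFree.rho S ∧ 0 < CrossingFree.beta S) ∧
    -- singular expansion at `ρ_S` of the analytic continuation to a dented domain
    (∃ φ R : ℝ, 0 < φ ∧ φ < Real.pi / 2 ∧ 1 < R ∧ ∃ F : ℂ → ℂ,
      AnalyticOnNhd ℂ F
        (CrossingFree.indentedDisc (Nat.setGcd S) (CrossingFree.rho S) φ R) ∧
      (∀ x : ℂ, ‖x‖ < CrossingFree.rho S →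
        HasSum (fun n : ℕ => ((PowerSeries.coeff n (CrossingFree.genFun S) : ℕ) : ℂ) * x ^ n)
          (F x)) ∧
      (fun x : ℂ => F x - ((CrossingFree.alpha S : ℂ) -
          (CrossingFree.beta S : ℂ) * Complex.sqrt (1 - x / (CrossingFree.rho S : ℂ))))
        =O[𝓝[CrossingFree.indentedDisc (Nat.setGcd S) (CrossingFree.rho S) φ R]
            (CrossingFree.rho S : ℂ)]
          (fun x : ℂ => 1 - x / (CrossingFree.rho S : ℂ))) ∧
    -- asymptotics of the coefficients along the multiples of `gcd(S)`
    ((fun n : ℕ => ((PowerSeries.coeff n (CrossingFree.genFun S) : ℕ) : ℝ))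
      ~[atTop ⊓ 𝓟 {n : ℕ | Nat.setGcd S ∣ n}]
      (fun n : ℕ => (Nat.setGcd S : ℝ) * CrossingFree.beta S / (2 * Real.sqrt Real.pi) *
        (n : ℝ) ^ (-(3 / 2) : ℝ) * CrossingFree.rho S ^ (-(n : ℤ)))) ∧
    -- the other coefficients vanish
    (∀ n : ℕ, ¬ Nat.setGcd S ∣ n → PowerSeries.coeff n (CrossingFree.genFun S) = 0) := by

  have h : CrossingFree.IsAdmissible S := ⟨hne, hpos, hS⟩
  refine ⟨⟨CrossingFree.existsUnique_isTau hne hpos hS, h.summable_tau_pow,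
    h.summable_mul_tau_pow, h.summable_mul_sub_one_mul_tau_pow, h.rho_pos, h.beta_pos⟩, ?_, ?_, ?_⟩
  · simpa only [CrossingFree.genFun, PowerSeries.coeff_mk] using h.exists_expansion
  · simpa only [CrossingFree.genFun, PowerSeries.coeff_mk] using h.isEquivalent_count
  · intro n hn
    rw [CrossingFree.genFun, PowerSeries.coeff_mk]
    exact CrossingFree.count_eq_zero hn
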